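/- **Setting.** Let $d\ge 2$, $m\ge 2$, $\mathcal X=\mathbb R^d$, and let $\boldsymbol\theta$ be a random vector in $\mathbb R^d$ whose law $\mu_1$ is absolutely continuous with respect to Lebesgue measure. At epoch $k=1,2,\dots$ a question $X_k=(x^{(1)},\dots,x^{(m)})\in(\mathbb R^d)^m$ is asked. Its true response is the least index $z$ that maximizes $\boldsymbol\theta^Tx^{(z)}$. A signal $Y_k$ is observed in a measurable space $\mathcal Y$; given that the true response is $z$, it has density $f^{(z)}$ with respect to a fixed $\sigma$-finite measure on $\mathcal Y$ and is independent of $\boldsymbol\theta$ and of the past. A policy $\pi\in\Pi$ chooses $X_k$ as a measurable function of $Y_1,\dots,Y_{k-1}$ and of i.i.d. uniform random variables that are independent of everything else. Let $\mu_k$ be the posterior law of $\boldsymbol\theta$ after $k-1$ questions and signals, and let $\delta(\mu)=\inf_{v\ne0}\mu(\{\theta:\theta^Tv\ge0\})$. Let $\mathbb E^\pi[I(\boldsymbol\theta;Y_1,\dots,Y_K)]$ be the mutual information, in bits, between $\boldsymbol\theta$ and the first $K$ signals, averaged over the randomization of the policy. **Channel.** Assume that every $H(f^{(z)})=-\int f^{(z)}\log_2f^{(z)}$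 is finite. For $u$ in the probability simplex $\Delta^m$ put $\varphi(u;f)=H\big(\sum_zu^{(z)}f^{(z)}\big)-\sum_zu^{(z)}H(f^{(z)})$, and let $C(f)=\sup_{u\in\Delta^m}\varphi(u;f)$. Assume that the channel is admissible: there is $u_*\in\Delta^m$ with all components positive and $\varphi(u_*;f)=C(f)$. Let $R(f)\ge0$ be the least constant such that $C(f)-\varphi(u;f)\le R(f)\,\|u-u_*\|^2$ for all $u\in\Delta^m$ (Euclidean norm). **Theorem.** The least constant $R(f)$ exists. Let $\varepsilon=0$ if $m=2$, let $\varepsilon>0$ be arbitrary if $m>2$, and put $\boldsymbol\sigma_k=\big(\max u_*-(1-\delta(\boldsymbol\mu_k))+\varepsilon\big)^+$. Then for every $K\ge 0$ we have $\sup_{\pi'\in\Pi}\mathbb E^{\pi'}[I(\boldsymbol\theta;Y_1,\dots,Y_K)]\le K\,C(f)$, and there is a policy $\pi$ such that $$K\,C(f)-\sup_{\pi'\in\Pi}\mathbb E^{\pi'}[I(\boldsymbol\theta;Y_1,\dots,Y_K)]\;\le\;K\,C(f)-\mathbb E^{\pi}[I(\boldsymbol\theta;Y_1,\dots,Y_K)]\;\le\;R(f)\Big(1+\frac1{m-1}\Big)\sum_{k=1}^K\mathbb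 E^\pi[\boldsymbol\sigma_k^2]$$ $$\le\;K\,R(f)\Big(1+\frac1{m-1}\Big)\Big(\big(\max u_*-\tfrac12+\varepsilon\big)^+\Big)^2 .$$ Thus the rate of entropy reduction per question is within the constant $R(f)\big(1+\frac1{m-1}\big)\big((\max u_*-\frac12+\varepsilon)^+\big)^2$ of the largest conceivable rate $C(f)$. -/

import Mathlib

open MeasureTheory
open scoped ENNReal

noncomputable section

namespace PreferenceLearning

/-- A noise channel with `m` inputs: for every true response `z` a probability density `dens z`
on the signal space `𝒴` with respect to the reference measure `ν` (Lebesgue measure for continuous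
signals, counting measure for a discrete noise channel). -/
structure NoiseChannel (m : ℕ) {𝒴 : Type*} [MeasurableSpace 𝒴] (ν : Measure 𝒴) where
  dens : Fin m → 𝒴 → ℝ
  measurable_dens : ∀ z, Measurable (dens z)
  dens_nonneg : ∀ z y, 0 ≤ dens z y
  integral_dens : ∀ z, ∫ y, dens z y ∂ν = 1

/-- Differential entropy, in bits, of a density with respect to `ν`. -/
def entropy {𝒴 : Type*} [MeasurableSpace 𝒴] (ν : Measure 𝒴) (p : 𝒴 → ℝ) : ℝ :=
  ∫ y, -(p y * Real.logb 2 (p y)) ∂ν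

/-- The channel function `φ(u ; f) = H(∑ z, u z • f z) - ∑ z, u z * H(f z)`. -/
def channelFun {m : ℕ} {𝒴 : Type*} [MeasurableSpace 𝒴] {ν : Measure 𝒴}
    (f : NoiseChannel m ν) (u : Fin m → ℝ) : ℝ :=
  entropy ν (fun y => ∑ z, u z * f.dens z y) - ∑ z, u z * entropy ν (f.dens z)

/-- The channel capacity `C(f)`: the supremum of `φ(· ; f)` over the probability simplex. -/
def capacity {m : ℕ} {𝒴 : Type*} [MeasurableSpace 𝒴] {ν : Measure 𝒴}
    (f : NoiseChannel m ν) : ℝ :=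
  sSup (channelFun f '' stdSimplex ℝ (Fin m))

/-- The constants `R ≥ 0` with `C(f) - φ(u ; f) ≤ R ‖u - u_*‖²` (Euclidean norm) on the simplex. -/
def quadraticBounds {m : ℕ} {𝒴 : Type*} [MeasurableSpace 𝒴] {ν : Measure 𝒴}
    (f : NoiseChannel m ν) (ustar : Fin m → ℝ) : Set ℝ :=
  {R | 0 ≤ R ∧ ∀ u ∈ stdSimplex ℝ (Fin m),
    capacity f - channelFun f u ≤ R * ∑ z, (u z - ustar z) ^ 2}

/-- The best constant `R(f)` in the quadratic upper bound on the optimality gap. -/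
def gapConst {m : ℕ} {𝒴 : Type*} [MeasurableSpace 𝒴] {ν : Measure 𝒴}
    (f : NoiseChannel m ν) (ustar : Fin m → ℝ) : ℝ :=
  sInf (quadraticBounds f ustar)

/-- `A^(z)(X)`: the linear classifiers whose true response to the question `X` is `z`, that is,
for which `z` is the least index that maximizes `⟪θ, X i⟫`. -/
def region {d m : ℕ} (X : Fin m → EuclideanSpace ℝ (Fin d)) (z : Fin m) :
    Set (EuclideanSpace ℝ (Fin d)) :=
  {θ | (∀ i, z < i → inner ℝ θ (X i) ≤ inner ℝ θ (X z)) ∧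
    (∀ i, i < z → inner ℝ θ (X i) < inner ℝ θ (X z))}

/-- Density at `y` of the signal to the question `X` given the classifier `θ`: it is `f z y` for
the true response `z` of `θ` to `X`. -/
def signalDensity {d m : ℕ} {𝒴 : Type*} [MeasurableSpace 𝒴] {ν : Measure 𝒴}
    (f : NoiseChannel m ν) (X : Fin m → EuclideanSpace ℝ (Fin d))
    (θ : EuclideanSpace ℝ (Fin d)) (y : 𝒴) : ℝ≥0∞ :=
  ∑ z, (region X z).indicator (fun _ => ENNReal.ofReal (f.dens z y)) θ

/-- A (possibly randomized) policy with alternatives in all of `ℝ^d`. `ask k s y` is the next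
question after the `k` signals `y`, where `s` is a sequence of i.i.d. uniform variables. -/
structure Policy (d m : ℕ) (𝒴 : Type*) [MeasurableSpace 𝒴] where
  ask : (k : ℕ) → (ℕ → unitInterval) → (Fin k → 𝒴) → Fin m → EuclideanSpace ℝ (Fin d)
  measurable_ask : ∀ k, Measurable (Function.uncurry (ask k))

/-- The law of a sequence of i.i.d. random variables that are uniform on `[0, 1]`. -/
def seedLaw : Measure (ℕ → unitInterval) :=
  Measure.infinitePi (fun _ : ℕ => (volume : Measure unitInterval))

/-- Joint density of the first `n` signals at `y` given the classifier `θ` and the randomization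
`s`, under the policy `π`. Given the true responses, the signals are independent of each other
and of `θ`. -/
def likelihood {d m : ℕ} {𝒴 : Type*} [MeasurableSpace 𝒴] {ν : Measure 𝒴}
    (f : NoiseChannel m ν) (π : Policy d m 𝒴) (s : ℕ → unitInterval) {n : ℕ}
    (θ : EuclideanSpace ℝ (Fin d)) (y : Fin n → 𝒴) : ℝ≥0∞ :=
  ∏ k : Fin n,
    signalDensity f (π.ask k s (fun i : Fin k => y (Fin.castLE k.isLt.le i))) θ (y k)

/-- Joint law of the classifier (with prior `μ`) and the first `n` signals, given the
randomization `s`, under the policy `π`. -/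
def jointLaw {d m : ℕ} {𝒴 : Type*} [MeasurableSpace 𝒴] {ν : Measure 𝒴}
    (f : NoiseChannel m ν) (μ : Measure (EuclideanSpace ℝ (Fin d))) (π : Policy d m 𝒴)
    (s : ℕ → unitInterval) (n : ℕ) : Measure (EuclideanSpace ℝ (Fin d) × (Fin n → 𝒴)) :=
  (μ.prod (Measure.pi fun _ : Fin n => ν)).withDensity (fun p => likelihood f π s p.1 p.2)

/-- Law of the first `n` signals given the randomization `s`, under the policy `π`. -/
def signalLaw {d m : ℕ} {𝒴 : Type*} [MeasurableSpace 𝒴] {ν : Measure 𝒴}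
    (f : NoiseChannel m ν) (μ : Measure (EuclideanSpace ℝ (Fin d))) (π : Policy d m 𝒴)
    (s : ℕ → unitInterval) (n : ℕ) : Measure (Fin n → 𝒴) :=
  (jointLaw f μ π s n).map Prod.snd

/-- The posterior law of the classifier after the signals `y` (Bayes' rule), which is the prior of
the epoch `n + 1`. -/
def posterior {d m : ℕ} {𝒴 : Type*} [MeasurableSpace 𝒴] {ν : Measure 𝒴}
    (f : NoiseChannel m ν) (μ : Measure (EuclideanSpace ℝ (Fin d))) (π : Policy d m 𝒴)
    (s : ℕ → unitInterval) {n : ℕ} (y : Fin n → 𝒴) : Measure (EuclideanSpace ℝ (Fin d)) :=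
  (∫⁻ θ, likelihood f π s θ y ∂μ)⁻¹ • μ.withDensity (fun θ => likelihood f π s θ y)

/-- `E^π[I(θ ; Y_1, …, Y_K)]` in bits: the mutual information between the classifier and the first
`K` signals (the Kullback-Leibler divergence of their joint law from the product of the marginals),
averaged over the randomization of the policy. -/
def expectedInfo {d m : ℕ} {𝒴 : Type*} [MeasurableSpace 𝒴] {ν : Measure 𝒴}
    (f : NoiseChannel m ν) (μ : Measure (EuclideanSpace ℝ (Fin d))) (K : ℕ)
    (π : Policy d m 𝒴) : ℝ≥0∞ :=
  (∫⁻ s, InformationTheory.klDiv (jointLaw f μ π s K) (μ.prod (signalLaw f μ π s K)) ∂seedLaw)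
    / ENNReal.ofReal (Real.log 2)

/-- Halfspace depth of the origin. -/
def halfspaceDepth {d : ℕ} (μ : Measure (EuclideanSpace ℝ (Fin d))) : ℝ :=
  ⨅ v : {v : EuclideanSpace ℝ (Fin d) // v ≠ 0}, μ.real {θ | 0 ≤ inner ℝ θ v.1}

/-- `σ = (max u_* - (1 - δ(μ)) + ε)^+`. -/
def shortfall {d m : ℕ} (ustar : Fin m → ℝ) (ε : ℝ)
    (μ : Measure (EuclideanSpace ℝ (Fin d))) : ℝ :=
  max ((⨆ z, ustar z) - (1 - halfspaceDepth μ) + ε) 0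

/-- `E^π[σ_{k+1}²]`, where `σ_{k+1}` belongs to the posterior after `k` signals. -/
def expectedSqShortfall {d m : ℕ} {𝒴 : Type*} [MeasurableSpace 𝒴] {ν : Measure 𝒴}
    (f : NoiseChannel m ν) (μ : Measure (EuclideanSpace ℝ (Fin d))) (ustar : Fin m → ℝ) (ε : ℝ)
    (π : Policy d m 𝒴) (k : ℕ) : ℝ :=
  ∫ s, ∫ y, (shortfall ustar ε (posterior f μ π s y)) ^ 2 ∂(signalLaw f μ π s k) ∂seedLaw

end PreferenceLearning

end

/-! By the chain rule the problem reduces to a single question. The mutual information is the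
integral of the logarithm of likelihood over evidence. A new signal adds the logarithm of
`signalDensity` over the mixture density at `predictive`, the posterior law of the true response.
Given the past, this increment has mean `log 2` times the channel function at `predictive`. Hence
the information in bits is the sum of the means of `channelFun f (predictive ..)`
(`klDiv_jointLaw_div_log_two`). Each term is at most the capacity, and the loss is at most
`gapConst` times the summed mean squared distances of the predictive laws from `ustar`.

The constant is finite because relative entropy is bounded by a chi-squared distance, which is
quadratic in `u - ustar` when all components of `ustar` are positive. Optimality makes the
divergences of all inputs from the optimal output equal (`divergence_eq_of_optimal`), so no linear
term remains.

It remains to see which predictive laws a question can produce when the belief has depth `δ`. For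
two alternatives the masses of halfspaces fill `[δ, 1 - δ]`, since the punctured space is connected.
For more alternatives, every positive law whose components lie below the mass of one halfspace
occurs (`exists_question_measureReal_eq`). Here the belief is pushed to a plane and the circle of
directions is cut into consecutive arcs of the prescribed masses, each shorter than a half circle
(`exists_short_arcs`). Such arcs form the normal fan of a convex polygon, whose vertices serve as
the alternatives. Trimming the largest component of `ustar` to just below `1 - δ` and spreading the
excess evenly over the others costs at most `(1 + 1/(m-1)) σ²`.

A measurable selection turns these questions into a policy, built epoch by epoch without
randomization. As the depth of a belief without atoms on hyperplanes and the complementary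
halfspaces sum to at most one in pairs, `δ ≤ 1/2`, which gives the last bound. -/

namespace PreferenceLearning

/-! ### Channel function: integrability, quadratic expansion, optimality conditions -/

section Channel

variable {m : ℕ} {𝒴 : Type*} [MeasurableSpace 𝒴] {ν : Measure 𝒴} (f : NoiseChannel m ν)

/-- The output density of the channel for the input distribution `u`. -/
def NoiseChannel.mix (u : Fin m → ℝ) (y : 𝒴) : ℝ := ∑ z, u z * f.dens z y

/-- Every density has an integrable `p log p`. -/
def NoiseChannel.FiniteEntropy : Prop :=
  ∀ z, Integrable (fun y => f.dens z y * Real.log (f.dens z y)) ν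

theorem NoiseChannel.integrable_dens (z : Fin m) : Integrable (f.dens z) ν := by
  by_contra h
  have := f.integral_dens z
  rw [integral_undef h] at this
  exact zero_ne_one this

theorem NoiseChannel.lintegral_dens (z : Fin m) :
    ∫⁻ y, ENNReal.ofReal (f.dens z y) ∂ν = 1 := by
  rw [← ofReal_integral_eq_lintegral_ofReal (f.integrable_dens z)
    (Filter.Eventually.of_forall (f.dens_nonneg z)), f.integral_dens z, ENNReal.ofReal_one]

theorem NoiseChannel.measurable_mix (u : Fin m → ℝ) : Measurable (f.mix u) := by
  unfold NoiseChannel.mix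
  exact Finset.measurable_sum _ fun z _ => (f.measurable_dens z).const_mul _

variable {f} {u : Fin m → ℝ}

theorem NoiseChannel.mix_nonneg (hu : ∀ z, 0 ≤ u z) (y : 𝒴) : 0 ≤ f.mix u y :=
  Finset.sum_nonneg fun z _ => mul_nonneg (hu z) (f.dens_nonneg z y)

theorem NoiseChannel.mul_dens_le_mix (hu : ∀ z, 0 ≤ u z) (z : Fin m) (y : 𝒴) :
    u z * f.dens z y ≤ f.mix u y :=
  Finset.single_le_sum (f := fun z => u z * f.dens z y)
    (fun z _ => mul_nonneg (hu z) (f.dens_nonneg z y)) (Finset.mem_univ z)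

theorem NoiseChannel.integrable_mix (u : Fin m → ℝ) : Integrable (f.mix u) ν :=
  integrable_finsetSum _ fun z _ => (f.integrable_dens z).const_mul _

theorem NoiseChannel.integral_mix (hu : u ∈ stdSimplex ℝ (Fin m)) : ∫ y, f.mix u y ∂ν = 1 := by
  unfold NoiseChannel.mix
  rw [integral_finsetSum _ fun z _ => (f.integrable_dens z).const_mul _]
  simp only [integral_const_mul, f.integral_dens, mul_one]
  exact hu.2

theorem neg_one_le_mul_log {x : ℝ} (hx : 0 ≤ x) : -1 ≤ x * Real.log x := by
  rcases hx.eq_or_lt with rfl | hx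
  · simp
  · have h := Real.one_sub_inv_le_log_of_pos hx
    have h2 : x * (1 - x⁻¹) ≤ x * Real.log x := mul_le_mul_of_nonneg_left h hx.le
    have h3 : x * (1 - x⁻¹) = x - 1 := by field_simp
    linarith

theorem mul_log_div_le {a b : ℝ} (ha : 0 ≤ a) (hb : 0 < b) :
    a * (Real.log b - Real.log a) ≤ b - a := by
  rcases ha.eq_or_lt with rfl | ha
  · simpa using hb.le
  · have h := Real.log_le_sub_one_of_pos (div_pos hb ha)
    rw [Real.log_div hb.ne' ha.ne'] at h
    calc a * (Real.log b - Real.log a) ≤ a * (b / a - 1) := mul_le_mul_of_nonneg_left h ha.le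
      _ = b - a := by field_simp

/-- Lower bound for a component of the information density. -/
theorem NoiseChannel.dens_mul_log_sub_ge (hu : ∀ z, 0 ≤ u z) (z : Fin m) (y : 𝒴)
    (hz : 0 < u z) :
    f.dens z y - f.mix u y ≤ f.dens z y * (Real.log (f.dens z y) - Real.log (f.mix u y)) := by
  rcases (f.dens_nonneg z y).eq_or_lt with h0 | h0
  · rw [← h0]; simpa using f.mix_nonneg hu y
  · have hp : 0 < f.mix u y := (mul_pos hz h0).trans_le (f.mul_dens_le_mix hu z y)
    have := mul_log_div_le h0.le hp
    linarith

/-- Upper bound for a component of the information density. -/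
theorem NoiseChannel.mul_dens_mul_log_sub_le (hu : ∀ z, 0 ≤ u z) (z : Fin m) (y : 𝒴) :
    u z * f.dens z y * (Real.log (f.dens z y) - Real.log (f.mix u y)) ≤ f.dens z y := by
  rcases (f.dens_nonneg z y).eq_or_lt with h0 | h0
  · rw [← h0]; simp
  rcases (hu z).eq_or_lt with hz | hz
  · rw [← hz]; simpa using h0.le
  have hp := f.mul_dens_le_mix hu z y
  have h1 : Real.log (u z) + Real.log (f.dens z y) ≤ Real.log (f.mix u y) := by
    rw [← Real.log_mul hz.ne' h0.ne']
    exact Real.log_le_log (mul_pos hz h0) hp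
  have h2 := neg_one_le_mul_log hz.le
  calc u z * f.dens z y * (Real.log (f.dens z y) - Real.log (f.mix u y))
      ≤ u z * f.dens z y * (- Real.log (u z)) :=
        mul_le_mul_of_nonneg_left (by linarith) (by positivity)
    _ = f.dens z y * (-(u z * Real.log (u z))) := by ring
    _ ≤ f.dens z y * 1 := mul_le_mul_of_nonneg_left (by linarith) h0.le
    _ = f.dens z y := mul_one _

/-- The dominating function does not depend on `u`. This is what later permits integration with a
random input distribution in place of `u`. -/
theorem NoiseChannel.abs_info_le (hu : u ∈ stdSimplex ℝ (Fin m)) (z : Fin m) (y : 𝒴) :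
    |u z * f.dens z y * (Real.log (f.dens z y) - Real.log (f.mix u y))|
      ≤ 2 * ∑ z, f.dens z y := by
  have hs : f.dens z y ≤ ∑ z, f.dens z y :=
    Finset.single_le_sum (f := fun z => f.dens z y) (fun z _ => f.dens_nonneg z y)
      (Finset.mem_univ z)
  have h1 : ∀ i, u i ≤ 1 := fun i => (mem_Icc_of_mem_stdSimplex hu i).2
  have hm : f.mix u y ≤ ∑ z, f.dens z y :=
    Finset.sum_le_sum fun i _ => mul_le_of_le_one_left (f.dens_nonneg i y) (h1 i)
  have hd := f.dens_nonneg z y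
  have hp := f.mix_nonneg hu.1 y
  rw [abs_le]
  refine ⟨?_, (f.mul_dens_mul_log_sub_le hu.1 z y).trans (by linarith)⟩
  rcases (hu.1 z).eq_or_lt with hz | hz
  · rw [← hz]; simp only [zero_mul]; linarith
  have h2 := mul_le_mul_of_nonneg_left (f.dens_mul_log_sub_ge hu.1 z y hz) hz.le
  have h3 : u z * (f.mix u y - f.dens z y) ≤ f.mix u y := by
    have := mul_le_mul_of_nonneg_right (h1 z) hp
    have := mul_nonneg hz.le hd
    linarith
  rw [mul_assoc]
  linarith

theorem NoiseChannel.measurable_info (u : Fin m → ℝ) (z : Fin m) :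
    Measurable fun y => u z * f.dens z y * (Real.log (f.dens z y) - Real.log (f.mix u y)) :=
  ((f.measurable_dens z).const_mul _).mul
    ((f.measurable_dens z).log.sub (f.measurable_mix u).log)

theorem NoiseChannel.integrable_info (hu : u ∈ stdSimplex ℝ (Fin m)) (z : Fin m) :
    Integrable (fun y => u z * f.dens z y * (Real.log (f.dens z y) - Real.log (f.mix u y))) ν := by
  refine Integrable.mono' ((integrable_finsetSum Finset.univ
    fun z _ => f.integrable_dens z).const_mul 2) (f.measurable_info u z).aestronglyMeasurable ?_
  exact Filter.Eventually.of_forall fun y => f.abs_info_le hu z y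

/-- Writes the entropy integrand of the mixture through integrable pieces, so its integrability
follows from that of the components. -/
theorem NoiseChannel.mix_mul_log (u : Fin m → ℝ) (y : 𝒴) :
    f.mix u y * Real.log (f.mix u y) = ∑ z, (u z * (f.dens z y * Real.log (f.dens z y))
      - u z * f.dens z y * (Real.log (f.dens z y) - Real.log (f.mix u y))) := by
  conv_lhs => rw [NoiseChannel.mix, Finset.sum_mul]
  refine Finset.sum_congr rfl fun z _ => ?_
  rw [NoiseChannel.mix]
  ring

/-- `log 2 * φ(u)` is the mutual information, in nats, for the input distribution `u`. -/
theorem log_two_mul_channelFun (hf : f.FiniteEntropy) (hu : u ∈ stdSimplex ℝ (Fin m)) :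
    Real.log 2 * channelFun f u =
      ∑ z, ∫ y, u z * f.dens z y * (Real.log (f.dens z y) - Real.log (f.mix u y)) ∂ν := by
  have hl : Real.log 2 ≠ 0 := (Real.log_pos one_lt_two).ne'
  have h1 : ∀ p : 𝒴 → ℝ, Real.log 2 * entropy ν p = - ∫ y, p y * Real.log (p y) ∂ν := by
    intro p
    rw [entropy, ← integral_const_mul, ← integral_neg]
    refine integral_congr_ae (Filter.Eventually.of_forall fun y => ?_)
    simp only [Real.logb]
    field_simp
  have h2 : Real.log 2 * entropy ν (fun y => ∑ z, u z * f.dens z y) =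
      - ∑ z, (u z * ∫ y, f.dens z y * Real.log (f.dens z y) ∂ν -
        ∫ y, u z * f.dens z y * (Real.log (f.dens z y) - Real.log (f.mix u y)) ∂ν) := by
    rw [h1]
    change - ∫ y, f.mix u y * Real.log (f.mix u y) ∂ν = _
    simp_rw [f.mix_mul_log]
    rw [integral_finsetSum]
    swap
    · exact fun z _ => ((hf z).const_mul (u z)).sub (f.integrable_info hu z)
    congr 1
    refine Finset.sum_congr rfl fun z _ => ?_
    rw [integral_sub ((hf z).const_mul (u z)) (f.integrable_info hu z), integral_const_mul]
  rw [channelFun, mul_sub, h2, Finset.mul_sum, Finset.sum_sub_distrib]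
  have h3 : ∀ z, Real.log 2 * (u z * entropy ν (f.dens z)) =
      -(u z * ∫ y, f.dens z y * Real.log (f.dens z y) ∂ν) := by
    intro z
    rw [mul_left_comm, h1]
    ring
  simp_rw [h3, Finset.sum_neg_distrib]
  ring

theorem log_two_mul_channelFun_le (hf : f.FiniteEntropy) (hu : u ∈ stdSimplex ℝ (Fin m)) :
    Real.log 2 * channelFun f u ≤ m := by
  rw [log_two_mul_channelFun hf hu]
  calc _ ≤ ∑ z : Fin m, (1 : ℝ) := by
        refine Finset.sum_le_sum fun z _ => ?_
        rw [← f.integral_dens z]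
        exact integral_mono (f.integrable_info hu z) (f.integrable_dens z)
          (f.mul_dens_mul_log_sub_le hu.1 z)
    _ = m := by simp

theorem channelFun_nonneg (hf : f.FiniteEntropy) (hu : u ∈ stdSimplex ℝ (Fin m)) :
    0 ≤ channelFun f u := by
  have hl : 0 < Real.log 2 := Real.log_pos one_lt_two
  refine nonneg_of_mul_nonneg_right ?_ hl
  rw [log_two_mul_channelFun hf hu]
  refine Finset.sum_nonneg fun z _ => ?_
  rcases (hu.1 z).eq_or_lt with hz | hz
  · simp [← hz]
  have : (0 : ℝ) = ∫ y, u z * (f.dens z y - f.mix u y) ∂ν := by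
    rw [integral_const_mul, integral_sub (f.integrable_dens z) (f.integrable_mix u),
      f.integral_dens, f.integral_mix hu]
    simp
  rw [this]
  refine integral_mono (((f.integrable_dens z).sub (f.integrable_mix u)).const_mul _)
    (f.integrable_info hu z) fun y => ?_
  have := mul_le_mul_of_nonneg_left (f.dens_mul_log_sub_ge hu.1 z y hz) hz.le
  simpa only [mul_assoc] using this

theorem channelFun_le_capacity (hf : f.FiniteEntropy) (hu : u ∈ stdSimplex ℝ (Fin m)) :
    channelFun f u ≤ capacity f := by
  have hl : 0 < Real.log 2 := Real.log_pos one_lt_two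
  refine le_csSup ⟨m / Real.log 2, ?_⟩ (Set.mem_image_of_mem _ hu)
  rintro _ ⟨v, hv, rfl⟩
  rw [le_div_iff₀' hl]
  exact log_two_mul_channelFun_le hf hv

section Optimal

variable {w : Fin m → ℝ}

theorem NoiseChannel.integrable_dens_mul_log_sub (hw : w ∈ stdSimplex ℝ (Fin m))
    (hpos : ∀ z, 0 < w z) (z : Fin m) :
    Integrable (fun y => f.dens z y * (Real.log (f.dens z y) - Real.log (f.mix w y))) ν := by
  have h := (f.integrable_info hw z).const_mul (w z)⁻¹
  refine h.congr (Filter.Eventually.of_forall fun y => ?_)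
  have := (hpos z).ne'
  simp only
  field_simp

/-- Pointwise form of the bound of relative entropy by chi-squared. With `p`, `q` the mixtures for
`u`, `w`, the inequality `log x ≤ x - 1` gives `p log (p/q) ≤ (p-q)²/q + (p-q)`. Cauchy-Schwarz
bounds `(p-q)²` by `‖u-w‖² ∑ f_z²`, and `w_z f_z ≤ q` absorbs the denominator. The difference `p -
q` integrates to zero. -/
theorem NoiseChannel.mix_mul_log_sub_le (hpos : ∀ z, 0 < w z) (hu : ∀ z, 0 ≤ u z) (y : 𝒴) :
    f.mix u y * (Real.log (f.mix u y) - Real.log (f.mix w y)) ≤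
      (∑ z, (u z - w z) ^ 2) * (∑ z, (w z)⁻¹ * f.dens z y) + (f.mix u y - f.mix w y) := by
  have hw : ∀ z, 0 ≤ w z := fun z => (hpos z).le
  have hp := f.mix_nonneg hu y
  have hS : 0 ≤ (∑ z, (u z - w z) ^ 2) * (∑ z, (w z)⁻¹ * f.dens z y) :=
    mul_nonneg (Finset.sum_nonneg fun z _ => sq_nonneg _)
      (Finset.sum_nonneg fun z _ => mul_nonneg (inv_nonneg.2 (hw z)) (f.dens_nonneg z y))
  rcases (f.mix_nonneg hw y).eq_or_lt with h0 | h0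
  · have hd : ∀ z, f.dens z y = 0 := by
      intro z
      have h1 := f.mul_dens_le_mix hw z y
      rw [← h0] at h1
      have h2 := mul_nonneg (hw z) (f.dens_nonneg z y)
      exact (mul_eq_zero.1 (le_antisymm h1 h2)).resolve_left (hpos z).ne'
    simp [NoiseChannel.mix, hd]
  rcases hp.eq_or_lt with hp0 | hp0
  · rw [← hp0]
    simp only [zero_mul, zero_sub]
    -- When the mixture for `u` vanishes at `y`, every `z` with positive density there has `u z =
    -- 0`, so its squared difference is `w z ^ 2`.
    have h4 : f.mix w y ≤ (∑ z, (u z - w z) ^ 2) * (∑ z, (w z)⁻¹ * f.dens z y) := by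
      have h5 : ∀ z, u z * f.dens z y = 0 := fun z =>
        le_antisymm (hp0 ▸ f.mul_dens_le_mix hu z y) (mul_nonneg (hu z) (f.dens_nonneg z y))
      rw [Finset.mul_sum]
      refine Finset.sum_le_sum fun z _ => ?_
      rcases (f.dens_nonneg z y).eq_or_lt with h6 | h6
      · simp [← h6]
      have h7 : u z = 0 := (mul_eq_zero.1 (h5 z)).resolve_right h6.ne'
      have h8 : w z ^ 2 ≤ ∑ z, (u z - w z) ^ 2 := by
        have := Finset.single_le_sum (f := fun z => (u z - w z) ^ 2)
          (fun z _ => sq_nonneg _) (Finset.mem_univ z)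
        simpa [h7] using this
      calc w z * f.dens z y = w z ^ 2 * ((w z)⁻¹ * f.dens z y) := by
            have := (hpos z).ne'
            field_simp
        _ ≤ _ := mul_le_mul_of_nonneg_right h8
            (mul_nonneg (inv_nonneg.2 (hw z)) (f.dens_nonneg z y))
    linarith
  set p := f.mix u y with hpdef
  set q := f.mix w y with hqdef
  have h1 : Real.log p - Real.log q ≤ p / q - 1 := by
    rw [← Real.log_div hp0.ne' h0.ne']
    exact Real.log_le_sub_one_of_pos (div_pos hp0 h0)
  have h2 : p * (Real.log p - Real.log q) ≤ (p - q) ^ 2 / q + (p - q) := by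
    calc _ ≤ p * (p / q - 1) := mul_le_mul_of_nonneg_left h1 hp
      _ = _ := by field_simp; ring
  have h3 : (p - q) ^ 2 ≤ (∑ z, (u z - w z) ^ 2) * ∑ z, f.dens z y ^ 2 := by
    have : p - q = ∑ z, (u z - w z) * f.dens z y := by
      rw [hpdef, hqdef, NoiseChannel.mix, NoiseChannel.mix, ← Finset.sum_sub_distrib]
      exact Finset.sum_congr rfl fun z _ => by ring
    rw [this]
    exact Finset.sum_mul_sq_le_sq_mul_sq _ _ _
  have h4 : (∑ z, f.dens z y ^ 2) ≤ q * ∑ z, (w z)⁻¹ * f.dens z y := by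
    rw [Finset.mul_sum]
    refine Finset.sum_le_sum fun z _ => ?_
    have h5 := f.mul_dens_le_mix hw z y
    have h6 : f.dens z y ≤ q * (w z)⁻¹ := by
      rw [← div_eq_mul_inv, le_div_iff₀ (hpos z)]; linarith
    calc f.dens z y ^ 2 = f.dens z y * f.dens z y := sq _
      _ ≤ (q * (w z)⁻¹) * f.dens z y := mul_le_mul_of_nonneg_right h6 (f.dens_nonneg z y)
      _ = _ := by ring
  have h5 : (p - q) ^ 2 / q ≤ (∑ z, (u z - w z) ^ 2) * (∑ z, (w z)⁻¹ * f.dens z y) := by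
    rw [div_le_iff₀ h0]
    calc _ ≤ _ := h3
      _ ≤ (∑ z, (u z - w z) ^ 2) * (q * ∑ z, (w z)⁻¹ * f.dens z y) :=
        mul_le_mul_of_nonneg_left h4 (Finset.sum_nonneg fun z _ => sq_nonneg _)
      _ = _ := by ring
  linarith

/-- Quadratic lower bound for the channel function around a positive input distribution. -/
theorem sub_le_log_two_mul_channelFun (hf : f.FiniteEntropy) (hw : w ∈ stdSimplex ℝ (Fin m))
    (hpos : ∀ z, 0 < w z) (hu : u ∈ stdSimplex ℝ (Fin m)) :
    ∑ z, u z * ∫ y, f.dens z y * (Real.log (f.dens z y) - Real.log (f.mix w y)) ∂ν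
      - (∑ z, (u z - w z) ^ 2) * (∑ z, (w z)⁻¹) ≤ Real.log 2 * channelFun f u := by
  have hi := f.integrable_dens_mul_log_sub hw hpos
  -- Compensation identity: the divergence of the mixture for `u` from the mixture for `w` is the
  -- average divergence of the components from the latter, minus the information at `u`.
  have e : ∀ y, f.mix u y * (Real.log (f.mix u y) - Real.log (f.mix w y)) =
      ∑ z, (u z * (f.dens z y * (Real.log (f.dens z y) - Real.log (f.mix w y))) -
        u z * f.dens z y * (Real.log (f.dens z y) - Real.log (f.mix u y))) := by
    intro y
    conv_lhs => rw [NoiseChannel.mix, Finset.sum_mul]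
    refine Finset.sum_congr rfl fun z _ => ?_
    rw [← NoiseChannel.mix]
    ring
  have hint : Integrable (fun y => f.mix u y *
      (Real.log (f.mix u y) - Real.log (f.mix w y))) ν := by
    simp_rw [e]
    exact integrable_finsetSum _ fun z _ =>
      ((hi z).const_mul (u z)).sub (f.integrable_info hu z)
  have h1 : ∫ y, f.mix u y * (Real.log (f.mix u y) - Real.log (f.mix w y)) ∂ν =
      ∑ z, u z * ∫ y, f.dens z y * (Real.log (f.dens z y) - Real.log (f.mix w y)) ∂ν
        - Real.log 2 * channelFun f u := by
    rw [log_two_mul_channelFun hf hu, ← Finset.sum_sub_distrib]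
    simp_rw [e]
    rw [integral_finsetSum]
    swap
    · exact fun z _ => ((hi z).const_mul (u z)).sub (f.integrable_info hu z)
    refine Finset.sum_congr rfl fun z _ => ?_
    rw [integral_sub ((hi z).const_mul (u z)) (f.integrable_info hu z), integral_const_mul]
  have hj : Integrable (fun y => ∑ z, (w z)⁻¹ * f.dens z y) ν :=
    integrable_finsetSum _ fun z _ => (f.integrable_dens z).const_mul _
  have h2 := integral_mono hint ((hj.const_mul (∑ z, (u z - w z) ^ 2)).add
    ((f.integrable_mix u).sub (f.integrable_mix w))) (f.mix_mul_log_sub_le hpos hu.1)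
  have h3 : ∫ y, ((fun y => (∑ z, (u z - w z) ^ 2) * ∑ z, (w z)⁻¹ * f.dens z y) +
      (f.mix u - f.mix w)) y ∂ν = (∑ z, (u z - w z) ^ 2) * (∑ z, (w z)⁻¹) := by
    rw [integral_add' (hj.const_mul _) ((f.integrable_mix u).sub (f.integrable_mix w)),
      integral_sub' (f.integrable_mix u) (f.integrable_mix w), f.integral_mix hu,
      f.integral_mix hw, integral_const_mul,
      integral_finsetSum _ fun z _ => (f.integrable_dens z).const_mul _]
    simp [integral_const_mul, f.integral_dens]
  rw [h1] at h2
  have h4 := h2.trans_eq h3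
  linarith

theorem log_two_mul_channelFun_self (hf : f.FiniteEntropy) (hw : w ∈ stdSimplex ℝ (Fin m)) :
    Real.log 2 * channelFun f w =
      ∑ z, w z * ∫ y, f.dens z y * (Real.log (f.dens z y) - Real.log (f.mix w y)) ∂ν := by
  rw [log_two_mul_channelFun hf hw]
  refine Finset.sum_congr rfl fun z _ => ?_
  rw [← integral_const_mul]
  simp only [mul_assoc]

/-- All inputs have the same divergence from the output law of a positive capacity-achieving
input distribution. -/
theorem divergence_eq_of_optimal (hf : f.FiniteEntropy) (hw : w ∈ stdSimplex ℝ (Fin m))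
    (hpos : ∀ z, 0 < w z) (hopt : channelFun f w = capacity f) (a b : Fin m) :
    ∫ y, f.dens a y * (Real.log (f.dens a y) - Real.log (f.mix w y)) ∂ν ≤
      ∫ y, f.dens b y * (Real.log (f.dens b y) - Real.log (f.mix w y)) ∂ν := by
  rcases eq_or_ne a b with rfl | hab
  · exact le_rfl
  set D : Fin m → ℝ := fun z =>
    ∫ y, f.dens z y * (Real.log (f.dens z y) - Real.log (f.mix w y)) ∂ν with hD
  change D a ≤ D b
  set c := ∑ z, (w z)⁻¹
  have hl : 0 < Real.log 2 := Real.log_pos one_lt_two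
  -- Moving mass `t` from input `b` to input `a` gains `t * (D a - D b)` to first order and loses at
  -- most `2 t² c`. The optimum `w` leaves no net gain, and `t ≤ w b` keeps the perturbed point in
  -- the simplex.
  have key : ∀ t, 0 < t → t ≤ w b → t * (D a - D b) ≤ 2 * t ^ 2 * c := by
    intro t ht htb
    set v : Fin m → ℝ := w + Pi.single a t - Pi.single b t with hv
    have hvm : v ∈ stdSimplex ℝ (Fin m) := by
      refine ⟨fun z => ?_, ?_⟩
      · simp only [hv, Pi.sub_apply, Pi.add_apply, Pi.single_apply]
        have := (hpos z).le
        split_ifs with h1 h2 h2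
        · exact absurd (h1.symm.trans h2) hab
        · linarith
        · subst h2; linarith
        · linarith
      · simp [hv, Finset.sum_sub_distrib, Finset.sum_add_distrib, hw.2]
    have h1 := sub_le_log_two_mul_channelFun hf hw hpos hvm
    have h2 : Real.log 2 * channelFun f v ≤ ∑ z, w z * D z := by
      rw [← log_two_mul_channelFun_self hf hw, hopt]
      exact mul_le_mul_of_nonneg_left (channelFun_le_capacity hf hvm) hl.le
    have h3 : ∑ z, v z * D z = ∑ z, w z * D z + t * (D a - D b) := by
      simp [hv, Finset.sum_sub_distrib, Finset.sum_add_distrib, sub_mul, add_mul, Pi.single_apply]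
      ring
    have h4 : ∑ z, (v z - w z) ^ 2 = 2 * t ^ 2 := by
      have : ∀ z, (v z - w z) ^ 2 = (if z = a then t ^ 2 else 0) + if z = b then t ^ 2 else 0 := by
        intro z
        simp only [hv, Pi.sub_apply, Pi.add_apply, Pi.single_apply]
        split_ifs with h1 h2 h2
        · exact absurd (h1.symm.trans h2) hab
        · ring
        · ring
        · ring
      simp_rw [this, Finset.sum_add_distrib]
      simp
      ring
    change ∑ z, v z * D z - _ ≤ _ at h1
    rw [h3, h4] at h1
    linarith
  by_contra hlt
  push Not at hlt
  have hc : 0 < c := Finset.sum_pos (fun z _ => inv_pos.2 (hpos z)) ⟨a, Finset.mem_univ a⟩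
  set g := D a - D b with hg
  have hgpos : 0 < g := sub_pos.2 hlt
  -- With `t ≤ g / (4c)` the inequality `g ≤ 2tc` would force `g ≤ g / 2`.
  set t := min (w b) (g / (4 * c)) with ht
  have ht0 : 0 < t := lt_min (hpos b) (by positivity)
  have h5 := key t ht0 (min_le_left _ _)
  have h6 : t ≤ g / (4 * c) := min_le_right _ _
  rw [le_div_iff₀ (by positivity)] at h6
  have h7 : t * g ≤ t * (2 * t * c) := by linarith [show t * (2 * t * c) = 2 * t ^ 2 * c by ring]
  have h8 := le_of_mul_le_mul_left h7 ht0
  linarith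

/-- Since all divergences `D z` coincide, `∑ z, u z * D z` is constant on the simplex and equals
`log 2` times the capacity. Only the quadratic remainder is left. -/
theorem sum_inv_div_log_two_mem_quadraticBounds (hf : f.FiniteEntropy)
    (hw : w ∈ stdSimplex ℝ (Fin m)) (hpos : ∀ z, 0 < w z) (hopt : channelFun f w = capacity f) :
    (∑ z, (w z)⁻¹) / Real.log 2 ∈ quadraticBounds f w := by
  have hl : 0 < Real.log 2 := Real.log_pos one_lt_two
  refine ⟨div_nonneg (Finset.sum_nonneg fun z _ => inv_nonneg.2 (hpos z).le) hl.le,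
    fun u hu => ?_⟩
  have h1 := sub_le_log_two_mul_channelFun hf hw hpos hu
  have h2 := log_two_mul_channelFun_self hf hw
  have hne : Nonempty (Fin m) := by
    by_contra h
    rw [not_nonempty_iff] at h
    simpa using hw.2
  obtain ⟨a⟩ := hne
  set D : Fin m → ℝ := fun z =>
    ∫ y, f.dens z y * (Real.log (f.dens z y) - Real.log (f.mix w y)) ∂ν with hD
  have h3 : ∀ z, D z = D a := fun z =>
    le_antisymm (divergence_eq_of_optimal hf hw hpos hopt z a)
      (divergence_eq_of_optimal hf hw hpos hopt a z)
  have h4 : ∀ v ∈ stdSimplex ℝ (Fin m), ∑ z, v z * D z = D a := by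
    intro v hv
    simp_rw [h3, ← Finset.sum_mul, hv.2, one_mul]
  change _ = ∑ z, w z * D z at h2
  change ∑ z, u z * D z - _ ≤ _ at h1
  rw [h4 w hw, hopt] at h2
  rw [h4 u hu] at h1
  rw [div_mul_eq_mul_div, le_div_iff₀ hl]
  linarith

/-- The set of admissible constants is closed, being cut out by weak inequalities that are linear in
`R`, so its infimum belongs to it. -/
theorem isLeast_gapConst (hf : f.FiniteEntropy) (hw : w ∈ stdSimplex ℝ (Fin m))
    (hpos : ∀ z, 0 < w z) (hopt : channelFun f w = capacity f) :
    IsLeast (quadraticBounds f w) (gapConst f w) := by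
  have hne : (quadraticBounds f w).Nonempty :=
    ⟨_, sum_inv_div_log_two_mem_quadraticBounds hf hw hpos hopt⟩
  have hbdd : BddBelow (quadraticBounds f w) := ⟨0, fun R hR => hR.1⟩
  have hcl : IsClosed (quadraticBounds f w) := by
    have : quadraticBounds f w = Set.Ici 0 ∩ ⋂ u ∈ stdSimplex ℝ (Fin m),
        {R | capacity f - channelFun f u ≤ R * ∑ z, (u z - w z) ^ 2} := by
      ext R; simp [quadraticBounds]
    rw [this]
    exact isClosed_Ici.inter (isClosed_biInter fun u _ =>
      isClosed_le continuous_const (continuous_id.mul continuous_const))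
  exact ⟨hcl.csInf_mem hne hbdd, fun R hR => csInf_le hbdd hR⟩

end Optimal

end Channel

end PreferenceLearning

noncomputable section

namespace PreferenceLearning

/-! ### Response regions of a question -/

section Regions

variable {d m : ℕ}

/-- Measurability is needed jointly in question and classifier, because the question depends on past
signals. -/
theorem measurableSet_region_prod (z : Fin m) :
    MeasurableSet {p : (Fin m → EuclideanSpace ℝ (Fin d)) × EuclideanSpace ℝ (Fin d) |
      p.2 ∈ region p.1 z} := by
  have hm : ∀ i, Measurable fun p : (Fin m → EuclideanSpace ℝ (Fin d)) ×
      EuclideanSpace ℝ (Fin d) => inner ℝ p.2 (p.1 i) := fun i => by fun_prop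
  have : {p : (Fin m → EuclideanSpace ℝ (Fin d)) × EuclideanSpace ℝ (Fin d) |
      p.2 ∈ region p.1 z} =
      (⋂ i, {p | z < i → inner ℝ p.2 (p.1 i) ≤ inner ℝ p.2 (p.1 z)}) ∩
      ⋂ i, {p | i < z → inner ℝ p.2 (p.1 i) < inner ℝ p.2 (p.1 z)} := by
    ext p; simp [region]
  rw [this]
  refine (MeasurableSet.iInter fun i => ?_).inter (MeasurableSet.iInter fun i => ?_)
  · by_cases h : z < i
    · simpa [h] using measurableSet_le (hm i) (hm z)
    · simp [h]
  · by_cases h : i < z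
    · simpa [h] using measurableSet_lt (hm i) (hm z)
    · simp [h]

theorem measurableSet_region (X : Fin m → EuclideanSpace ℝ (Fin d)) (z : Fin m) :
    MeasurableSet (region X z) :=
  measurable_prodMk_left (measurableSet_region_prod z)

theorem exists_mem_region (hm : 0 < m) (X : Fin m → EuclideanSpace ℝ (Fin d))
    (θ : EuclideanSpace ℝ (Fin d)) : ∃ z, θ ∈ region X z := by
  classical
  have : Nonempty (Fin m) := ⟨⟨0, hm⟩⟩
  set S : Finset (Fin m) :=
    Finset.univ.filter fun z => ∀ i, inner ℝ θ (X i) ≤ inner ℝ θ (X z) with hS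
  have hne : S.Nonempty := by
    obtain ⟨z, -, hz⟩ := Finset.exists_max_image Finset.univ (fun z => inner ℝ θ (X z))
      Finset.univ_nonempty
    exact ⟨z, by simpa [hS] using fun i => hz i (Finset.mem_univ i)⟩
  have hmem := S.min'_mem hne
  have hmax : ∀ i, inner ℝ θ (X i) ≤ inner ℝ θ (X (S.min' hne)) := (Finset.mem_filter.1 hmem).2
  refine ⟨S.min' hne, fun i _ => hmax i, fun i hi => ?_⟩
  have hni : i ∉ S := fun h => absurd (S.min'_le i h) (not_le.2 hi)
  have : ∃ j, inner ℝ θ (X i) < inner ℝ θ (X j) := by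
    by_contra hcon
    push Not at hcon
    exact hni (by simpa [hS] using hcon)
  obtain ⟨j, hj⟩ := this
  exact hj.trans_le (hmax j)

theorem eq_of_mem_region {X : Fin m → EuclideanSpace ℝ (Fin d)}
    {θ : EuclideanSpace ℝ (Fin d)} {z w : Fin m} (hz : θ ∈ region X z) (hw : θ ∈ region X w) :
    z = w := by
  rcases lt_trichotomy z w with h | h | h
  · exact absurd (hz.1 w h) (not_le.2 (hw.2 z h))
  · exact h
  · exact absurd (hw.1 z h) (not_le.2 (hz.2 w h))

theorem pairwise_disjoint_region (X : Fin m → EuclideanSpace ℝ (Fin d)) :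
    Pairwise (Function.onFun Disjoint (region X)) := fun _ _ hzw =>
  Set.disjoint_left.2 fun _ hz hw => hzw (eq_of_mem_region hz hw)

theorem iUnion_region (hm : 0 < m) (X : Fin m → EuclideanSpace ℝ (Fin d)) :
    ⋃ z, region X z = Set.univ :=
  Set.eq_univ_of_forall fun θ => Set.mem_iUnion.2 (exists_mem_region hm X θ)

theorem sum_measureReal_region (hm : 0 < m) (X : Fin m → EuclideanSpace ℝ (Fin d))
    (μ : Measure (EuclideanSpace ℝ (Fin d))) [IsProbabilityMeasure μ] :
    ∑ z, μ.real (region X z) = 1 := by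
  have h := measureReal_iUnion_fintype (μ := μ) (pairwise_disjoint_region X)
    (measurableSet_region X)
  rw [← h, iUnion_region hm, probReal_univ]

variable {𝒴 : Type*} [MeasurableSpace 𝒴] {ν : Measure 𝒴} (f : NoiseChannel m ν)

theorem signalDensity_of_mem {X : Fin m → EuclideanSpace ℝ (Fin d)}
    {θ : EuclideanSpace ℝ (Fin d)} {z : Fin m} (hz : θ ∈ region X z) (y : 𝒴) :
    signalDensity f X θ y = ENNReal.ofReal (f.dens z y) := by
  rw [signalDensity, Finset.sum_eq_single z]
  · rw [Set.indicator_of_mem hz]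
  · intro w _ hw
    exact Set.indicator_of_notMem (fun h => hw (eq_of_mem_region h hz)) _
  · simp

theorem measurable_signalDensity :
    Measurable fun p : (Fin m → EuclideanSpace ℝ (Fin d)) × EuclideanSpace ℝ (Fin d) × 𝒴 =>
      signalDensity f p.1 p.2.1 p.2.2 := by
  classical
  unfold signalDensity
  refine Finset.measurable_sum _ fun z _ => ?_
  have h1 : MeasurableSet {p : (Fin m → EuclideanSpace ℝ (Fin d)) ×
      EuclideanSpace ℝ (Fin d) × 𝒴 | p.2.1 ∈ region p.1 z} :=
    (measurable_fst.prodMk (measurable_fst.comp measurable_snd)) (measurableSet_region_prod z)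
  have h2 : Measurable fun p : (Fin m → EuclideanSpace ℝ (Fin d)) ×
      EuclideanSpace ℝ (Fin d) × 𝒴 => ENNReal.ofReal (f.dens z p.2.2) :=
    ((f.measurable_dens z).comp (measurable_snd.comp measurable_snd)).ennreal_ofReal
  exact h2.indicator h1

theorem lintegral_signalDensity (hm : 0 < m) (X : Fin m → EuclideanSpace ℝ (Fin d))
    (θ : EuclideanSpace ℝ (Fin d)) : ∫⁻ y, signalDensity f X θ y ∂ν = 1 := by
  obtain ⟨z, hz⟩ := exists_mem_region hm X θ
  simp_rw [signalDensity_of_mem f hz, f.lintegral_dens]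

theorem signalDensity_ne_top (hm : 0 < m) (X : Fin m → EuclideanSpace ℝ (Fin d))
    (θ : EuclideanSpace ℝ (Fin d)) (y : 𝒴) : signalDensity f X θ y ≠ ∞ := by
  obtain ⟨z, hz⟩ := exists_mem_region hm X θ
  rw [signalDensity_of_mem f hz]
  exact ENNReal.ofReal_ne_top

end Regions

/-! ### Bayes' rule and the recursion of the joint laws -/

section Bayes

variable {d m : ℕ} {𝒴 : Type*} [MeasurableSpace 𝒴] {ν : Measure 𝒴} (f : NoiseChannel m ν)
  (μ : Measure (EuclideanSpace ℝ (Fin d))) (π : Policy d m 𝒴) (s : ℕ → unitInterval)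

theorem Policy.measurable_ask_right (n : ℕ) : Measurable (π.ask n s) :=
  (π.measurable_ask n).comp measurable_prodMk_left

theorem likelihood_snoc {n : ℕ} (θ : EuclideanSpace ℝ (Fin d)) (y : Fin n → 𝒴) (y' : 𝒴) :
    likelihood f π s θ (Fin.snoc y y' : Fin (n + 1) → 𝒴) =
      likelihood f π s θ y * signalDensity f (π.ask n s y) θ y' := by
  unfold likelihood
  rw [Fin.prod_univ_castSucc]
  congr 1
  · refine Finset.prod_congr rfl fun k _ => ?_
    rw [Fin.snoc_castSucc]
    congr 2
    funext i
    have : Fin.castLE k.castSucc.isLt.le i = (Fin.castLE k.isLt.le i).castSucc := by ext; simp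
    simp only [this, Fin.snoc_castSucc]
  · rw [Fin.snoc_last]
    congr 2
    funext i
    exact Fin.snoc_castSucc (α := fun _ => 𝒴) y' y i

theorem measurable_likelihood (n : ℕ) :
    Measurable fun p : EuclideanSpace ℝ (Fin d) × (Fin n → 𝒴) => likelihood f π s p.1 p.2 := by
  unfold likelihood
  refine Finset.measurable_prod _ fun k _ => ?_
  have h1 : Measurable fun p : EuclideanSpace ℝ (Fin d) × (Fin n → 𝒴) =>
      fun i : Fin k => p.2 (Fin.castLE k.isLt.le i) :=
    measurable_pi_lambda _ fun i => (measurable_pi_apply _).comp measurable_snd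
  have h2 : Measurable fun p : EuclideanSpace ℝ (Fin d) × (Fin n → 𝒴) =>
      π.ask k s fun i : Fin k => p.2 (Fin.castLE k.isLt.le i) :=
    (π.measurable_ask_right s k).comp h1
  have h3 : Measurable fun p : EuclideanSpace ℝ (Fin d) × (Fin n → 𝒴) => p.2 k :=
    (measurable_pi_apply k).comp measurable_snd
  have h4 := (measurable_signalDensity f).comp (h2.prodMk (measurable_fst.prodMk h3))
  exact h4

theorem likelihood_ne_top (hm : 0 < m) {n : ℕ} (θ : EuclideanSpace ℝ (Fin d))
    (y : Fin n → 𝒴) : likelihood f π s θ y ≠ ∞ :=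
  ENNReal.prod_ne_top fun k _ => signalDensity_ne_top f hm _ θ (y k)

/-- Density of the first signals at `y`. -/
def evidence {n : ℕ} (y : Fin n → 𝒴) : ℝ≥0∞ := ∫⁻ θ, likelihood f π s θ y ∂μ

/-- Conditional law of the true response to the next question, given the past signals. -/
def predictive {n : ℕ} (y : Fin n → 𝒴) (z : Fin m) : ℝ :=
  (posterior f μ π s y).real (region (π.ask n s y) z)

theorem measurable_evidence [SFinite μ] (n : ℕ) :
    Measurable fun y : Fin n → 𝒴 => evidence f μ π s y :=
  (measurable_likelihood f π s n).lintegral_prod_left'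

theorem posterior_absolutelyContinuous {n : ℕ} (y : Fin n → 𝒴) : posterior f μ π s y ≪ μ :=
  (Measure.AbsolutelyContinuous.smul_left (withDensity_absolutelyContinuous _ _) _)

theorem measurable_likelihood_left {n : ℕ} (y : Fin n → 𝒴) :
    Measurable fun θ => likelihood f π s θ y := by
  have h := (measurable_likelihood f π s n).comp (measurable_prodMk_right (y := y))
  exact h

theorem measurable_stepDensity (n : ℕ) :
    Measurable fun p : (EuclideanSpace ℝ (Fin d) × (Fin n → 𝒴)) × 𝒴 =>
      signalDensity f (π.ask n s p.1.2) p.1.1 p.2 := by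
  have h1 : Measurable fun p : (EuclideanSpace ℝ (Fin d) × (Fin n → 𝒴)) × 𝒴 =>
      π.ask n s p.1.2 :=
    (π.measurable_ask_right s n).comp (measurable_snd.comp measurable_fst)
  have h2 := (measurable_signalDensity f).comp
    (h1.prodMk ((measurable_fst.comp measurable_fst).prodMk measurable_snd))
  exact h2

theorem posterior_apply {n : ℕ} (y : Fin n → 𝒴) {A : Set (EuclideanSpace ℝ (Fin d))}
    (hA : MeasurableSet A) :
    posterior f μ π s y A = (evidence f μ π s y)⁻¹ * ∫⁻ θ in A, likelihood f π s θ y ∂μ := by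
  rw [posterior, Measure.smul_apply, withDensity_apply _ hA, smul_eq_mul]
  rfl

/-- Holds also when the evidence is `0` or `∞`: the conventions for `ℝ≥0∞` then make the posterior
the zero measure. Hence every posterior is finite, with no almost-everywhere proviso. -/
theorem posterior_univ_le {n : ℕ} (y : Fin n → 𝒴) : posterior f μ π s y Set.univ ≤ 1 := by
  rw [posterior_apply f μ π s y MeasurableSet.univ, setLIntegral_univ]
  exact ENNReal.inv_mul_le_one _

instance isFiniteMeasure_posterior {n : ℕ} (y : Fin n → 𝒴) :
    IsFiniteMeasure (posterior f μ π s y) :=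
  ⟨(posterior_univ_le f μ π s y).trans_lt ENNReal.one_lt_top⟩

theorem isProbabilityMeasure_posterior {n : ℕ} {y : Fin n → 𝒴} (h0 : evidence f μ π s y ≠ 0)
    (ht : evidence f μ π s y ≠ ∞) : IsProbabilityMeasure (posterior f μ π s y) := by
  refine ⟨?_⟩
  rw [posterior_apply f μ π s y MeasurableSet.univ, setLIntegral_univ]
  exact ENNReal.inv_mul_cancel h0 ht

theorem evidence_mul_posterior {n : ℕ} {y : Fin n → 𝒴} (ht : evidence f μ π s y ≠ ∞)
    {A : Set (EuclideanSpace ℝ (Fin d))} (hA : MeasurableSet A) :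
    evidence f μ π s y * posterior f μ π s y A = ∫⁻ θ in A, likelihood f π s θ y ∂μ := by
  rw [posterior_apply f μ π s y hA, ← mul_assoc]
  by_cases h0 : evidence f μ π s y = 0
  · rw [h0, zero_mul, zero_mul]
    refine (le_antisymm ?_ bot_le).symm
    rw [bot_eq_zero, ← h0]
    exact setLIntegral_le_lintegral _ _
  · rw [ENNReal.mul_inv_cancel h0 ht, one_mul]

theorem predictive_nonneg {n : ℕ} (y : Fin n → 𝒴) (z : Fin m) : 0 ≤ predictive f μ π s y z :=
  measureReal_nonneg

theorem predictive_mem_stdSimplex (hm : 0 < m) {n : ℕ} {y : Fin n → 𝒴}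
    (h0 : evidence f μ π s y ≠ 0) (ht : evidence f μ π s y ≠ ∞) :
    predictive f μ π s y ∈ stdSimplex ℝ (Fin m) := by
  have := isProbabilityMeasure_posterior f μ π s h0 ht
  exact ⟨predictive_nonneg f μ π s y, sum_measureReal_region hm _ _⟩

/-- Splitting the classifiers by their response to the next question shows that the conditional
density of the next signal is the channel mixture at the predictive law. -/
theorem evidence_snoc {n : ℕ} {y : Fin n → 𝒴} (ht : evidence f μ π s y ≠ ∞) (y' : 𝒴) :
    evidence f μ π s (Fin.snoc y y' : Fin (n + 1) → 𝒴) =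
      evidence f μ π s y * ENNReal.ofReal (f.mix (predictive f μ π s y) y') := by
  have h1 : ∀ θ, likelihood f π s θ (Fin.snoc y y' : Fin (n + 1) → 𝒴) =
      ∑ z, ENNReal.ofReal (f.dens z y') *
        (region (π.ask n s y) z).indicator (fun θ => likelihood f π s θ y) θ := by
    intro θ
    rw [likelihood_snoc, signalDensity, Finset.mul_sum]
    refine Finset.sum_congr rfl fun z _ => ?_
    by_cases h : θ ∈ region (π.ask n s y) z
    · simp [h, mul_comm]
    · simp [h]
  have hL := measurable_likelihood_left f π s y
  rw [evidence]
  simp_rw [h1]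
  rw [lintegral_finsetSum _ fun z _ =>
    (hL.indicator (measurableSet_region _ z)).const_mul _]
  rw [NoiseChannel.mix, ENNReal.ofReal_sum_of_nonneg fun z _ =>
    mul_nonneg (predictive_nonneg f μ π s y z) (f.dens_nonneg z y'), Finset.mul_sum]
  refine Finset.sum_congr rfl fun z _ => ?_
  rw [lintegral_const_mul _ (hL.indicator (measurableSet_region _ z)),
    lintegral_indicator (measurableSet_region _ z),
    ← evidence_mul_posterior f μ π s ht (measurableSet_region _ z),
    ENNReal.ofReal_mul (predictive_nonneg f μ π s y z), predictive, ofReal_measureReal]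
  ring

variable [SigmaFinite ν] [IsProbabilityMeasure μ]

theorem measurePreserving_snoc (n : ℕ) :
    MeasurePreserving (fun p : (Fin n → 𝒴) × 𝒴 => (Fin.snoc p.1 p.2 : Fin (n + 1) → 𝒴))
      ((Measure.pi fun _ : Fin n => ν).prod ν) (Measure.pi fun _ : Fin (n + 1) => ν) := by
  -- This equivalence puts the separated last coordinate first, hence the swap that follows.
  have h1 := (measurePreserving_piFinSuccAbove (fun _ : Fin (n + 1) => ν) (Fin.last n)).symm
  have h2 := h1.comp (Measure.measurePreserving_swap
    (μ := Measure.pi fun _ : Fin n => ν) (ν := ν))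
  have h3 : (fun p : (Fin n → 𝒴) × 𝒴 => (Fin.snoc p.1 p.2 : Fin (n + 1) → 𝒴)) =
      (MeasurableEquiv.piFinSuccAbove (fun _ => 𝒴) (Fin.last n)).symm ∘ Prod.swap := by
    funext p
    simp [MeasurableEquiv.piFinSuccAbove, Fin.insertNthEquiv, Fin.insertNth_last']
  rw [h3]
  exact h2

/-- Append a signal to the history. -/
def extend {n : ℕ} (p : (EuclideanSpace ℝ (Fin d) × (Fin n → 𝒴)) × 𝒴) :
    EuclideanSpace ℝ (Fin d) × (Fin (n + 1) → 𝒴) :=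
  (p.1.1, Fin.snoc p.1.2 p.2)

theorem measurePreserving_extend (n : ℕ) :
    MeasurePreserving (extend (d := d) (𝒴 := 𝒴) (n := n))
      ((μ.prod (Measure.pi fun _ : Fin n => ν)).prod ν)
      (μ.prod (Measure.pi fun _ : Fin (n + 1) => ν)) := by
  have h1 := (MeasurePreserving.id μ).prod (measurePreserving_snoc (ν := ν) n)
  exact h1.comp (measurePreserving_prodAssoc μ (Measure.pi fun _ : Fin n => ν) ν)

/-- Joint law of the classifier, the first `n` signals, and the next signal. -/
def stepLaw (n : ℕ) : Measure ((EuclideanSpace ℝ (Fin d) × (Fin n → 𝒴)) × 𝒴) :=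
  ((jointLaw f μ π s n).prod ν).withDensity
    fun p => signalDensity f (π.ask n s p.1.2) p.1.1 p.2

instance sFinite_jointLaw (n : ℕ) : SFinite (jointLaw f μ π s n) := by
  unfold jointLaw; infer_instance

/-- Together with `map_fst_stepLaw` this drives all inductions over epochs: `stepLaw` projects to
the joint law of `n` signals and is carried by `extend` to that of `n + 1`. -/
theorem map_stepLaw (n : ℕ) : (stepLaw f μ π s n).map extend = jointLaw f μ π s (n + 1) := by
  have hΦ := measurePreserving_extend (ν := ν) μ n
  have hL := measurable_likelihood f π s n
  have hL' := measurable_likelihood f π s (n + 1)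
  have h1 : stepLaw f μ π s n = ((μ.prod (Measure.pi fun _ : Fin n => ν)).prod ν).withDensity
      fun p => likelihood f π s (extend p).1 (extend p).2 := by
    have h2 : Measurable fun p : (EuclideanSpace ℝ (Fin d) × (Fin n → 𝒴)) × 𝒴 =>
      likelihood f π s p.1.1 p.1.2 := hL.comp measurable_fst
    rw [stepLaw, jointLaw, prod_withDensity_left hL,
      ← withDensity_mul _ h2 (measurable_stepDensity f π s n)]
    congr 1
    funext p
    exact (likelihood_snoc f π s p.1.1 p.1.2 p.2).symm
  rw [h1, jointLaw, ← hΦ.map_eq]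
  ext A hA
  rw [Measure.map_apply hΦ.measurable hA, withDensity_apply _ (hΦ.measurable hA),
    withDensity_apply _ hA, setLIntegral_map hA hL' hΦ.measurable]

theorem map_fst_stepLaw (hm : 0 < m) (n : ℕ) :
    (stepLaw f μ π s n).map Prod.fst = jointLaw f μ π s n := by
  ext A hA
  rw [Measure.map_apply measurable_fst hA, stepLaw, withDensity_apply _ (measurable_fst hA),
    ← Set.prod_univ, setLIntegral_prod _ (measurable_stepDensity f π s n).aemeasurable]
  simp [lintegral_signalDensity f hm]

theorem isProbabilityMeasure_jointLaw (hm : 0 < m) (n : ℕ) :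
    IsProbabilityMeasure (jointLaw f μ π s n) := by
  induction n with
  | zero =>
    have : jointLaw f μ π s 0 = μ.prod (Measure.pi fun _ : Fin 0 => ν) := by
      rw [jointLaw]
      conv_rhs => rw [← withDensity_one (μ := μ.prod (Measure.pi fun _ : Fin 0 => ν))]
      congr 1
    rw [this, Measure.pi_of_empty]
    infer_instance
  | succ n ih =>
    have hΦ := (measurePreserving_extend (ν := ν) μ n).measurable
    have h1 : IsProbabilityMeasure (stepLaw f μ π s n) := by
      refine ⟨?_⟩
      rw [← Set.preimage_univ (f := Prod.fst), ← Measure.map_apply measurable_fst .univ,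
        map_fst_stepLaw f μ π s hm]
      exact measure_univ
    rw [← map_stepLaw]
    exact Measure.isProbabilityMeasure_map hΦ.aemeasurable

theorem isProbabilityMeasure_signalLaw (hm : 0 < m) (n : ℕ) :
    IsProbabilityMeasure (signalLaw f μ π s n) := by
  have := isProbabilityMeasure_jointLaw f μ π s hm n
  exact Measure.isProbabilityMeasure_map measurable_snd.aemeasurable

theorem signalLaw_eq_withDensity (n : ℕ) : signalLaw f μ π s n =
    (Measure.pi fun _ : Fin n => ν).withDensity fun y => evidence f μ π s y := by
  have hL := measurable_likelihood f π s n
  ext A hA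
  rw [signalLaw, Measure.map_apply measurable_snd hA, jointLaw,
    withDensity_apply _ (measurable_snd hA), ← Set.univ_prod,
    ← lintegral_indicator (MeasurableSet.univ.prod hA),
    lintegral_prod_symm _ (hL.indicator (MeasurableSet.univ.prod hA)).aemeasurable,
    withDensity_apply _ hA, ← lintegral_indicator hA]
  refine lintegral_congr fun y => ?_
  by_cases h : y ∈ A
  · simp [h, evidence]
  · simp [h]

/-- The evidence is the density of a probability measure, so its integral is one. -/
theorem ae_evidence_ne_top (hm : 0 < m) (n : ℕ) :
    ∀ᵐ y ∂(Measure.pi fun _ : Fin n => ν), evidence f μ π s y ≠ ∞ := by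
  have h := isProbabilityMeasure_signalLaw f μ π s hm n
  have h1 : ∫⁻ y, evidence f μ π s y ∂(Measure.pi fun _ : Fin n => ν) = 1 := by
    rw [← setLIntegral_univ, ← withDensity_apply _ MeasurableSet.univ,
      ← signalLaw_eq_withDensity]
    exact measure_univ
  filter_upwards [ae_lt_top (measurable_evidence f μ π s n) (by rw [h1]; simp)] with y hy
  exact hy.ne

theorem ae_signalLaw_evidence (hm : 0 < m) (n : ℕ) :
    ∀ᵐ y ∂(signalLaw f μ π s n), evidence f μ π s y ≠ 0 ∧ evidence f μ π s y ≠ ∞ := by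
  rw [signalLaw_eq_withDensity,
    ae_withDensity_iff (measurable_evidence f μ π s n)]
  filter_upwards [ae_evidence_ne_top f μ π s hm n] with y hy h0
  exact ⟨h0, hy⟩

end Bayes

end PreferenceLearning

end

noncomputable section

set_option linter.unusedSectionVars false

/-! ### Chain rule for the mutual information -/

namespace PreferenceLearning

theorem _root_.MeasureTheory.Measure.map_withDensity_comp {α β : Type*} [MeasurableSpace α]
    [MeasurableSpace β] (μ : Measure α) {Φ : α → β} (hΦ : Measurable Φ) {g : β → ℝ≥0∞}
    (hg : Measurable g) : (μ.withDensity (g ∘ Φ)).map Φ = (μ.map Φ).withDensity g := by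
  ext A hA
  rw [Measure.map_apply hΦ hA, withDensity_apply _ (hΦ hA), withDensity_apply _ hA,
    setLIntegral_map hA hg hΦ]
  rfl

section Info

variable {d m : ℕ} {𝒴 : Type*} [MeasurableSpace 𝒴] {ν : Measure 𝒴} [SigmaFinite ν]
  (f : NoiseChannel m ν) (μ : Measure (EuclideanSpace ℝ (Fin d))) [IsProbabilityMeasure μ]
  (π : Policy d m 𝒴) (s : ℕ → unitInterval)

theorem measurable_posterior_apply {n : ℕ} {A : Set (EuclideanSpace ℝ (Fin d) × (Fin n → 𝒴))}
    (hA : MeasurableSet A) : Measurable fun y => posterior f μ π s y {θ | (θ, y) ∈ A} := by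
  have h1 : ∀ y, posterior f μ π s y {θ | (θ, y) ∈ A} =
      (evidence f μ π s y)⁻¹ * ∫⁻ θ, A.indicator (fun p => likelihood f π s p.1 p.2) (θ, y) ∂μ := by
    intro y
    have hAy : MeasurableSet {θ | (θ, y) ∈ A} := measurable_prodMk_right hA
    rw [posterior_apply f μ π s y hAy, ← lintegral_indicator hAy]
    rfl
  simp_rw [h1]
  exact (measurable_evidence f μ π s n).inv.mul
    ((measurable_likelihood f π s n).indicator hA).lintegral_prod_left'

/-- Histories for which the true response to the next question is `z`. -/
def responseSet (n : ℕ) (z : Fin m) : Set (EuclideanSpace ℝ (Fin d) × (Fin n → 𝒴)) :=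
  {p | p.1 ∈ region (π.ask n s p.2) z}

theorem measurableSet_responseSet (n : ℕ) (z : Fin m) : MeasurableSet (responseSet π s n z) := by
  have h : Measurable fun p : EuclideanSpace ℝ (Fin d) × (Fin n → 𝒴) => (π.ask n s p.2, p.1) :=
    ((π.measurable_ask_right s n).comp measurable_snd).prodMk measurable_fst
  exact h (measurableSet_region_prod z)

theorem measurable_predictive (n : ℕ) (z : Fin m) :
    Measurable fun y : Fin n → 𝒴 => predictive f μ π s y z :=
  (measurable_posterior_apply f μ π s (measurableSet_responseSet π s n z)).ennreal_toReal

/-- Bayes' rule in integrated form: evidence times posterior mass of a region is the likelihood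
integrated over that region. -/
theorem map_snd_restrict_jointLaw (hm : 0 < m) (n : ℕ) (z : Fin m) :
    ((jointLaw f μ π s n).restrict (responseSet π s n z)).map Prod.snd =
      (signalLaw f μ π s n).withDensity fun y => ENNReal.ofReal (predictive f μ π s y z) := by
  have hL := measurable_likelihood f π s n
  have hR := measurableSet_responseSet π s n z
  ext B hB
  have hB' : MeasurableSet (Prod.snd ⁻¹' B ∩ responseSet π s n z) := (measurable_snd hB).inter hR
  rw [Measure.map_apply measurable_snd hB, Measure.restrict_apply (measurable_snd hB), jointLaw,
    withDensity_apply _ hB', ← lintegral_indicator hB',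
    lintegral_prod_symm _ (hL.indicator hB').aemeasurable, signalLaw_eq_withDensity,
    ← withDensity_mul _ (measurable_evidence f μ π s n)
      (measurable_predictive f μ π s n z).ennreal_ofReal,
    withDensity_apply _ hB, ← lintegral_indicator hB]
  refine lintegral_congr_ae ?_
  filter_upwards [ae_evidence_ne_top f μ π s hm n] with y hy
  by_cases h : y ∈ B
  · have h1 : ∀ θ, (Prod.snd ⁻¹' B ∩ responseSet π s n z).indicator
        (fun p => likelihood f π s p.1 p.2) (θ, y) =
        (region (π.ask n s y) z).indicator (fun θ => likelihood f π s θ y) θ := by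
      intro θ
      by_cases h2 : θ ∈ region (π.ask n s y) z
      · rw [Set.indicator_of_mem h2, Set.indicator_of_mem]
        exact ⟨h, h2⟩
      · rw [Set.indicator_of_notMem h2, Set.indicator_of_notMem]
        exact fun h3 => h2 h3.2
    simp_rw [h1]
    rw [lintegral_indicator (measurableSet_region _ z),
      ← evidence_mul_posterior f μ π s hy (measurableSet_region _ z), Set.indicator_of_mem h,
      Pi.mul_apply, predictive, ofReal_measureReal]
  · simp [h]

/-- Joint law of the past signals and the next signal on the event that the true response to the
next question is `z`. -/
theorem map_restrict_stepLaw (hm : 0 < m) (n : ℕ) (z : Fin m) :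
    ((stepLaw f μ π s n).restrict (responseSet π s n z ×ˢ Set.univ)).map
        (Prod.map Prod.snd id) =
      ((signalLaw f μ π s n).prod ν).withDensity fun p =>
        ENNReal.ofReal (predictive f μ π s p.1 z * f.dens z p.2) := by
  have := isProbabilityMeasure_jointLaw f μ π s hm n
  have := isProbabilityMeasure_signalLaw f μ π s hm n
  have hR := measurableSet_responseSet π s n z
  have hd : Measurable fun p : (Fin n → 𝒴) × 𝒴 => ENNReal.ofReal (f.dens z p.2) :=
    ((f.measurable_dens z).comp measurable_snd).ennreal_ofReal
  have hp : Measurable fun p : (Fin n → 𝒴) × 𝒴 =>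
      ENNReal.ofReal (predictive f μ π s p.1 z) :=
    ((measurable_predictive f μ π s n z).comp measurable_fst).ennreal_ofReal
  have h1 : (stepLaw f μ π s n).restrict (responseSet π s n z ×ˢ Set.univ) =
      ((((jointLaw f μ π s n).restrict (responseSet π s n z)).prod ν).withDensity
        ((fun p : (Fin n → 𝒴) × 𝒴 => ENNReal.ofReal (f.dens z p.2)) ∘ Prod.map Prod.snd id)) := by
    have h2 : ((jointLaw f μ π s n).restrict (responseSet π s n z)).prod ν =
        ((jointLaw f μ π s n).prod ν).restrict (responseSet π s n z ×ˢ Set.univ) := by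
      rw [← Measure.prod_restrict, Measure.restrict_univ]
    rw [stepLaw, restrict_withDensity (hR.prod .univ), h2]
    refine withDensity_congr_ae ?_
    filter_upwards [ae_restrict_mem (hR.prod .univ)] with p hp
    exact signalDensity_of_mem f hp.1 p.2
  rw [h1, Measure.map_withDensity_comp _ (measurable_snd.prodMap measurable_id) hd,
    ← Measure.map_prod_map _ _ measurable_snd measurable_id, Measure.map_id,
    map_snd_restrict_jointLaw f μ π s hm, prod_withDensity_left
      (measurable_predictive f μ π s n z).ennreal_ofReal, ← withDensity_mul _ hp hd]
  congr 1
  funext p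
  exact (ENNReal.ofReal_mul (predictive_nonneg f μ π s p.1 z)).symm

theorem measurable_mix_predictive (n : ℕ) : Measurable fun p : (Fin n → 𝒴) × 𝒴 =>
    f.mix (predictive f μ π s p.1) p.2 := by
  unfold NoiseChannel.mix
  exact Finset.measurable_sum _ fun z _ =>
    ((measurable_predictive f μ π s n z).comp measurable_fst).mul
      ((f.measurable_dens z).comp measurable_snd)

/-- Information gained from one more signal. -/
def stepInfo (n : ℕ) (p : (EuclideanSpace ℝ (Fin d) × (Fin n → 𝒴)) × 𝒴) : ℝ :=
  Real.log (signalDensity f (π.ask n s p.1.2) p.1.1 p.2).toReal -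
    Real.log (f.mix (predictive f μ π s p.1.2) p.2)

/-- The bound of `abs_info_le` is uniform in the input distribution, so it applies with the
predictive law of each history and is integrable on the product. -/
theorem integrable_response_info (hm : 0 < m) (n : ℕ) (z : Fin m) :
    Integrable (fun p : (Fin n → 𝒴) × 𝒴 => predictive f μ π s p.1 z * f.dens z p.2 *
      (Real.log (f.dens z p.2) - Real.log (f.mix (predictive f μ π s p.1) p.2)))
      ((signalLaw f μ π s n).prod ν) := by
  have := isProbabilityMeasure_signalLaw f μ π s hm n
  have hb : Integrable (fun y => 2 * ∑ z, f.dens z y) ν :=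
    (integrable_finsetSum Finset.univ fun z _ => f.integrable_dens z).const_mul 2
  refine Integrable.mono' (hb.comp_snd (signalLaw f μ π s n)) ?_ ?_
  · refine Measurable.aestronglyMeasurable ?_
    exact (((measurable_predictive f μ π s n z).comp measurable_fst).mul
      ((f.measurable_dens z).comp measurable_snd)).mul
      (((f.measurable_dens z).comp measurable_snd).log.sub
        (measurable_mix_predictive f μ π s n).log)
  · have h1 := (Measure.quasiMeasurePreserving_fst (μ := signalLaw f μ π s n) (ν := ν)).ae
      (ae_signalLaw_evidence f μ π s hm n)
    filter_upwards [h1] with p hp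
    exact f.abs_info_le (predictive_mem_stdSimplex f μ π s hm hp.1 hp.2) z p.2

theorem integrableOn_and_setIntegral_stepInfo (hm : 0 < m) (n : ℕ) (z : Fin m) :
    IntegrableOn (stepInfo f μ π s n) (responseSet π s n z ×ˢ Set.univ) (stepLaw f μ π s n) ∧
    ∫ p in responseSet π s n z ×ˢ Set.univ, stepInfo f μ π s n p ∂(stepLaw f μ π s n) =
      ∫ p : (Fin n → 𝒴) × 𝒴, predictive f μ π s p.1 z * f.dens z p.2 *
      (Real.log (f.dens z p.2) - Real.log (f.mix (predictive f μ π s p.1) p.2))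
      ∂((signalLaw f μ π s n).prod ν) := by
  have hR : MeasurableSet (responseSet π s n z ×ˢ (Set.univ : Set 𝒴)) :=
    (measurableSet_responseSet π s n z).prod .univ
  set G : (Fin n → 𝒴) × 𝒴 → ℝ := fun p =>
    Real.log (f.dens z p.2) - Real.log (f.mix (predictive f μ π s p.1) p.2) with hG
  have hGm : Measurable G := ((f.measurable_dens z).comp measurable_snd).log.sub
    (measurable_mix_predictive f μ π s n).log
  have hw : Measurable fun p : (Fin n → 𝒴) × 𝒴 =>
      ENNReal.ofReal (predictive f μ π s p.1 z * f.dens z p.2) :=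
    (((measurable_predictive f μ π s n z).comp measurable_fst).mul
      ((f.measurable_dens z).comp measurable_snd)).ennreal_ofReal
  have hΦ : Measurable (Prod.map Prod.snd id :
      (EuclideanSpace ℝ (Fin d) × (Fin n → 𝒴)) × 𝒴 → (Fin n → 𝒴) × 𝒴) :=
    measurable_snd.prodMap measurable_id
  have hmap := map_restrict_stepLaw f μ π s hm n z
  -- Once the true response is fixed, the gain depends on the classifier no more; it factors through
  -- the past signals and the new one.
  have hcongr : stepInfo f μ π s n =ᵐ[(stepLaw f μ π s n).restrict
      (responseSet π s n z ×ˢ Set.univ)] G ∘ Prod.map Prod.snd id := by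
    filter_upwards [ae_restrict_mem hR] with p hp
    simp only [stepInfo, hG, Function.comp, Prod.map]
    rw [signalDensity_of_mem f hp.1, ENNReal.toReal_ofReal (f.dens_nonneg z p.2)]
    rfl
  have hreal : ∀ p : (Fin n → 𝒴) × 𝒴,
      (ENNReal.ofReal (predictive f μ π s p.1 z * f.dens z p.2)).toReal • G p =
      predictive f μ π s p.1 z * f.dens z p.2 *
      (Real.log (f.dens z p.2) - Real.log (f.mix (predictive f μ π s p.1) p.2)) := by
    intro p
    rw [ENNReal.toReal_ofReal
      (mul_nonneg (predictive_nonneg f μ π s p.1 z) (f.dens_nonneg z p.2)), smul_eq_mul]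
  have hint : Integrable G (((stepLaw f μ π s n).restrict
      (responseSet π s n z ×ˢ Set.univ)).map (Prod.map Prod.snd id)) := by
    rw [hmap, integrable_withDensity_iff_integrable_smul' hw (by simp)]
    simp_rw [hreal]
    exact integrable_response_info f μ π s hm n z
  refine ⟨(hint.comp_measurable hΦ).congr hcongr.symm, ?_⟩
  rw [integral_congr_ae hcongr]
  have h3 := integral_map hΦ.aemeasurable hint.aestronglyMeasurable
  rw [hmap, integral_withDensity_eq_integral_toReal_smul hw (by simp)] at h3
  simp_rw [hreal] at h3
  exact h3.symm

theorem iUnion_responseSet (hm : 0 < m) (n : ℕ) :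
    ⋃ z, responseSet π s n z ×ˢ (Set.univ : Set 𝒴) = Set.univ := by
  refine Set.eq_univ_of_forall fun p => Set.mem_iUnion.2 ?_
  obtain ⟨z, hz⟩ := exists_mem_region hm (π.ask n s p.1.2) p.1.1
  exact ⟨z, hz, trivial⟩

theorem integrable_stepInfo (hm : 0 < m) (n : ℕ) :
    Integrable (stepInfo f μ π s n) (stepLaw f μ π s n) := by
  rw [← integrableOn_univ, ← iUnion_responseSet π s hm n, integrableOn_finite_iUnion]
  exact fun z => (integrableOn_and_setIntegral_stepInfo f μ π s hm n z).1

/-- Obtained from Fubini's theorem: almost everywhere the channel function is, up to the factor `log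
2`, a partial integral of the integrable response terms. -/
theorem integrable_channelFun_predictive (hf : f.FiniteEntropy) (hm : 0 < m) (n : ℕ) :
    Integrable (fun y => channelFun f (predictive f μ π s y)) (signalLaw f μ π s n) := by
  have := isProbabilityMeasure_signalLaw f μ π s hm n
  have h1 := integrable_finsetSum (Finset.univ : Finset (Fin m)) fun z _ =>
    (integrable_response_info f μ π s hm n z).integral_prod_left
  refine (h1.const_mul (Real.log 2)⁻¹).congr ?_
  filter_upwards [ae_signalLaw_evidence f μ π s hm n] with y hy
  rw [← log_two_mul_channelFun hf (predictive_mem_stdSimplex f μ π s hm hy.1 hy.2),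
    inv_mul_cancel_left₀ (Real.log_pos one_lt_two).ne']

theorem integral_stepInfo (hf : f.FiniteEntropy) (hm : 0 < m) (n : ℕ) :
    ∫ p, stepInfo f μ π s n p ∂(stepLaw f μ π s n) =
      Real.log 2 * ∫ y, channelFun f (predictive f μ π s y) ∂(signalLaw f μ π s n) := by
  have := isProbabilityMeasure_signalLaw f μ π s hm n
  have hi := integrableOn_and_setIntegral_stepInfo f μ π s hm n
  rw [← setIntegral_univ, ← iUnion_responseSet π s hm n,
    integral_iUnion_fintype (fun z => (measurableSet_responseSet π s n z).prod .univ) ?_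
      fun z => (hi z).1]
  · have h1 : ∀ z, ∫ p in responseSet π s n z ×ˢ Set.univ, stepInfo f μ π s n p
        ∂(stepLaw f μ π s n) = ∫ y, ∫ y', predictive f μ π s y z * f.dens z y' *
          (Real.log (f.dens z y') - Real.log (f.mix (predictive f μ π s y) y')) ∂ν
          ∂(signalLaw f μ π s n) := fun z => by
      rw [(hi z).2, integral_prod _ (integrable_response_info f μ π s hm n z)]
    simp_rw [h1]
    rw [← integral_finsetSum _ fun z _ =>
      (integrable_response_info f μ π s hm n z).integral_prod_left, ← integral_const_mul]
    refine integral_congr_ae ?_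
    filter_upwards [ae_signalLaw_evidence f μ π s hm n] with y hy
    rw [log_two_mul_channelFun hf (predictive_mem_stdSimplex f μ π s hm hy.1 hy.2)]
  · intro z w hzw
    refine Set.disjoint_left.2 fun p hz hw => hzw (eq_of_mem_region hz.1 hw.1)

/-- Logarithm of the density of the joint law with respect to the product of the marginals. -/
def infoDensity (n : ℕ) (p : EuclideanSpace ℝ (Fin d) × (Fin n → 𝒴)) : ℝ :=
  Real.log (likelihood f π s p.1 p.2).toReal - Real.log (evidence f μ π s p.2).toReal

theorem ae_jointLaw_evidence (hm : 0 < m) (n : ℕ) : ∀ᵐ p ∂(jointLaw f μ π s n),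
    likelihood f π s p.1 p.2 ≠ 0 ∧ evidence f μ π s p.2 ≠ 0 ∧ evidence f μ π s p.2 ≠ ∞ := by
  have h1 : ∀ᵐ p ∂(jointLaw f μ π s n), likelihood f π s p.1 p.2 ≠ 0 := by
    rw [jointLaw, ae_withDensity_iff (measurable_likelihood f π s n)]
    exact Filter.Eventually.of_forall fun p hp => hp
  have h2 := ae_of_ae_map measurable_snd.aemeasurable (ae_signalLaw_evidence f μ π s hm n)
  filter_upwards [h1, h2] with p hp hp'
  exact ⟨hp, hp'⟩

theorem jointLaw_eq_withDensity_prod (hm : 0 < m) (n : ℕ) : jointLaw f μ π s n =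
    (μ.prod (signalLaw f μ π s n)).withDensity
      fun p => likelihood f π s p.1 p.2 / evidence f μ π s p.2 := by
  have hL := measurable_likelihood f π s n
  have hev : Measurable fun p : EuclideanSpace ℝ (Fin d) × (Fin n → 𝒴) =>
    evidence f μ π s p.2 := (measurable_evidence f μ π s n).comp measurable_snd
  have hq : Measurable fun p : EuclideanSpace ℝ (Fin d) × (Fin n → 𝒴) =>
    likelihood f π s p.1 p.2 / evidence f μ π s p.2 := hL.div hev
  rw [signalLaw_eq_withDensity, prod_withDensity_right (measurable_evidence f μ π s n),
    ← withDensity_mul _ hev hq, jointLaw]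
  refine withDensity_congr_ae ?_
  have h := ae_jointLaw_evidence f μ π s hm n
  rw [jointLaw, ae_withDensity_iff hL] at h
  filter_upwards [h] with p hp
  rw [Pi.mul_apply]
  by_cases h0 : likelihood f π s p.1 p.2 = 0
  · simp [h0]
  · exact (ENNReal.mul_div_cancel (hp h0).2.1 (hp h0).2.2).symm

/-- The log-likelihood ratio of the joint law to the product law is `infoDensity` almost everywhere,
because the density is likelihood over evidence. -/
theorem klDiv_jointLaw (hm : 0 < m) (n : ℕ)
    (hint : Integrable (infoDensity f μ π s n) (jointLaw f μ π s n)) :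
    InformationTheory.klDiv (jointLaw f μ π s n) (μ.prod (signalLaw f μ π s n)) =
      ENNReal.ofReal (∫ p, infoDensity f μ π s n p ∂(jointLaw f μ π s n)) := by
  have := isProbabilityMeasure_jointLaw f μ π s hm n
  have := isProbabilityMeasure_signalLaw f μ π s hm n
  have hL := measurable_likelihood f π s n
  have hev : Measurable fun p : EuclideanSpace ℝ (Fin d) × (Fin n → 𝒴) =>
    evidence f μ π s p.2 := (measurable_evidence f μ π s n).comp measurable_snd
  have heq := jointLaw_eq_withDensity_prod f μ π s hm n
  have hac : jointLaw f μ π s n ≪ μ.prod (signalLaw f μ π s n) := by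
    rw [heq]; exact withDensity_absolutelyContinuous _ _
  have h1 : (jointLaw f μ π s n).rnDeriv (μ.prod (signalLaw f μ π s n))
      =ᵐ[jointLaw f μ π s n] fun p => likelihood f π s p.1 p.2 / evidence f μ π s p.2 := by
    have h := Measure.rnDeriv_withDensity (μ.prod (signalLaw f μ π s n)) (hL.div hev)
    change ((μ.prod (signalLaw f μ π s n)).withDensity
      fun p => likelihood f π s p.1 p.2 / evidence f μ π s p.2).rnDeriv _ =ᵐ[_] _ at h
    rw [← heq] at h
    exact hac.ae_le h
  have h2 : llr (jointLaw f μ π s n) (μ.prod (signalLaw f μ π s n))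
      =ᵐ[jointLaw f μ π s n] infoDensity f μ π s n := by
    filter_upwards [h1, ae_jointLaw_evidence f μ π s hm n] with p hp hp'
    rw [llr, hp, ENNReal.toReal_div, Real.log_div, infoDensity]
    · exact ENNReal.toReal_ne_zero.2 ⟨hp'.1, likelihood_ne_top f π s hm _ _⟩
    · exact ENNReal.toReal_ne_zero.2 hp'.2
  rw [InformationTheory.klDiv_of_ac_of_integrable hac (hint.congr h2.symm),
    integral_congr_ae h2]
  -- The mass correction in `klDiv` cancels, as both measures are probabilities.
  simp

/-- Likelihood and evidence both acquire one factor per signal. The identity is only almost sure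
because splitting the logarithms needs nonzero factors; these come from the joint laws at both
epochs. -/
theorem infoDensity_extend (hm : 0 < m) (n : ℕ) : ∀ᵐ p ∂(stepLaw f μ π s n),
    infoDensity f μ π s (n + 1) (extend p) = infoDensity f μ π s n p.1 + stepInfo f μ π s n p := by
  have hΦ := (measurePreserving_extend (ν := ν) μ n).measurable
  have h1 := ae_jointLaw_evidence f μ π s hm (n + 1)
  rw [← map_stepLaw] at h1
  have h2 := ae_of_ae_map hΦ.aemeasurable h1
  have h3 := ae_jointLaw_evidence f μ π s hm n
  rw [← map_fst_stepLaw f μ π s hm] at h3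
  have h4 := ae_of_ae_map measurable_fst.aemeasurable h3
  filter_upwards [h2, h4] with p hp hp'
  have e1 := likelihood_snoc f π s p.1.1 p.1.2 p.2
  have e2 := evidence_snoc f μ π s hp'.2.2 p.2
  have hp1 := hp.1
  have hp2 := hp.2.1
  simp only [extend] at hp1 hp2 ⊢
  rw [e1] at hp1
  rw [e2] at hp2
  simp only [infoDensity, stepInfo]
  rw [e1, e2, ENNReal.toReal_mul, ENNReal.toReal_mul, Real.log_mul, Real.log_mul,
    ENNReal.toReal_ofReal (f.mix_nonneg (predictive_nonneg f μ π s p.1.2) p.2)]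
  · ring
  · exact ENNReal.toReal_ne_zero.2 hp'.2
  · exact ENNReal.toReal_ne_zero.2 ⟨right_ne_zero_of_mul hp2, ENNReal.ofReal_ne_top⟩
  · exact ENNReal.toReal_ne_zero.2 ⟨hp'.1, likelihood_ne_top f π s hm _ _⟩
  · exact ENNReal.toReal_ne_zero.2
      ⟨right_ne_zero_of_mul hp1, signalDensity_ne_top f hm _ _ _⟩

theorem infoDensity_zero (p : EuclideanSpace ℝ (Fin d) × (Fin 0 → 𝒴)) :
    infoDensity f μ π s 0 p = 0 := by
  simp [infoDensity, evidence, likelihood]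

theorem integrable_and_integral_infoDensity (hf : f.FiniteEntropy) (hm : 0 < m) (n : ℕ) :
    Integrable (infoDensity f μ π s n) (jointLaw f μ π s n) ∧
    ∫ p, infoDensity f μ π s n p ∂(jointLaw f μ π s n) = Real.log 2 *
      ∑ k ∈ Finset.range n, ∫ y, channelFun f (predictive f μ π s y) ∂(signalLaw f μ π s k) := by
  induction n with
  | zero =>
    have h : infoDensity f μ π s 0 = fun _ => 0 := funext (infoDensity_zero f μ π s)
    rw [h]
    simp
  | succ n ih =>
    have hΦ := (measurePreserving_extend (ν := ν) μ n).measurable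
    have h1 := infoDensity_extend f μ π s hm n
    have hi1 : Integrable (fun p => infoDensity f μ π s n p.1) (stepLaw f μ π s n) := by
      have h2 := ih.1
      rw [← map_fst_stepLaw f μ π s hm] at h2
      exact h2.comp_measurable measurable_fst
    have hi2 := integrable_stepInfo f μ π s hm n
    have hmeas : Measurable (infoDensity f μ π s (n + 1)) :=
      (measurable_likelihood f π s (n + 1)).ennreal_toReal.log.sub
        ((measurable_evidence f μ π s (n + 1)).comp measurable_snd).ennreal_toReal.log
    have hi3 : Integrable (infoDensity f μ π s (n + 1) ∘ extend) (stepLaw f μ π s n) :=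
      (hi1.add hi2).congr (h1.mono fun p hp => hp.symm)
    rw [← map_stepLaw]
    refine ⟨(integrable_map_measure hmeas.aestronglyMeasurable hΦ.aemeasurable).2 hi3, ?_⟩
    rw [integral_map hΦ.aemeasurable hmeas.aestronglyMeasurable, integral_congr_ae h1,
      integral_add hi1 hi2, integral_stepInfo f μ π s hf hm, Finset.sum_range_succ, mul_add,
      ← ih.2]
    congr 1
    have h2 : AEStronglyMeasurable (infoDensity f μ π s n)
        ((stepLaw f μ π s n).map Prod.fst) := by
      rw [map_fst_stepLaw f μ π s hm]; exact ih.1.aestronglyMeasurable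
    rw [← integral_map measurable_fst.aemeasurable h2, map_fst_stepLaw f μ π s hm]

/-- Chain rule: the mutual information between the classifier and the signals is the sum of the
expected values of the channel function at the predictive distributions. -/
theorem klDiv_jointLaw_div_log_two (hf : f.FiniteEntropy) (hm : 0 < m) (n : ℕ) :
    InformationTheory.klDiv (jointLaw f μ π s n) (μ.prod (signalLaw f μ π s n)) /
        ENNReal.ofReal (Real.log 2) = ENNReal.ofReal (∑ k ∈ Finset.range n,
          ∫ y, channelFun f (predictive f μ π s y) ∂(signalLaw f μ π s k)) := by
  obtain ⟨h1, h2⟩ := integrable_and_integral_infoDensity f μ π s hf hm n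
  have hl : 0 < Real.log 2 := Real.log_pos one_lt_two
  rw [klDiv_jointLaw f μ π s hm n h1, h2, ← ENNReal.ofReal_div_of_pos hl,
    mul_div_cancel_left₀ _ hl.ne']

theorem integral_channelFun_le_capacity (hf : f.FiniteEntropy) (hm : 0 < m) (k : ℕ) :
    ∫ y, channelFun f (predictive f μ π s y) ∂(signalLaw f μ π s k) ≤ capacity f := by
  have := isProbabilityMeasure_signalLaw f μ π s hm k
  calc _ ≤ ∫ _, capacity f ∂(signalLaw f μ π s k) := by
        refine integral_mono_ae (integrable_channelFun_predictive f μ π s hf hm k)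
          (integrable_const _) ?_
        filter_upwards [ae_signalLaw_evidence f μ π s hm k] with y hy
        exact channelFun_le_capacity hf (predictive_mem_stdSimplex f μ π s hm hy.1 hy.2)
    _ = _ := by simp

instance isProbabilityMeasure_seedLaw : IsProbabilityMeasure seedLaw := by
  unfold seedLaw; infer_instance

theorem expectedInfo_le (hf : f.FiniteEntropy) (hm : 0 < m) (K : ℕ) :
    expectedInfo f μ K π ≤ ENNReal.ofReal (K * capacity f) := by
  have hl : 0 < Real.log 2 := Real.log_pos one_lt_two
  have h0 : ENNReal.ofReal (Real.log 2) ≠ 0 := by simpa using hl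
  rw [expectedInfo, ENNReal.div_le_iff h0 ENNReal.ofReal_ne_top]
  calc _ ≤ ∫⁻ _, ENNReal.ofReal (K * capacity f) * ENNReal.ofReal (Real.log 2) ∂seedLaw := by
        refine lintegral_mono fun s => ?_
        rw [← ENNReal.div_le_iff h0 ENNReal.ofReal_ne_top,
          klDiv_jointLaw_div_log_two f μ π s hf hm]
        refine ENNReal.ofReal_le_ofReal ?_
        calc _ ≤ ∑ k ∈ Finset.range K, capacity f :=
              Finset.sum_le_sum fun k _ => integral_channelFun_le_capacity f μ π s hf hm k
          _ = _ := by simp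
    _ = _ := by simp

end Info

end PreferenceLearning

end

noncomputable section

namespace PreferenceLearning

/-! ### Measurable selection for Carathéodory functions -/

section Selection

open Set Filter Topology

variable {Y : Type*} [MeasurableSpace Y]

/-- By compactness the minimum is attained, so it is nonpositive exactly when values below every
`1/(j+1)` occur, and these already occur on a countable dense set. -/
theorem measurableSet_exists_nonpos {K : Type*} [TopologicalSpace K] [CompactSpace K]
    [TopologicalSpace.SeparableSpace K] (F : Y → K → ℝ) (hm : ∀ k, Measurable fun y => F y k)
    (hc : ∀ y, Continuous (F y)) : MeasurableSet {y | ∃ k, F y k ≤ 0} := by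
  rcases isEmpty_or_nonempty K with hK | hK
  · simp
  have h1 : {y | ∃ k, F y k ≤ 0} =
      ⋂ j : ℕ, ⋃ n : ℕ, {y | F y (TopologicalSpace.denseSeq K n) < 1 / ((j : ℝ) + 1)} := by
    ext y
    simp only [mem_ofPred_eq, mem_iInter, mem_iUnion]
    constructor
    · rintro ⟨k, hk⟩ j
      have ho : IsOpen {x | F y x < 1 / ((j : ℝ) + 1)} := isOpen_lt (hc y) continuous_const
      exact (TopologicalSpace.denseRange_denseSeq K).exists_mem_open ho
        ⟨k, hk.trans_lt (by positivity)⟩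
    · intro h
      obtain ⟨k, -, hk⟩ := isCompact_univ.exists_isMinOn univ_nonempty (hc y).continuousOn
      refine ⟨k, le_of_forall_pos_lt_add fun ε hε => ?_⟩
      obtain ⟨j, hj⟩ := exists_nat_one_div_lt hε
      obtain ⟨n, hn⟩ := h j
      have := hk (mem_univ (TopologicalSpace.denseSeq K n))
      simp only [mem_ofPred_eq] at this
      linarith
  rw [h1]
  exact MeasurableSet.iInter fun j => MeasurableSet.iUnion fun n =>
    measurableSet_lt (hm _) measurable_const

/-- Measurable selection of a point where a Carathéodory function on a compact metric space is
nonpositive. -/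
theorem exists_measurable_selection_of_compactSpace {K : Type*} [MetricSpace K] [CompactSpace K]
    [Nonempty K] [MeasurableSpace K] [BorelSpace K] (F : Y → K → ℝ)
    (hm : ∀ k, Measurable fun y => F y k) (hc : ∀ y, Continuous (F y)) :
    ∃ sel : Y → K, Measurable sel ∧ ∀ y, (∃ k, F y k ≤ 0) → F y (sel y) ≤ 0 := by
  classical
  -- A continuous surjection from the Cantor set gives `K` a parameter in a compact set of reals.
  -- The selection takes the least admissible parameter.
  obtain ⟨ψ₀, hψ₀, hs₀⟩ := exists_nat_bool_continuous_surjective_of_compact K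
  set ψ : cantorSet → K := ψ₀ ∘ cantorSetHomeomorphNatToBool with hψdef
  have hψ : Continuous ψ := hψ₀.comp cantorSetHomeomorphNatToBool.continuous
  have hs : Function.Surjective ψ := hs₀.comp cantorSetHomeomorphNatToBool.surjective
  have hcomp : CompactSpace cantorSet := isCompact_iff_compactSpace.1 isCompact_cantorSet
  have hmin : ∀ y, (∃ k, F y k ≤ 0) →
      ∃ t : cantorSet, F y (ψ t) ≤ 0 ∧ ∀ t' : cantorSet, F y (ψ t') ≤ 0 → t ≤ t' := by
    rintro y ⟨k, hk⟩
    obtain ⟨t₀, rfl⟩ := hs k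
    have hcl : IsClosed {t | F y (ψ t) ≤ 0} :=
      isClosed_le ((hc y).comp hψ) continuous_const
    obtain ⟨t, ht, hmin⟩ := hcl.isCompact.exists_isMinOn ⟨t₀, hk⟩
      (continuous_subtype_val (p := (· ∈ cantorSet))).continuousOn
    exact ⟨t, ht, fun t' ht' => hmin ht'⟩
  obtain ⟨t₀, -⟩ := hs (Classical.arbitrary K)
  set τ : Y → cantorSet := fun y => if h : ∃ k, F y k ≤ 0 then (hmin y h).choose else t₀ with hτ
  have hD : MeasurableSet {y | ∃ k, F y k ≤ 0} := measurableSet_exists_nonpos F hm hc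
  have hE : ∀ r : ℝ, MeasurableSet {y | ∃ t : cantorSet, (t : ℝ) ≤ r ∧ F y (ψ t) ≤ 0} := by
    intro r
    have hcl : IsClosed {t : cantorSet | (t : ℝ) ≤ r} :=
      isClosed_le continuous_subtype_val continuous_const
    have := isCompact_iff_compactSpace.1 hcl.isCompact
    have h := measurableSet_exists_nonpos
      (fun y (t : {t : cantorSet | (t : ℝ) ≤ r}) => F y (ψ t)) (fun t => hm _)
      fun y => ((hc y).comp hψ).comp continuous_subtype_val
    convert h using 2
    ext y
    simp
  have hτm : Measurable τ := by
    refine (MeasurableEmbedding.subtype_coe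
      isClosed_cantorSet.measurableSet).measurable_comp_iff.1 ?_
    refine measurable_of_Iic fun r => ?_
    -- The least admissible parameter is at most `r` iff some admissible one is, and that is a
    -- solvability condition on a compact set again.
    have : (Subtype.val ∘ τ) ⁻¹' Iic r =
        {y | ∃ t : cantorSet, (t : ℝ) ≤ r ∧ F y (ψ t) ≤ 0} ∪
        ({y | ∃ k, F y k ≤ 0}ᶜ ∩ {_y | (t₀ : ℝ) ≤ r}) := by
      ext y
      by_cases h : ∃ k, F y k ≤ 0
      · have h1 : τ y = (hmin y h).choose := by simp only [hτ, dif_pos h]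
        have h2 := (hmin y h).choose_spec
        rw [← h1] at h2
        simp only [mem_preimage, Function.comp, mem_Iic, mem_union, mem_ofPred_eq, mem_inter_iff,
          mem_compl_iff, h, not_true, false_and, or_false]
        exact ⟨fun h3 => ⟨τ y, h3, h2.1⟩, fun ⟨t, ht, ht'⟩ => le_trans (h2.2 t ht') ht⟩
      · have h1 : τ y = t₀ := by simp only [hτ, dif_neg h]
        have h2 : ¬ ∃ t : cantorSet, (t : ℝ) ≤ r ∧ F y (ψ t) ≤ 0 := fun ⟨t, _, ht⟩ => h ⟨_, ht⟩
        simp only [mem_preimage, Function.comp, mem_Iic, mem_union, mem_ofPred_eq, mem_inter_iff,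
          mem_compl_iff, h, h1, h2, not_false_iff, true_and, false_or]
    rw [this]
    exact (hE r).union (hD.compl.inter (MeasurableSet.const _))
  refine ⟨ψ ∘ τ, hψ.measurable.comp hτm, fun y h => ?_⟩
  have h1 : τ y = (hmin y h).choose := by simp only [hτ, dif_pos h]
  rw [Function.comp, h1]
  exact (hmin y h).choose_spec.1

/-- Measurable selection of a point where a Carathéodory function on a `σ`-compact metric space is
nonpositive. -/
theorem exists_measurable_selection {X : Type*} [MetricSpace X] [SigmaCompactSpace X]
    [Nonempty X] [MeasurableSpace X] [BorelSpace X] (F : Y → X → ℝ)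
    (hm : ∀ x, Measurable fun y => F y x) (hc : ∀ y, Continuous (F y)) :
    ∃ sel : Y → X, Measurable sel ∧ ∀ y, (∃ x, F y x ≤ 0) → F y (sel y) ≤ 0 := by
  classical
  have hK : ∀ n, ∃ sel : Y → X, Measurable sel ∧
      ∀ y, (∃ x ∈ compactCovering X n, F y x ≤ 0) → F y (sel y) ≤ 0 := by
    intro n
    rcases (compactCovering X n).eq_empty_or_nonempty with h | h
    · exact ⟨fun _ => Classical.arbitrary X, measurable_const, by simp [h]⟩
    · have := isCompact_iff_compactSpace.1 (isCompact_compactCovering X n)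
      have := h.to_subtype
      obtain ⟨sel, h1, h2⟩ := exists_measurable_selection_of_compactSpace
        (fun y (x : compactCovering X n) => F y x) (fun x => hm x)
        fun y => (hc y).comp continuous_subtype_val
      exact ⟨fun y => sel y, measurable_subtype_coe.comp h1,
        fun y ⟨x, hx, hx'⟩ => h2 y ⟨⟨x, hx⟩, hx'⟩⟩
  choose sel hsel hsel' using hK
  have hp : ∀ n, MeasurableSet {y | ∃ x ∈ compactCovering X n, F y x ≤ 0} := by
    intro n
    have := isCompact_iff_compactSpace.1 (isCompact_compactCovering X n)
    have h := measurableSet_exists_nonpos (fun y (x : compactCovering X n) => F y x)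
      (fun x => hm x) fun y => (hc y).comp continuous_subtype_val
    convert h using 2
    ext y
    simp
  have hcov : ∀ y, (∃ x, F y x ≤ 0) ↔ ∃ n, ∃ x ∈ compactCovering X n, F y x ≤ 0 := by
    intro y
    constructor
    · rintro ⟨x, hx⟩
      obtain ⟨n, hn⟩ := exists_mem_compactCovering x
      exact ⟨n, x, hn, hx⟩
    · rintro ⟨n, x, -, hx⟩
      exact ⟨x, hx⟩
  have hD : MeasurableSet {y | ∃ x, F y x ≤ 0} := by
    have : {y | ∃ x, F y x ≤ 0} = ⋃ n, {y | ∃ x ∈ compactCovering X n, F y x ≤ 0} := by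
      ext y
      rw [mem_iUnion]
      exact hcov y
    rw [this]
    exact MeasurableSet.iUnion hp
  -- The first compact piece with a solution is used. The implication makes the search succeed, with
  -- index `0`, also where no solution exists.
  have hex : ∀ y, ∃ n, (∃ x, F y x ≤ 0) → ∃ x ∈ compactCovering X n, F y x ≤ 0 := by
    intro y
    by_cases h : ∃ x, F y x ≤ 0
    · obtain ⟨n, hn⟩ := (hcov y).1 h
      exact ⟨n, fun _ => hn⟩
    · exact ⟨0, fun h' => absurd h' h⟩
  have hp' : ∀ n, MeasurableSet {y | (∃ x, F y x ≤ 0) → ∃ x ∈ compactCovering X n, F y x ≤ 0} := by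
    intro n
    have : {y | (∃ x, F y x ≤ 0) → ∃ x ∈ compactCovering X n, F y x ≤ 0} =
        {y | ∃ x, F y x ≤ 0}ᶜ ∪ {y | ∃ x ∈ compactCovering X n, F y x ≤ 0} := by
      ext y; simp only [mem_ofPred_eq, mem_union, mem_compl_iff, imp_iff_not_or]
    rw [this]
    exact hD.compl.union (hp n)
  refine ⟨fun y => sel (Nat.find (hex y)) y, Measurable.find hsel hp' hex, fun y hy => ?_⟩
  exact hsel' _ y (Nat.find_spec (hex y) hy)

end Selection

/-! ### Continuity of masses in the question, measurability of depth -/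

section Continuity

open Filter Topology

variable {d m : ℕ}

theorem volume_inner_eq_zero {v : EuclideanSpace ℝ (Fin d)} (hv : v ≠ 0) :
    volume {θ : EuclideanSpace ℝ (Fin d) | inner ℝ θ v = 0} = 0 := by
  have h : {θ : EuclideanSpace ℝ (Fin d) | inner ℝ θ v = 0} =
      (LinearMap.ker (innerₛₗ ℝ v) : Set (EuclideanSpace ℝ (Fin d))) := by
    ext θ
    simp [real_inner_comm]
  rw [h]
  refine Measure.addHaar_submodule _ _ fun htop => hv ?_
  have : v ∈ LinearMap.ker (innerₛₗ ℝ v) := htop ▸ Submodule.mem_top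
  simpa using this

/-- Openness makes the injective questions a locally compact space, as the selection theorem
requires. On them masses are continuous. -/
theorem isOpen_setOf_injective :
    IsOpen {X : Fin m → EuclideanSpace ℝ (Fin d) | Function.Injective X} := by
  have : {X : Fin m → EuclideanSpace ℝ (Fin d) | Function.Injective X} =
      ⋂ i, ⋂ j, {X | i ≠ j → X i ≠ X j} := by
    ext X
    simp only [Set.mem_ofPred_eq, Set.mem_iInter, Function.Injective]
    exact ⟨fun h i j hij hX => hij (h hX), fun h i j hX => by
      by_contra hij; exact h i j hij hX⟩
  rw [this]
  refine isOpen_iInter_of_finite fun i => isOpen_iInter_of_finite fun j => ?_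
  by_cases hij : i = j
  · simp [hij]
  · simpa [hij] using isOpen_ne_fun (continuous_apply i) (continuous_apply j)

/-- For distinct alternatives almost every classifier has no ties, so its response is locally
constant in the question; dominated convergence does the rest. Coinciding alternatives would tie for
every classifier. -/
theorem continuousAt_measureReal_region (hm : 0 < m) (ρ : Measure (EuclideanSpace ℝ (Fin d)))
    [IsFiniteMeasure ρ] (hρ : ρ ≪ volume) (z : Fin m) {X : Fin m → EuclideanSpace ℝ (Fin d)}
    (hX : Function.Injective X) : ContinuousAt (fun X => ρ.real (region X z)) X := by
  have h1 : (fun X : Fin m → EuclideanSpace ℝ (Fin d) => ρ.real (region X z)) =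
      fun X => ∫ θ, (region X z).indicator (fun _ => (1 : ℝ)) θ ∂ρ := by
    funext X
    rw [integral_indicator_const _ (measurableSet_region X z), smul_eq_mul, mul_one]
  rw [h1]
  refine continuousAt_of_dominated (bound := fun _ => 1) ?_ ?_ (integrable_const _) ?_
  · exact Eventually.of_forall fun X =>
      (measurable_const.indicator (measurableSet_region X z)).aestronglyMeasurable
  · refine Eventually.of_forall fun X => Eventually.of_forall fun θ => ?_
    by_cases h : θ ∈ region X z <;> simp [h]
  · have h2 : ∀ᵐ θ ∂ρ, ∀ i j, i ≠ j → inner ℝ θ (X i - X j) ≠ 0 := by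
      rw [ae_all_iff]; intro i
      rw [ae_all_iff]; intro j
      by_cases hij : i = j
      · simp [hij]
      · have hne : X i - X j ≠ 0 := sub_ne_zero.2 fun h => hij (hX h)
        have := hρ (volume_inner_eq_zero hne)
        rw [← compl_mem_ae_iff] at this
        filter_upwards [this] with θ hθ _
        exact hθ
    filter_upwards [h2] with θ hθ
    obtain ⟨w, hw⟩ := exists_mem_region hm X θ
    have hlt : ∀ i, i ≠ w → inner ℝ θ (X i) < inner ℝ θ (X w) := by
      intro i hi
      rcases lt_or_gt_of_ne hi with h | h
      · exact hw.2 i h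
      · refine lt_of_le_of_ne (hw.1 i h) fun h3 => hθ i w hi ?_
        rw [inner_sub_right, h3, sub_self]
    have hev : ∀ᶠ X' in 𝓝 X, ∀ i, i ≠ w → inner ℝ θ (X' i) < inner ℝ θ (X' w) := by
      rw [eventually_all]
      intro i
      by_cases hi : i = w
      · simp [hi]
      · have hc : ∀ i, Continuous fun X' : Fin m → EuclideanSpace ℝ (Fin d) =>
            inner ℝ θ (X' i) := fun i => continuous_const.inner (continuous_apply i)
        filter_upwards [(isOpen_lt (hc i) (hc w)).mem_nhds (hlt i hi)] with X' hX' _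
        exact hX'
    have hev2 : ∀ᶠ X' in 𝓝 X, (region X' z).indicator (fun _ => (1 : ℝ)) θ =
        if w = z then 1 else 0 := by
      filter_upwards [hev] with X' hX'
      have hmem : θ ∈ region X' w :=
        ⟨fun i hi => (hX' i hi.ne').le, fun i hi => hX' i hi.ne⟩
      split_ifs with hwz
      · rw [Set.indicator_of_mem (hwz ▸ hmem)]
      · rw [Set.indicator_of_notMem fun h => hwz (eq_of_mem_region hmem h)]
    exact (continuousAt_const (y := if w = z then (1 : ℝ) else 0)).congr
      (hev2.mono fun X' hX' => hX'.symm)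

theorem injective_cons_zero {v : EuclideanSpace ℝ (Fin d)} (hv : v ≠ 0) :
    Function.Injective ![v, 0] := by
  intro i j hij
  fin_cases i <;> fin_cases j <;> simp_all

/-- Makes halfspaces a special case of response regions, the tie on the boundary going to the first
index. -/
theorem region_cons_zero (v : EuclideanSpace ℝ (Fin d)) :
    region ![v, 0] 0 = {θ | 0 ≤ inner ℝ θ v} := by
  ext θ
  simp [region, Fin.forall_fin_two]

theorem continuousAt_measureReal_halfspace (ρ : Measure (EuclideanSpace ℝ (Fin d)))
    [IsFiniteMeasure ρ] (hρ : ρ ≪ volume) {v : EuclideanSpace ℝ (Fin d)} (hv : v ≠ 0) :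
    ContinuousAt (fun v => ρ.real {θ | 0 ≤ inner ℝ θ v}) v := by
  simp_rw [← region_cons_zero]
  have h1 := continuousAt_measureReal_region two_pos ρ hρ 0 (injective_cons_zero hv)
  have h2 : Continuous fun v : EuclideanSpace ℝ (Fin d) => ![v, 0] := by fun_prop
  exact ContinuousAt.comp (f := fun v : EuclideanSpace ℝ (Fin d) => ![v, 0])
    (g := fun X => ρ.real (region X 0)) h1 h2.continuousAt

/-- Continuity in the normal vector reduces the infimum to a countable dense family. -/
theorem measurable_halfspaceDepth (hd : 0 < d) {Y : Type*} [MeasurableSpace Y]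
    (ρ : Y → Measure (EuclideanSpace ℝ (Fin d))) [∀ y, IsFiniteMeasure (ρ y)]
    (hρ : ∀ y, ρ y ≪ volume)
    (hm : ∀ A, MeasurableSet A → Measurable fun y => ρ y A) :
    Measurable fun y => halfspaceDepth (ρ y) := by
  have hne : Nonempty {v : EuclideanSpace ℝ (Fin d) // v ≠ 0} := by
    refine ⟨⟨EuclideanSpace.single ⟨0, hd⟩ 1, ?_⟩⟩
    simp
  have hc : ∀ y, Continuous fun v : {v : EuclideanSpace ℝ (Fin d) // v ≠ 0} =>
      (ρ y).real {θ | 0 ≤ inner ℝ θ v.1} := fun y => continuous_iff_continuousAt.2 fun v =>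
    (continuousAt_measureReal_halfspace (ρ y) (hρ y) v.2).comp
      continuous_subtype_val.continuousAt
  have hb : ∀ (y : Y) {ι : Type} (φ : ι → {v : EuclideanSpace ℝ (Fin d) // v ≠ 0}),
      BddBelow (Set.range fun i => (ρ y).real {θ | 0 ≤ inner ℝ θ (φ i).1}) := by
    intro y ι φ
    refine ⟨0, ?_⟩
    rintro _ ⟨i, rfl⟩
    exact measureReal_nonneg
  have h1 : ∀ y, halfspaceDepth (ρ y) = ⨅ n, (ρ y).real
      {θ | 0 ≤ inner ℝ θ (TopologicalSpace.denseSeq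
        {v : EuclideanSpace ℝ (Fin d) // v ≠ 0} n).1} := by
    intro y
    refine le_antisymm (le_ciInf fun n => ciInf_le (hb y id) _) (le_ciInf fun v => ?_)
    have hcl := isClosed_le (continuous_const (y := ⨅ n, (ρ y).real
      {θ | 0 ≤ inner ℝ θ (TopologicalSpace.denseSeq
        {v : EuclideanSpace ℝ (Fin d) // v ≠ 0} n).1})) (hc y)
    exact (TopologicalSpace.denseRange_denseSeq _).induction_on v hcl fun n => ciInf_le (hb y _) n
  simp_rw [h1]
  refine Measurable.iInf fun n => Measurable.ennreal_toReal (hm _ ?_)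
  rw [← region_cons_zero]
  exact measurableSet_region _ _

end Continuity

end PreferenceLearning

end

noncomputable section

namespace PreferenceLearning

/-! ### Cutting the circle into short arcs of prescribed masses -/

section Arcs

open Set Real

/-- The union of the other sets is closed by finiteness, so meeting it too would disconnect `T`. -/
theorem _root_.IsPreconnected.subset_of_finite_closed_cover {α ι : Type*} [TopologicalSpace α]
    [Finite ι] {T : Set α} (hT : IsPreconnected T) (C : ι → Set α) (hcl : ∀ i, IsClosed (C i))
    (hcov : T ⊆ ⋃ i, C i) (hdisj : ∀ x ∈ T, ∀ i j, x ∈ C i → x ∈ C j → i = j) {i : ι}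
    (hi : (T ∩ C i).Nonempty) : T ⊆ C i := by
  intro x hx
  by_contra hxi
  have hD : IsClosed (⋃ j : {j // j ≠ i}, C j) := isClosed_iUnion_of_finite fun j => hcl j
  have hc : T ⊆ C i ∪ ⋃ j : {j // j ≠ i}, C j := by
    intro y hy
    obtain ⟨j, hj⟩ := mem_iUnion.1 (hcov hy)
    by_cases hji : j = i
    · exact Or.inl (hji ▸ hj)
    · exact Or.inr (mem_iUnion.2 ⟨⟨j, hji⟩, hj⟩)
  have hx2 : (T ∩ ⋃ j : {j // j ≠ i}, C j).Nonempty := ⟨x, hx, (hc hx).resolve_left hxi⟩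
  obtain ⟨y, hy, hyi, hyD⟩ := isPreconnected_closed_iff.1 hT _ _ (hcl i) hD hc hi hx2
  obtain ⟨⟨j, hji⟩, hj⟩ := mem_iUnion.1 hyD
  exact hji (hdisj y hy j i hj hyi)

/-- Endpoints of consecutive arcs of the circle, with prescribed values of the distribution
function `G`. -/
def arcFiber {m : ℕ} (G : ℝ → ℝ) (U : Fin (m + 1) → ℝ) (g : ℝ) : Set (Fin (m + 1) → ℝ) :=
  {a | a (Fin.last m) = a 0 + 2 * π ∧ ∀ k, G (a k) = g + U k}

/-- Level sets of a monotone function are intervals. Convexity matters because `G` may have flat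
pieces, which leave the cut points undetermined. -/
theorem convex_arcFiber {m : ℕ} {G : ℝ → ℝ} (hG : Monotone G) (U : Fin (m + 1) → ℝ) (g : ℝ) :
    Convex ℝ (arcFiber G U g) := by
  intro a ha b hb s t hs ht hst
  refine ⟨?_, fun k => ?_⟩
  · simp only [Pi.add_apply, Pi.smul_apply, smul_eq_mul, ha.1, hb.1]
    linear_combination 2 * π * hst
  · have h1 : ∀ c : ℝ, (c = a k ∨ c = b k) → G c = g + U k := by
      rintro c (rfl | rfl)
      · exact ha.2 k
      · exact hb.2 k
    have h2 : (s • a + t • b) k ≤ max (a k) (b k) :=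
      Convex.combo_le_max _ _ hs ht hst
    have h3 : min (a k) (b k) ≤ (s • a + t • b) k :=
      Convex.min_le_combo _ _ hs ht hst
    refine le_antisymm ?_ ?_
    · rw [← h1 _ (max_choice (a k) (b k))]; exact hG h2
    · rw [← h1 _ (min_choice (a k) (b k))]; exact hG h3

theorem sum_succ_sub_castSucc {m : ℕ} (a : Fin (m + 1) → ℝ) :
    ∑ i : Fin m, (a i.succ - a i.castSucc) = a (Fin.last m) - a 0 := by
  have h1 := Fin.sum_univ_castSucc a
  have h2 := Fin.sum_univ_succ a
  rw [Finset.sum_sub_distrib]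
  linarith

/-- `G x - x / (2π)` is periodic. -/
theorem sub_intCast_of_add_two_pi {G : ℝ → ℝ} (hper : ∀ x, G (x + 2 * π) = G x + 1) (x : ℝ)
    (k : ℤ) : G (x - k * (2 * π)) = G x - k := by
  have hp : Function.Periodic (fun x => G x - x / (2 * π)) (2 * π) := by
    intro x
    have := pi_pos.ne'
    simp only [hper]
    field_simp
    ring
  have h := hp.sub_zsmul_eq k (x := x)
  simp only [zsmul_eq_mul] at h
  have h2 : (x - k * (2 * π)) / (2 * π) = x / (2 * π) - k := by
    have := pi_pos.ne'
    field_simp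
  rw [h2] at h
  linarith

theorem surjective_of_add_two_pi {G : ℝ → ℝ} (hcont : Continuous G)
    (hper : ∀ x, G (x + 2 * π) = G x + 1) : Function.Surjective G := by
  intro c
  refine mem_range_of_exists_le_of_exists_ge hcont ?_ ?_
  · obtain ⟨k, hk⟩ := exists_int_gt (G 0 - c)
    exact ⟨0 - k * (2 * π), by rw [sub_intCast_of_add_two_pi hper]; linarith⟩
  · obtain ⟨k, hk⟩ := exists_int_lt (G 0 - c)
    exact ⟨0 - k * (2 * π), by rw [sub_intCast_of_add_two_pi hper]; linarith⟩

/-- A circle can be cut into consecutive arcs of prescribed masses, each shorter than a half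
circle, if some half circle has a larger mass than each of the arcs. -/
theorem exists_short_arcs {m : ℕ} (hm : 3 ≤ m) {G : ℝ → ℝ} (hmono : Monotone G)
    (hcont : Continuous G) (hper : ∀ x, G (x + 2 * π) = G x + 1) {w : Fin m → ℝ}
    (hw : ∀ i, 0 < w i) (hsum : ∑ i, w i = 1) {b : ℝ} (hb : ∀ i, w i < G (b + π) - G b) :
    ∃ a : Fin (m + 1) → ℝ, a (Fin.last m) = a 0 + 2 * π ∧ ∀ i : Fin m,
      G (a i.succ) = G (a i.castSucc) + w i ∧ a i.castSucc < a i.succ ∧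
      a i.succ < a i.castSucc + π := by
  classical
  set U : Fin (m + 1) → ℝ := fun k => ∑ j : Fin m, if j.castSucc < k then w j else 0 with hU
  have hU0 : U 0 = 0 := by simp [hU]
  have hU1 : U (Fin.last m) = 1 := by simp [hU, Fin.castSucc_lt_last, hsum]
  have hUs : ∀ i : Fin m, U i.succ = U i.castSucc + w i := by
    intro i
    have : w i = ∑ j : Fin m, if j = i then w j else 0 := by simp
    rw [this, hU, ← Finset.sum_add_distrib]
    refine Finset.sum_congr rfl fun j _ => ?_
    have e1 : j.castSucc < i.succ ↔ j ≤ i := by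
      simp only [Fin.lt_def, Fin.le_def, Fin.val_castSucc, Fin.val_succ]; omega
    have e2 : j.castSucc < i.castSucc ↔ j < i := Iff.rfl
    simp only [e1, e2]
    rcases lt_trichotomy j i with h | h | h
    · simp [h, h.le, h.ne]
    · simp [h]
    · simp [h.not_ge, h.not_gt, h.ne']
  have hU01 : ∀ k, U k ∈ Icc (0 : ℝ) 1 := by
    intro k
    refine ⟨Finset.sum_nonneg fun j _ => ?_, ?_⟩
    · split_ifs; exacts [(hw j).le, le_rfl]
    · rw [← hsum]
      refine Finset.sum_le_sum fun j _ => ?_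
      split_ifs; exacts [le_rfl, (hw j).le]
  have hsurj := surjective_of_add_two_pi hcont hper
  set F := arcFiber G U with hF
  set C : Fin m → Set (Fin (m + 1) → ℝ) := fun i => {a | a i.castSucc + π ≤ a i.succ} with hC
  have hCcl : ∀ i, IsClosed (C i) := fun i =>
    isClosed_le ((continuous_apply _).add continuous_const) (continuous_apply _)
  have hstep : ∀ g, ∀ a ∈ F g, ∀ i : Fin m, G (a i.succ) = G (a i.castSucc) + w i ∧
      a i.castSucc < a i.succ := by
    intro g a ha i
    have h1 : G (a i.succ) = G (a i.castSucc) + w i := by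
      rw [ha.2, ha.2, hUs]; ring
    exact ⟨h1, hmono.reflect_lt (by rw [h1]; linarith [hw i])⟩
  -- Two arcs of length at least `π` would fill the circle, but there is a third arc of positive
  -- length. This uses `3 ≤ m`.
  have hdisj : ∀ g, ∀ a ∈ F g, ∀ i j, a ∈ C i → a ∈ C j → i = j := by
    intro g a ha i j hi hj
    by_contra hij
    obtain ⟨k, hk⟩ : ∃ k, k ∉ ({i, j} : Finset (Fin m)) := by
      by_contra hcon
      push Not at hcon
      have h1 : (Finset.univ : Finset (Fin m)) ⊆ {i, j} := fun k _ => hcon k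
      have h2 := Finset.card_le_card h1
      rw [Finset.card_univ, Fintype.card_fin] at h2
      have h3 := Finset.card_le_two (a := i) (b := j)
      omega
    have h1 := sum_succ_sub_castSucc a
    have h2 : ∑ l ∈ ({k, i, j} : Finset (Fin m)), (a l.succ - a l.castSucc) ≤
        ∑ l : Fin m, (a l.succ - a l.castSucc) :=
      Finset.sum_le_sum_of_subset_of_nonneg (Finset.subset_univ _)
        fun l _ _ => (sub_pos.2 (hstep g a ha l).2).le
    rw [Finset.sum_insert hk, Finset.sum_insert (by simpa using hij), Finset.sum_singleton] at h2
    have h3 := (hstep g a ha k).2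
    have h4 := ha.1
    simp only [hC, mem_ofPred_eq] at hi hj
    linarith
  have hne : ∀ (g : ℝ) (i : Fin m) (x : ℝ), G x = g + U i.castSucc →
      ∃ a ∈ F g, a i.castSucc = x := by
    intro g i x hx
    choose c hc using fun k => hsurj (g + U k)
    set c' := Function.update c i.castSucc x with hc'
    have hc'G : ∀ k, G (c' k) = g + U k := by
      intro k
      by_cases hk : k = i.castSucc
      · rw [hk, hc', Function.update_self, hx]
      · rw [hc', Function.update_of_ne hk, hc]
    have h0 : (0 : Fin (m + 1)) ≠ Fin.last m := by
      intro h
      have := congrArg Fin.val h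
      simp at this
      omega
    refine ⟨Function.update c' (Fin.last m) (c' 0 + 2 * π), ⟨?_, fun k => ?_⟩, ?_⟩
    · rw [Function.update_self, Function.update_of_ne h0]
    · by_cases hk : k = Fin.last m
      · rw [hk, Function.update_self, hper, hc'G, hU0, hU1]; ring
      · rw [Function.update_of_ne hk, hc'G]
    · rw [Function.update_of_ne (Fin.castSucc_lt_last i).ne, hc', Function.update_self]
  suffices h : ∃ g, ∃ a ∈ F g, ∀ i, a ∉ C i by
    obtain ⟨g, a, ha, hai⟩ := h
    exact ⟨a, ha.1, fun i => ⟨(hstep g a ha i).1, (hstep g a ha i).2, not_le.1 (hai i)⟩⟩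
  -- If every cut had a long arc, its index would be unique, hence constant on each connected fiber,
  -- and then constant in the starting level `g` over `[0, 1]`. Rotating that arc so that it starts
  -- at `b` contradicts `hb`.
  by_contra hcon
  push Not at hcon
  have hfib : ∀ g i, (F g ∩ C i).Nonempty → F g ⊆ C i := fun g i hi =>
    (convex_arcFiber hmono U g).isPreconnected.subset_of_finite_closed_cover C hCcl
      (fun a ha => mem_iUnion.2 (hcon g a ha)) (hdisj g) hi
  set S : Fin m → Set ℝ := fun i => {g | g ∈ Icc (0 : ℝ) 1 ∧ (F g ∩ C i).Nonempty} with hS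
  have hScl : ∀ i, IsClosed (S i) := by
    intro i
    set Z : Set (Fin (m + 1) → ℝ) := {a | a (Fin.last m) = a 0 + 2 * π} ∩
      (⋂ k, {a | G (a k) = G (a 0) + U k}) ∩ {a | G (a 0) ∈ Icc (0 : ℝ) 1} ∩ C i with hZ
    have hG0 : ∀ k, Continuous fun a : Fin (m + 1) → ℝ => G (a k) :=
      fun k => hcont.comp (continuous_apply k)
    have hZcl : IsClosed Z := by
      have z1 : IsClosed {a : Fin (m + 1) → ℝ | a (Fin.last m) = a 0 + 2 * π} :=
        isClosed_eq (continuous_apply _) ((continuous_apply _).add continuous_const)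
      have z2 : ∀ k, IsClosed {a : Fin (m + 1) → ℝ | G (a k) = G (a 0) + U k} := fun k =>
        isClosed_eq (hG0 k) ((hG0 0).add continuous_const)
      exact ((z1.inter (isClosed_iInter z2)).inter (isClosed_Icc.preimage (hG0 0))).inter (hCcl i)
    -- The values `G (a k)` lie in `[0, 2]`; points with values `-1` and `3` therefore bound all cut
    -- points.
    obtain ⟨x₀, hx₀⟩ := hsurj (-1)
    obtain ⟨x₁, hx₁⟩ := hsurj 3
    have hZc : IsCompact Z := by
      refine (isCompact_Icc (a := fun _ : Fin (m + 1) => x₀) (b := fun _ => x₁)).of_isClosed_subset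
        hZcl ?_
      rintro a ⟨⟨⟨-, h2⟩, h3⟩, -⟩
      rw [mem_iInter] at h2
      have h4 : G (a 0) ∈ Icc (0 : ℝ) 1 := h3
      refine ⟨fun k => ?_, fun k => ?_⟩
      · have h5 : G (a k) = G (a 0) + U k := h2 k
        exact (hmono.reflect_lt (by rw [hx₀, h5]; linarith [h4.1, (hU01 k).1])).le
      · have h5 : G (a k) = G (a 0) + U k := h2 k
        exact (hmono.reflect_lt (by rw [hx₁, h5]; linarith [h4.2, (hU01 k).2])).le
    have : S i = (fun a => G (a 0)) '' Z := by
      ext g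
      constructor
      · rintro ⟨hg, a, ha, hai⟩
        have h0 : G (a 0) = g := by rw [ha.2, hU0, add_zero]
        refine ⟨a, ⟨⟨⟨ha.1, mem_iInter.2 fun k => ?_⟩, ?_⟩, hai⟩, h0⟩
        · change G (a k) = G (a 0) + U k
          rw [h0, ha.2]
        · change G (a 0) ∈ Icc (0 : ℝ) 1
          rwa [h0]
      · rintro ⟨a, ⟨⟨⟨h1, h2⟩, h3⟩, h4⟩, rfl⟩
        exact ⟨h3, a, ⟨h1, fun k => mem_iInter.1 h2 k⟩, h4⟩
    rw [this]
    exact (hZc.image (hG0 0)).isClosed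
  have hScov : Icc (0 : ℝ) 1 ⊆ ⋃ i, S i := by
    intro g hg
    obtain ⟨x, hx⟩ := hsurj (g + U (Fin.castSucc (⟨0, by omega⟩ : Fin m)))
    obtain ⟨a, ha, -⟩ := hne g _ x hx
    obtain ⟨i, hi⟩ := hcon g a ha
    exact mem_iUnion.2 ⟨i, hg, a, ha, hi⟩
  have hSdisj : ∀ g ∈ Icc (0 : ℝ) 1, ∀ i j, g ∈ S i → g ∈ S j → i = j := by
    intro g _ i j hi hj
    obtain ⟨a, ha, hai⟩ := hi.2
    exact hdisj g a ha i j hai (hfib g j hj.2 ha)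
  obtain ⟨i, hi⟩ := mem_iUnion.1 (hScov ⟨le_rfl, zero_le_one⟩)
  have hall := isPreconnected_Icc.subset_of_finite_closed_cover S hScl hScov hSdisj
    ⟨0, ⟨le_rfl, zero_le_one⟩, hi⟩
  -- The starting level that lets arc `i` begin at `b`, shifted by whole turns so that the level
  -- falls in `[0, 1]`.
  set n : ℤ := ⌊G b - U i.castSucc⌋ with hn
  set g := Int.fract (G b - U i.castSucc) with hg
  have hgI : g ∈ Icc (0 : ℝ) 1 := ⟨Int.fract_nonneg _, (Int.fract_lt_one _).le⟩
  have hb1 : G (b - n * (2 * π)) = g + U i.castSucc := by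
    rw [sub_intCast_of_add_two_pi hper, hg, Int.fract]; ring
  obtain ⟨a, ha, hab⟩ := hne g i _ hb1
  have hai : a ∈ C i := hfib g i (hall hgI).2 ha
  have h1 : G (b + π) - n ≤ G (a i.succ) := by
    rw [← sub_intCast_of_add_two_pi hper]
    refine hmono ?_
    have h2 : a i.castSucc + π ≤ a i.succ := hai
    rw [hab] at h2
    linarith
  rw [(hstep g a ha i).1, hab, sub_intCast_of_add_two_pi hper] at h1
  linarith [hb i]

end Arcs

end PreferenceLearning

end

noncomputable section

namespace PreferenceLearning

/-! ### Convex polygons and their normal fans -/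

section Fan

open Real

variable {m : ℕ} {a : Fin (m + 1) → ℝ}

/-- Closes the cycle: the end of the last arc is the direction in which the first begins. -/
theorem exists_angle_eq_succ (h0 : a (Fin.last m) = a 0 + 2 * π) (j : Fin m) :
    ∃ j' : Fin m, cos (a j'.castSucc) = cos (a j.succ) ∧ sin (a j'.castSucc) = sin (a j.succ) := by
  by_cases h : (j : ℕ) + 1 < m
  · exact ⟨⟨j + 1, h⟩, rfl, rfl⟩
  · have h1 : j.succ = Fin.last m := by
      ext; simp only [Fin.val_succ, Fin.val_last]; omega
    refine ⟨⟨0, by omega⟩, ?_⟩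
    have h2 : (⟨0, by omega⟩ : Fin m).castSucc = 0 := rfl
    rw [h1, h0, cos_add_two_pi, sin_add_two_pi, h2]
    exact ⟨rfl, rfl⟩

/-- Directions that are not contained in a half plane have a positive linear relation. -/
theorem exists_positive_relation (h0 : a (Fin.last m) = a 0 + 2 * π)
    (hlt : ∀ i : Fin m, a i.castSucc < a i.succ)
    (hpi : ∀ i : Fin m, a i.succ < a i.castSucc + π) :
    ∃ l : Fin m → ℝ, (∀ i, 0 < l i) ∧ ∑ i, l i * cos (a i.castSucc) = 0 ∧
      ∑ i, l i * sin (a i.castSucc) = 0 := by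
  have hmono : StrictMono a := Fin.strictMono_iff_lt_succ.2 hlt
  -- The direction opposite to direction `i` lies in a sector of angle less than `π`, so it is a
  -- nonnegative combination of the two sides. This gives a nonnegative relation with positive
  -- coefficient at `i`; the sum over `i` is positive throughout.
  have key : ∀ i : Fin m, ∃ c : Fin m → ℝ, (∀ k, 0 ≤ c k) ∧ 0 < c i ∧
      ∑ k, c k * cos (a k.castSucc) = 0 ∧ ∑ k, c k * sin (a k.castSucc) = 0 := by
    intro i
    have hi0 : a 0 ≤ a i.castSucc := hmono.monotone (Fin.zero_le _)
    have hi1 : a i.castSucc < a 0 + 2 * π := h0 ▸ hmono (Fin.castSucc_lt_last i)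
    obtain ⟨b, hb0, hb1, hbc, hbs⟩ : ∃ b, a 0 ≤ b ∧ b < a 0 + 2 * π ∧
        cos b = - cos (a i.castSucc) ∧ sin b = - sin (a i.castSucc) := by
      by_cases h : a i.castSucc < a 0 + π
      · exact ⟨a i.castSucc + π, by linarith [pi_pos], by linarith, cos_add_pi _, sin_add_pi _⟩
      · exact ⟨a i.castSucc - π, by linarith, by linarith [pi_pos], cos_sub_pi _, sin_sub_pi _⟩
    obtain ⟨j, hj0, hj1⟩ : ∃ j : Fin m, a j.castSucc ≤ b ∧ b < a j.succ := by
      by_contra hcon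
      push Not at hcon
      have : ∀ k, a k ≤ b := fun k => Fin.induction hb0 (fun j hj => hcon j hj) k
      have := this (Fin.last m)
      linarith
    obtain ⟨j', hc', hs'⟩ := exists_angle_eq_succ h0 j
    set Δ := a j.succ - a j.castSucc with hΔ
    have hsin : 0 < sin Δ := sin_pos_of_pos_of_lt_pi (by linarith [hlt j]) (by linarith [hpi j])
    -- Coordinates of the direction `b` in the basis of the two sides, by the sine rule.
    set x := sin (a j.succ - b) / sin Δ with hx
    set y := sin (b - a j.castSucc) / sin Δ with hy
    have hx0 : 0 ≤ x := div_nonneg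
      (sin_nonneg_of_nonneg_of_le_pi (by linarith) (by linarith [hpi j])) hsin.le
    have hy0 : 0 ≤ y := div_nonneg
      (sin_nonneg_of_nonneg_of_le_pi (by linarith) (by linarith [hpi j])) hsin.le
    have hcos : x * cos (a j.castSucc) + y * cos (a j.succ) = cos b := by
      rw [hx, hy, div_mul_eq_mul_div, div_mul_eq_mul_div, ← add_div, div_eq_iff hsin.ne', hΔ]
      simp only [sin_sub]
      ring_nf
    have hsn : x * sin (a j.castSucc) + y * sin (a j.succ) = sin b := by
      rw [hx, hy, div_mul_eq_mul_div, div_mul_eq_mul_div, ← add_div, div_eq_iff hsin.ne', hΔ]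
      simp only [sin_sub]
      ring_nf
    have hsum : ∀ g : Fin m → ℝ, ∑ k, ((Pi.single i 1 + Pi.single j x + Pi.single j' y :
        Fin m → ℝ) k) * g k = g i + x * g j + y * g j' := by
      intro g
      simp [add_mul, Finset.sum_add_distrib, Pi.single_apply]
    have hnn : ∀ (p : Fin m) (q : ℝ), 0 ≤ q → ∀ k, 0 ≤ (Pi.single p q : Fin m → ℝ) k := by
      intro p q hq k
      rw [Pi.single_apply]
      split_ifs <;> simp [hq]
    refine ⟨Pi.single i 1 + Pi.single j x + Pi.single j' y, fun k => ?_, ?_, ?_, ?_⟩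
    · exact add_nonneg (add_nonneg (hnn i 1 zero_le_one k) (hnn j x hx0 k)) (hnn j' y hy0 k)
    · have h1 := hnn j x hx0 i
      have h2 := hnn j' y hy0 i
      simp only [Pi.add_apply, Pi.single_eq_same]
      linarith
    · rw [hsum fun k => cos (a k.castSucc), hc']
      linarith
    · rw [hsum fun k => sin (a k.castSucc), hs']
      linarith
  choose c hc0 hc1 hc2 hc3 using key
  refine ⟨fun k => ∑ i, c i k, fun k => ?_, ?_, ?_⟩
  · exact Finset.sum_pos' (fun i _ => hc0 i k) ⟨k, Finset.mem_univ k, hc1 k⟩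
  · simp_rw [Finset.sum_mul]
    rw [Finset.sum_comm]
    exact Finset.sum_eq_zero fun i _ => hc2 i
  · simp_rw [Finset.sum_mul]
    rw [Finset.sum_comm]
    exact Finset.sum_eq_zero fun i _ => hc3 i

/-- The vertices of a convex polygon: in the sector `z` of its normal fan, the vertex `z` is the
unique maximizer. -/
theorem partial_sum_lt_of_mem_sector (h0 : a (Fin.last m) = a 0 + 2 * π)
    (hlt : ∀ i : Fin m, a i.castSucc < a i.succ)
    (hpi : ∀ i : Fin m, a i.succ < a i.castSucc + π) {l : Fin m → ℝ} (hl : ∀ i, 0 < l i)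
    (hc : ∑ i, l i * cos (a i.castSucc) = 0) (hs : ∑ i, l i * sin (a i.castSucc) = 0)
    {z j : Fin m} (hjz : j ≠ z) {α : ℝ} (hα0 : a z.castSucc < α) (hα1 : α < a z.succ) :
    ∑ i, (if i ≤ j then l i * sin (α - a i.castSucc) else 0) <
      ∑ i, (if i ≤ z then l i * sin (α - a i.castSucc) else 0) := by
  have hmono : StrictMono a := Fin.strictMono_iff_lt_succ.2 hlt
  set t : Fin m → ℝ := fun i => l i * sin (α - a i.castSucc) with ht
  -- The term `t i` is the component of edge `i` in direction `α`; the relation says that the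
  -- polygon closes up. Two vertices can thus be compared along either of the two paths between
  -- them.
  have htot : ∑ i, t i = 0 := by
    have : ∀ i, t i = sin α * (l i * cos (a i.castSucc)) - cos α * (l i * sin (a i.castSucc)) := by
      intro i; simp only [ht, sin_sub]; ring
    simp_rw [this]
    rw [Finset.sum_sub_distrib, ← Finset.mul_sum, ← Finset.mul_sum, hc, hs]
    ring
  have hpos : ∀ i, 0 < α - a i.castSucc → α - a i.castSucc < π → 0 < t i := fun i h1 h2 =>
    mul_pos (hl i) (sin_pos_of_pos_of_lt_pi h1 h2)
  have hpos' : ∀ i, π < a i.castSucc - α → a i.castSucc - α < 2 * π → 0 < t i := by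
    intro i h1 h2
    refine mul_pos (hl i) ?_
    rw [← sin_add_two_pi]
    exact sin_pos_of_pos_of_lt_pi (by linarith) (by linarith)
  have hneg : ∀ i, 0 < a i.castSucc - α → a i.castSucc - α < π → t i < 0 := fun i h1 h2 =>
    mul_neg_of_pos_of_neg (hl i) (sin_neg_of_neg_of_neg_pi_lt (by linarith) (by linarith))
  have hneg' : ∀ i, π < α - a i.castSucc → α - a i.castSucc < 2 * π → t i < 0 := by
    intro i h1 h2
    refine mul_neg_of_pos_of_neg (hl i) ?_
    rw [← sin_sub_two_pi]
    exact sin_neg_of_neg_of_neg_pi_lt (by linarith) (by linarith)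
  have hnn : ∀ i, 0 ≤ α - a i.castSucc → α - a i.castSucc ≤ π → 0 ≤ t i := fun i h1 h2 =>
    mul_nonneg (hl i).le (sin_nonneg_of_nonneg_of_le_pi h1 h2)
  have hnp : ∀ i, 0 ≤ a i.castSucc - α → a i.castSucc - α ≤ π → t i ≤ 0 := by
    intro i h1 h2
    refine mul_nonpos_of_nonneg_of_nonpos (hl i).le ?_
    rw [← neg_sub, sin_neg, neg_nonpos]
    exact sin_nonneg_of_nonneg_of_le_pi h1 h2
  have hge0 : ∀ i : Fin m, a 0 ≤ a i.castSucc := fun i => hmono.monotone (Fin.zero_le _)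
  have hlt2 : ∀ i : Fin m, a i.castSucc < a 0 + 2 * π := fun i =>
    h0 ▸ hmono (Fin.castSucc_lt_last i)
  have hz2 : a z.succ ≤ a 0 + 2 * π := h0 ▸ hmono.monotone (Fin.le_last _)
  have hle : ∀ i k : Fin m, i ≤ k → a i.castSucc ≤ a k.castSucc := fun i k h =>
    hmono.monotone (by simpa using h)
  have hgt : ∀ i : Fin m, z < i → a z.succ ≤ a i.castSucc := fun i h =>
    hmono.monotone (by
      simp only [Fin.le_def, Fin.lt_def, Fin.val_succ, Fin.val_castSucc] at h ⊢; omega)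
  rw [← sub_pos]
  rcases lt_or_gt_of_ne hjz with hj | hj
  · by_cases hall : ∀ i, j < i → i ≤ z → α - a i.castSucc ≤ π
    · rw [← Finset.sum_sub_distrib]
      refine Finset.sum_pos' (fun i _ => ?_) ⟨z, Finset.mem_univ z, ?_⟩
      · by_cases h1 : i ≤ j
        · simp [h1, h1.trans hj.le]
        · by_cases h2 : i ≤ z
          · simp only [h1, h2, if_true, if_false, sub_zero]
            exact hnn i (by linarith [hle i z h2]) (hall i (not_le.1 h1) h2)
          · simp [h1, h2]
      · simp only [le_refl, if_true, hj.not_ge, if_false, sub_zero]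
        exact hpos z (by linarith) (by linarith [hpi z])
    · push Not at hall
      obtain ⟨k, hjk, hkz, hk⟩ := hall
      have e : ∑ i, (if i ≤ z then t i else 0) - ∑ i, (if i ≤ j then t i else 0) =
          ∑ i, ((if i ≤ z then t i else 0) - (if i ≤ j then t i else 0) - t i) := by
        rw [Finset.sum_sub_distrib, Finset.sum_sub_distrib, htot, sub_zero]
      have h3 : ∀ i, i ≤ j → t i < 0 := fun i hi => hneg' i
        (by linarith [hle i k (hi.trans hjk.le)]) (by linarith [hge0 i])
      have h4 : ∀ i, z < i → t i < 0 := fun i hi => hneg i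
        (by linarith [hgt i hi]) (by linarith [hge0 k, hlt2 i])
      rw [e]
      refine Finset.sum_pos' (fun i _ => ?_) ⟨j, Finset.mem_univ j, ?_⟩
      · by_cases h1 : i ≤ j
        · simp only [h1, h1.trans hj.le, if_true]
          linarith [h3 i h1]
        · by_cases h2 : i ≤ z
          · simp [h1, h2]
          · simp only [h1, h2, if_false]
            linarith [h4 i (not_le.1 h2)]
      · simp only [le_refl, hj.le, if_true]
        linarith [h3 j le_rfl]
  · by_cases hall : ∀ i, z < i → i ≤ j → a i.castSucc - α ≤ π
    · rw [← Finset.sum_sub_distrib]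
      have hlt' : (z : ℕ) + 1 < m := by
        have := j.isLt
        have h : (z : ℕ) < j := hj
        omega
      refine Finset.sum_pos' (fun i _ => ?_) ⟨⟨z + 1, hlt'⟩, Finset.mem_univ _, ?_⟩
      · by_cases h1 : i ≤ z
        · simp [h1, h1.trans hj.le]
        · by_cases h2 : i ≤ j
          · simp only [h1, h2, if_true, if_false]
            linarith [hnp i (by linarith [hgt i (not_le.1 h1)]) (hall i (not_le.1 h1) h2)]
          · simp [h1, h2]
      · have h1 : ¬ (⟨z + 1, hlt'⟩ : Fin m) ≤ z := by simp [Fin.le_def]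
        have h2 : (⟨z + 1, hlt'⟩ : Fin m) ≤ j := by
          rw [Fin.le_def]; exact Nat.succ_le_of_lt hj
        have h3 : a (⟨z + 1, hlt'⟩ : Fin m).castSucc = a z.succ := rfl
        simp only [h1, h2, if_true, if_false]
        have := hneg ⟨z + 1, hlt'⟩ (by rw [h3]; linarith) (by rw [h3]; linarith [hpi z])
        linarith
    · push Not at hall
      obtain ⟨k, hzk, hkj, hk⟩ := hall
      have e : ∑ i, (if i ≤ z then t i else 0) - ∑ i, (if i ≤ j then t i else 0) =
          ∑ i, ((if i ≤ z then t i else 0) - (if i ≤ j then t i else 0) + t i) := by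
        rw [Finset.sum_add_distrib, Finset.sum_sub_distrib, htot, add_zero]
      have h3 : ∀ i, i ≤ z → 0 < t i := fun i hi => hpos i
        (by linarith [hle i z hi]) (by linarith [hge0 i, hlt2 k])
      have h4 : ∀ i, j < i → 0 < t i := fun i hi => hpos' i
        (by linarith [hle k i (hkj.trans hi.le)]) (by linarith [hlt2 i, hge0 z])
      rw [e]
      refine Finset.sum_pos' (fun i _ => ?_) ⟨z, Finset.mem_univ z, ?_⟩
      · by_cases h1 : i ≤ z
        · simp only [h1, h1.trans hj.le, if_true]
          linarith [h3 i h1]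
        · by_cases h2 : i ≤ j
          · simp [h1, h2]
          · simp only [h1, h2, if_false]
            linarith [h4 i (not_le.1 h2)]
      · simp only [le_refl, hj.le, if_true]
        linarith [h3 z le_rfl]

end Fan

/-! ### Polar angles and questions with a prescribed response law -/

section Angle

open Real Filter

variable {d : ℕ} (v v' : EuclideanSpace ℝ (Fin d))

/-- Polar angle of the projection of `θ` to the plane of `v` and `w`. -/
def planeAngle (v w θ : EuclideanSpace ℝ (Fin d)) : ℝ :=
  Complex.arg ⟨inner ℝ θ v, inner ℝ θ w⟩

/-- Norm of the projection of `θ` to the plane of `v` and `w`. -/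
def planeRadius (v w θ : EuclideanSpace ℝ (Fin d)) : ℝ :=
  ‖(⟨inner ℝ θ v, inner ℝ θ w⟩ : ℂ)‖

/-- An identity in the coordinates `(⟪θ, v⟫, ⟪θ, v'⟫)`; it needs no orthonormality of `v` and `v'`.
-/
theorem inner_rotated (θ : EuclideanSpace ℝ (Fin d)) (x : ℝ) :
    inner ℝ θ (-(sin x) • v + cos x • v') =
      planeRadius v v' θ * sin (planeAngle v v' θ - x) := by
  have h1 := Complex.norm_mul_cos_arg (⟨inner ℝ θ v, inner ℝ θ v'⟩ : ℂ)
  have h2 := Complex.norm_mul_sin_arg (⟨inner ℝ θ v, inner ℝ θ v'⟩ : ℂ)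
  simp only at h1 h2
  rw [inner_add_right, inner_smul_right, inner_smul_right, sin_sub, planeRadius, planeAngle]
  linear_combination sin x * h1 - cos x * h2

theorem measurable_planeAngle : Measurable (planeAngle v v') := by
  have h : Measurable fun θ : EuclideanSpace ℝ (Fin d) =>
      (⟨inner ℝ θ v, inner ℝ θ v'⟩ : ℂ) := by
    have : (fun θ : EuclideanSpace ℝ (Fin d) => (⟨inner ℝ θ v, inner ℝ θ v'⟩ : ℂ)) =
        fun θ => Complex.measurableEquivRealProd.symm (inner ℝ θ v, inner ℝ θ v') := rfl
    rw [this]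
    exact Complex.measurableEquivRealProd.symm.measurable.comp (by fun_prop)
  exact Complex.measurable_arg.comp h

variable {v v'}

theorem rotated_ne_zero (hv : LinearIndependent ℝ ![v, v']) (x : ℝ) :
    -(sin x) • v + cos x • v' ≠ 0 := by
  intro h
  have := LinearIndependent.pair_iff.1 hv _ _ h
  have h2 := sin_sq_add_cos_sq x
  rw [this.2, neg_eq_zero.1 this.1] at h2
  norm_num at h2

variable (μ : Measure (EuclideanSpace ℝ (Fin d)))

/-- A zero radius, or an angle equal to `x` modulo full turns, puts `θ` on the hyperplane orthogonal
to the rotated vector, which is null. -/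
theorem ae_planeAngle_ne (hμ : μ ≪ volume) (hv : LinearIndependent ℝ ![v, v']) (x : ℝ) :
    ∀ᵐ θ ∂μ, 0 < planeRadius v v' θ ∧ ∀ k : ℤ, planeAngle v v' θ + k * (2 * π) ≠ x := by
  have h := hμ (volume_inner_eq_zero (rotated_ne_zero hv x))
  rw [← compl_mem_ae_iff] at h
  filter_upwards [h] with θ hθ
  have h1 : inner ℝ θ (-(sin x) • v + cos x • v') ≠ 0 := hθ
  rw [inner_rotated] at h1
  refine ⟨lt_of_le_of_ne (norm_nonneg _) (left_ne_zero_of_mul h1).symm, fun k hk => ?_⟩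
  refine right_ne_zero_of_mul h1 ?_
  rw [← hk, sub_add_cancel_left, ← sin_zero, ← sin_add_int_mul_two_pi _ k]
  simp

/-- Distribution function of the polar angle, with period `2π` up to an increment of `1`. -/
def angleCdf (v v' : EuclideanSpace ℝ (Fin d)) (x : ℝ) : ℝ :=
  ∫ θ, (⌊(x - planeAngle v v' θ) / (2 * π)⌋ : ℝ) ∂μ

theorem measurable_floor_planeAngle (x : ℝ) :
    Measurable fun θ => (⌊(x - planeAngle v v' θ) / (2 * π)⌋ : ℝ) :=
  measurable_from_top.comp
    (Int.measurable_floor.comp (((measurable_planeAngle v v').const_sub x).div_const _))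

theorem abs_floor_planeAngle_le (x : ℝ) (θ : EuclideanSpace ℝ (Fin d)) :
    |(⌊(x - planeAngle v v' θ) / (2 * π)⌋ : ℝ)| ≤ |x| + 2 := by
  have h1 : -π < planeAngle v v' θ := Complex.neg_pi_lt_arg _
  have h2 : planeAngle v v' θ ≤ π := Complex.arg_le_pi _
  have h3 := Int.floor_le ((x - planeAngle v v' θ) / (2 * π))
  have h4 := Int.lt_floor_add_one ((x - planeAngle v v' θ) / (2 * π))
  have h5 : |(x - planeAngle v v' θ) / (2 * π)| ≤ |x| + 1 := by
    rw [abs_div, abs_of_pos two_pi_pos, div_le_iff₀ two_pi_pos]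
    have h6 : |x - planeAngle v v' θ| ≤ |x| + π :=
      (abs_sub _ _).trans (add_le_add_right (abs_le.2 ⟨h1.le, h2⟩) _)
    have := abs_nonneg x
    nlinarith [pi_gt_three]
  rw [abs_le] at h5 ⊢
  constructor <;> linarith [h5.1, h5.2]

variable [IsProbabilityMeasure μ]

theorem integrable_floor_planeAngle (x : ℝ) :
    Integrable (fun θ => (⌊(x - planeAngle v v' θ) / (2 * π)⌋ : ℝ)) μ :=
  Integrable.mono' (integrable_const (|x| + 2))
    (measurable_floor_planeAngle x).aestronglyMeasurable
    (Eventually.of_forall fun θ => abs_floor_planeAngle_le x θ)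

theorem monotone_angleCdf : Monotone (angleCdf μ v v') := by
  intro x y hxy
  refine integral_mono (integrable_floor_planeAngle μ x) (integrable_floor_planeAngle μ y)
    fun θ => ?_
  have := pi_pos
  simp only [Int.cast_le]
  gcongr

theorem angleCdf_add_two_pi (x : ℝ) : angleCdf μ v v' (x + 2 * π) = angleCdf μ v v' x + 1 := by
  have h : ∀ θ, (⌊(x + 2 * π - planeAngle v v' θ) / (2 * π)⌋ : ℝ) =
      (⌊(x - planeAngle v v' θ) / (2 * π)⌋ : ℝ) + 1 := by
    intro θ
    have : (x + 2 * π - planeAngle v v' θ) / (2 * π) =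
        (x - planeAngle v v' θ) / (2 * π) + 1 := by
      have := pi_pos.ne'
      field_simp
      ring
    rw [this, Int.floor_add_one]
    push_cast
    ring
  simp_rw [angleCdf, h]
  rw [integral_add (integrable_floor_planeAngle μ x) (integrable_const _)]
  simp

theorem continuous_angleCdf (hμ : μ ≪ volume) (hv : LinearIndependent ℝ ![v, v']) :
    Continuous (angleCdf μ v v') := by
  refine continuous_iff_continuousAt.2 fun x => ?_
  refine continuousAt_of_dominated (bound := fun _ => |x| + 3) ?_ ?_ (integrable_const _) ?_
  · exact Eventually.of_forall fun y => (measurable_floor_planeAngle y).aestronglyMeasurable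
  · filter_upwards [Metric.ball_mem_nhds x one_pos] with y hy
    refine Eventually.of_forall fun θ => ?_
    have h1 := abs_floor_planeAngle_le (v := v) (v' := v') y θ
    rw [Metric.mem_ball, Real.dist_eq] at hy
    have h2 := abs_sub_abs_le_abs_sub y x
    rw [Real.norm_eq_abs]
    linarith
  · filter_upwards [ae_planeAngle_ne μ hμ hv x] with θ hθ
    set y := (x - planeAngle v v' θ) / (2 * π) with hy
    have hne : (⌊y⌋ : ℝ) ≠ y := by
      intro h
      refine hθ.2 ⌊y⌋ ?_
      rw [h, hy]
      have := pi_pos.ne'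
      field_simp
      ring
    have h1 : ContinuousAt (fun y : ℝ => (⌊y⌋ : ℝ)) y :=
      ((continuousOn_floor ⌊y⌋).mono Set.Ioo_subset_Ico_self).continuousAt
        (Ioo_mem_nhds (lt_of_le_of_ne (Int.floor_le y) hne) (Int.lt_floor_add_one y))
    have h2 : ContinuousAt (fun x => (x - planeAngle v v' θ) / (2 * π)) x := by fun_prop
    exact ContinuousAt.comp (g := fun y : ℝ => (⌊y⌋ : ℝ)) h1 h2

/-- On an arc shorter than a full turn the two floors differ by at most one, and they differ only if
a lift of the angle lies between the endpoints. The endpoint `b` itself is excluded almost surely.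
-/
theorem angleCdf_sub_le (hμ : μ ≪ volume) (hv : LinearIndependent ℝ ![v, v']) {a b : ℝ}
    (hab : b < a + π) {A : Set (EuclideanSpace ℝ (Fin d))} (hA : MeasurableSet A)
    (h : ∀ θ, 0 < planeRadius v v' θ → ∀ k : ℤ, a < planeAngle v v' θ + k * (2 * π) →
      planeAngle v v' θ + k * (2 * π) < b → θ ∈ A) :
    angleCdf μ v v' b - angleCdf μ v v' a ≤ μ.real A := by
  rw [angleCdf, angleCdf, ← integral_sub (integrable_floor_planeAngle μ b)
    (integrable_floor_planeAngle μ a)]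
  have e : μ.real A = ∫ θ, A.indicator (fun _ => (1 : ℝ)) θ ∂μ := by
    rw [integral_indicator_const _ hA, smul_eq_mul, mul_one]
  rw [e]
  refine integral_mono_ae ((integrable_floor_planeAngle μ b).sub
    (integrable_floor_planeAngle μ a)) ((integrable_const _).indicator hA) ?_
  filter_upwards [ae_planeAngle_ne μ hμ hv b] with θ hθ
  set α := planeAngle v v' θ with hα
  set n := ⌊(b - α) / (2 * π)⌋ with hn
  set k := ⌊(a - α) / (2 * π)⌋ with hk
  have hπ := two_pi_pos
  have hn1 : n * (2 * π) ≤ b - α := (le_div_iff₀ hπ).1 (Int.floor_le _)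
  have hn2 : b - α < (n + 1) * (2 * π) := (div_lt_iff₀ hπ).1 (Int.lt_floor_add_one _)
  have hk1 : k * (2 * π) ≤ a - α := (le_div_iff₀ hπ).1 (Int.floor_le _)
  have hk2 : a - α < (k + 1) * (2 * π) := (div_lt_iff₀ hπ).1 (Int.lt_floor_add_one _)
  by_cases hkn : n ≤ k
  · have h1 : (n : ℝ) ≤ k := by exact_mod_cast hkn
    have h2 : 0 ≤ A.indicator (fun _ => (1 : ℝ)) θ := Set.indicator_nonneg (by simp) θ
    linarith
  · push Not at hkn
    have h1 : ((k : ℝ) + 1) ≤ n := by exact_mod_cast hkn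
    have h2 : n ≤ k + 1 := by
      by_contra hcon
      push Not at hcon
      have h3 : ((k : ℝ) + 2) ≤ n := by exact_mod_cast (by omega : k + 2 ≤ n)
      nlinarith [pi_pos]
    have h3 : θ ∈ A := by
      refine h θ hθ.1 n ?_ (lt_of_le_of_ne (by linarith) (hθ.2 n))
      nlinarith [pi_pos]
    rw [Set.indicator_of_mem h3]
    have h4 : (n : ℝ) ≤ k + 1 := by exact_mod_cast h2
    linarith

/-- As `⟪θ, v⟫` is the first coordinate, the open halfspace consists of angles in `(-π/2, π/2)`.
This supplies the heavy half circle for `exists_short_arcs`. -/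
theorem measureReal_halfspace_le (hμ : μ ≪ volume) (hv0 : v ≠ 0) :
    μ.real {θ | 0 ≤ inner ℝ θ v} ≤ angleCdf μ v v' (-(π / 2) + π) - angleCdf μ v v' (-(π / 2)) := by
  have hA : MeasurableSet {θ : EuclideanSpace ℝ (Fin d) | 0 ≤ inner ℝ θ v} := by
    rw [← region_cons_zero]
    exact measurableSet_region _ _
  rw [angleCdf, angleCdf, ← integral_sub (integrable_floor_planeAngle μ _)
    (integrable_floor_planeAngle μ _)]
  have e : μ.real {θ | 0 ≤ inner ℝ θ v} =
      ∫ θ, {θ : EuclideanSpace ℝ (Fin d) | 0 ≤ inner ℝ θ v}.indicator (fun _ => (1 : ℝ)) θ ∂μ := by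
    rw [integral_indicator_const _ hA, smul_eq_mul, mul_one]
  rw [e]
  refine integral_mono_ae ((integrable_const _).indicator hA)
    ((integrable_floor_planeAngle μ _).sub (integrable_floor_planeAngle μ _)) ?_
  have h := hμ (volume_inner_eq_zero hv0)
  rw [← compl_mem_ae_iff] at h
  filter_upwards [h] with θ hθ
  have hπ := two_pi_pos
  by_cases h1 : 0 ≤ inner ℝ θ v
  · have h2 : 0 < inner ℝ θ v := lt_of_le_of_ne h1 fun h => hθ h.symm
    have h3 : |planeAngle v v' θ| < π / 2 :=
      Complex.abs_arg_lt_pi_div_two_iff.2 (Or.inl h2)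
    rw [abs_lt] at h3
    have h4 : (0 : ℤ) ≤ ⌊(-(π / 2) + π - planeAngle v v' θ) / (2 * π)⌋ := by
      rw [Int.le_floor, le_div_iff₀ hπ]
      push_cast
      linarith
    have h5 : ⌊(-(π / 2) - planeAngle v v' θ) / (2 * π)⌋ < 0 := by
      rw [Int.floor_lt, div_lt_iff₀ hπ]
      push_cast
      linarith
    have h6 : ((0 : ℤ) : ℝ) ≤ ⌊(-(π / 2) + π - planeAngle v v' θ) / (2 * π)⌋ := by
      exact_mod_cast h4
    have h7 : ((⌊(-(π / 2) - planeAngle v v' θ) / (2 * π)⌋ + 1 : ℤ) : ℝ) ≤ 0 := by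
      exact_mod_cast h5
    rw [Set.indicator_of_mem (by exact h1)]
    push_cast at h6 h7
    linarith
  · rw [Set.indicator_of_notMem (by exact h1), sub_nonneg, Int.cast_le]
    gcongr
    linarith [pi_pos]

/-- Every positive target distribution whose components are smaller than the mass of some
halfspace is the response distribution of a question. -/
theorem exists_question_measureReal_eq (hd : 2 ≤ d) {m : ℕ} (hm : 3 ≤ m) (hμ : μ ≪ volume)
    (hv0 : v ≠ 0) {w : Fin m → ℝ} (hw : ∀ i, 0 < w i) (hsum : ∑ i, w i = 1)
    (hlt : ∀ i, w i < μ.real {θ | 0 ≤ inner ℝ θ v}) :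
    ∃ X : Fin m → EuclideanSpace ℝ (Fin d), Function.Injective X ∧
      ∀ z, μ.real (region X z) = w z := by
  obtain ⟨v', hv⟩ := exists_linearIndependent_pair_of_one_lt_finrank
    (R := ℝ) (M := EuclideanSpace ℝ (Fin d)) (by rw [finrank_euclideanSpace_fin]; omega) hv0
  obtain ⟨a, h0, ha⟩ := exists_short_arcs hm (monotone_angleCdf μ) (continuous_angleCdf μ hμ hv)
    (angleCdf_add_two_pi μ) hw hsum fun i => (hlt i).trans_le
      (measureReal_halfspace_le (v' := v') μ hμ hv0)
  obtain ⟨l, hl, hc, hs⟩ := exists_positive_relation h0 (fun i => (ha i).2.1) fun i => (ha i).2.2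
  -- Vertices of the polygon: partial sums of the cut directions, turned by a right angle and scaled
  -- by the positive relation.
  set X : Fin m → EuclideanSpace ℝ (Fin d) := fun z => ∑ i, if i ≤ z then
    l i • (-(sin (a i.castSucc)) • v + cos (a i.castSucc) • v') else 0 with hX
  have hinner : ∀ θ z (k : ℤ), inner ℝ θ (X z) = planeRadius v v' θ * ∑ i, if i ≤ z then
      l i * sin (planeAngle v v' θ + k * (2 * π) - a i.castSucc) else 0 := by
    intro θ z k
    rw [hX, inner_sum, Finset.mul_sum]
    refine Finset.sum_congr rfl fun i _ => ?_
    split_ifs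
    · rw [inner_smul_right, inner_rotated, add_sub_right_comm, sin_add_int_mul_two_pi]
      ring
    · simp
  -- One inequality per region suffices, since both families of masses have total one.
  have hle : ∀ z, w z ≤ μ.real (region X z) := by
    intro z
    have h1 : w z = angleCdf μ v v' (a z.succ) - angleCdf μ v v' (a z.castSucc) := by
      rw [(ha z).1]; ring
    rw [h1]
    refine angleCdf_sub_le μ hμ hv (ha z).2.2 (measurableSet_region X z)
      fun θ hθ k hk0 hk1 => ?_
    have h2 : ∀ j, j ≠ z → inner ℝ θ (X j) < inner ℝ θ (X z) := by
      intro j hj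
      rw [hinner θ j k, hinner θ z k]
      exact mul_lt_mul_of_pos_left (partial_sum_lt_of_mem_sector h0 (fun i => (ha i).2.1)
        (fun i => (ha i).2.2) hl hc hs hj hk0 hk1) hθ
    exact ⟨fun i hi => (h2 i hi.ne').le, fun i hi => h2 i hi.ne⟩
  have htot := sum_measureReal_region (by omega) X μ
  have heq : ∀ z, μ.real (region X z) = w z := by
    have h := (Finset.sum_eq_sum_iff_of_le fun z (_ : z ∈ Finset.univ) => hle z).1
      (hsum.trans htot.symm)
    exact fun z => (h z (Finset.mem_univ z)).symm
  refine ⟨X, ?_, heq⟩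
  -- Of two equal alternatives the later is never the response, which contradicts its positive mass.
  have hinj : ∀ i j, i < j → X i ≠ X j := by
    intro i j hij hXij
    have hempty : region X j = ∅ := by
      refine Set.eq_empty_of_forall_notMem fun θ hθ => ?_
      have := hθ.2 i hij
      rw [hXij] at this
      exact lt_irrefl _ this
    have h1 := heq j
    rw [hempty, measureReal_empty] at h1
    exact (hw j).ne h1
  intro i j hXij
  by_contra hne
  rcases lt_or_gt_of_ne hne with h | h
  · exact hinj i j h hXij
  · exact hinj j i h hXij.symm

end Angle

end PreferenceLearning

end

noncomputable section

set_option linter.unusedSectionVars false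

namespace PreferenceLearning

/-! ### Response laws attainable under a given halfspace depth -/

section Depth

variable {d m : ℕ} (μ : Measure (EuclideanSpace ℝ (Fin d)))

theorem bddBelow_halfspace : BddBelow (Set.range
    fun v : {v : EuclideanSpace ℝ (Fin d) // v ≠ 0} => μ.real {θ | 0 ≤ inner ℝ θ v.1}) :=
  ⟨0, by rintro _ ⟨v, rfl⟩; exact measureReal_nonneg⟩

theorem halfspaceDepth_le {v : EuclideanSpace ℝ (Fin d)} (hv : v ≠ 0) :
    halfspaceDepth μ ≤ μ.real {θ | 0 ≤ inner ℝ θ v} :=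
  ciInf_le (bddBelow_halfspace μ) ⟨v, hv⟩

theorem exists_ne_zero (hd : 0 < d) : ∃ v : EuclideanSpace ℝ (Fin d), v ≠ 0 :=
  ⟨EuclideanSpace.single ⟨0, hd⟩ 1, by simp⟩

theorem measurableSet_halfspace (v : EuclideanSpace ℝ (Fin d)) :
    MeasurableSet {θ : EuclideanSpace ℝ (Fin d) | 0 ≤ inner ℝ θ v} := by
  rw [← region_cons_zero]
  exact measurableSet_region _ _

variable [IsProbabilityMeasure μ]

theorem measureReal_halfspace_neg (hμ : μ ≪ volume) {v : EuclideanSpace ℝ (Fin d)} (hv : v ≠ 0) :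
    μ.real {θ | 0 ≤ inner ℝ θ (-v)} = 1 - μ.real {θ | 0 ≤ inner ℝ θ v} := by
  rw [← probReal_compl_eq_one_sub (measurableSet_halfspace v)]
  refine measureReal_congr ?_
  have h := hμ (volume_inner_eq_zero hv)
  rw [← compl_mem_ae_iff] at h
  filter_upwards [h] with θ hθ
  have h1 : inner ℝ θ v ≠ 0 := hθ
  refine propext ?_
  change 0 ≤ inner ℝ θ (-v) ↔ ¬ 0 ≤ inner ℝ θ v
  rw [inner_neg_right, not_le, neg_nonneg]
  exact ⟨fun h => lt_of_le_of_ne h h1, le_of_lt⟩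

theorem halfspaceDepth_le_half (hd : 0 < d) (hμ : μ ≪ volume) : halfspaceDepth μ ≤ 1 / 2 := by
  obtain ⟨v, hv⟩ := exists_ne_zero hd
  have h1 := halfspaceDepth_le μ hv
  have h2 := halfspaceDepth_le μ (neg_ne_zero.2 hv)
  rw [measureReal_halfspace_neg μ hμ hv] at h2
  linarith

theorem exists_halfspace_gt (hd : 0 < d) (hμ : μ ≪ volume) {c : ℝ} (hc : c < 1 - halfspaceDepth μ) :
    ∃ v : EuclideanSpace ℝ (Fin d), v ≠ 0 ∧ c < μ.real {θ | 0 ≤ inner ℝ θ v} := by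
  obtain ⟨v₀, hv₀⟩ := exists_ne_zero hd
  have : Nonempty {v : EuclideanSpace ℝ (Fin d) // v ≠ 0} := ⟨⟨v₀, hv₀⟩⟩
  have h1 : halfspaceDepth μ < 1 - c := by linarith
  obtain ⟨v, hv⟩ := exists_lt_of_ciInf_lt h1
  refine ⟨-v.1, neg_ne_zero.2 v.2, ?_⟩
  rw [measureReal_halfspace_neg μ hμ v.2]
  linarith

/-- The mass depends only on the direction of the normal, so the minimum over the compact unit
sphere is the depth. -/
theorem exists_halfspaceDepth_eq (hd : 0 < d) (hμ : μ ≪ volume) :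
    ∃ v : EuclideanSpace ℝ (Fin d), v ≠ 0 ∧ μ.real {θ | 0 ≤ inner ℝ θ v} = halfspaceDepth μ := by
  obtain ⟨v₀, hv₀⟩ := exists_ne_zero hd
  have : Nonempty {v : EuclideanSpace ℝ (Fin d) // v ≠ 0} := ⟨⟨v₀, hv₀⟩⟩
  have hunit : ∀ v : EuclideanSpace ℝ (Fin d), v ≠ 0 →
      ‖v‖⁻¹ • v ∈ Metric.sphere (0 : EuclideanSpace ℝ (Fin d)) 1 := by
    intro v hv
    rw [mem_sphere_zero_iff_norm, norm_smul, norm_inv, norm_norm,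
      inv_mul_cancel₀ (norm_ne_zero_iff.2 hv)]
  have hne : ∀ v ∈ Metric.sphere (0 : EuclideanSpace ℝ (Fin d)) 1, v ≠ 0 := by
    rintro v hv rfl
    simp at hv
  obtain ⟨v, hv, hmin⟩ := (isCompact_sphere (0 : EuclideanSpace ℝ (Fin d)) 1).exists_isMinOn
    ⟨_, hunit v₀ hv₀⟩ fun v hv =>
      (continuousAt_measureReal_halfspace μ hμ (hne v hv)).continuousWithinAt
  refine ⟨v, hne v hv, le_antisymm (le_ciInf fun w => ?_) (halfspaceDepth_le μ (hne v hv))⟩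
  have h1 := hmin (hunit w.1 w.2)
  have h2 : {θ : EuclideanSpace ℝ (Fin d) | 0 ≤ inner ℝ θ (‖w.1‖⁻¹ • w.1)} =
      {θ | 0 ≤ inner ℝ θ w.1} := by
    ext θ
    simp only [Set.mem_ofPred_eq, inner_smul_right]
    exact mul_nonneg_iff_of_pos_left (inv_pos.2 (norm_pos_iff.2 w.2))
  simp only [Set.mem_ofPred_eq, h2] at h1
  exact h1

/-- Intermediate values between a minimizing normal and its negative, in the punctured space, which
is connected for `2 ≤ d`. -/
theorem exists_halfspace_eq (hd : 2 ≤ d) (hμ : μ ≪ volume) {t : ℝ} (h0 : halfspaceDepth μ ≤ t)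
    (h1 : t ≤ 1 - halfspaceDepth μ) :
    ∃ v : EuclideanSpace ℝ (Fin d), v ≠ 0 ∧ μ.real {θ | 0 ≤ inner ℝ θ v} = t := by
  obtain ⟨v, hv, hvd⟩ := exists_halfspaceDepth_eq μ (by omega) hμ
  have hrank : 1 < Module.rank ℝ (EuclideanSpace ℝ (Fin d)) := by
    rw [← Module.finrank_eq_rank, finrank_euclideanSpace_fin]
    exact_mod_cast hd
  have hpre := (isConnected_compl_singleton_of_one_lt_rank hrank
    (0 : EuclideanSpace ℝ (Fin d))).isPreconnected
  have hcont : ContinuousOn (fun v => μ.real {θ | 0 ≤ inner ℝ θ v})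
      ({0}ᶜ : Set (EuclideanSpace ℝ (Fin d))) := fun w hw =>
    (continuousAt_measureReal_halfspace μ hμ hw).continuousWithinAt
  have h2 := hpre.intermediate_value (a := v) (b := -v) hv (neg_ne_zero.2 hv) hcont
  obtain ⟨w, hw, hwt⟩ := h2 ⟨hvd.trans_le h0, by
    rw [measureReal_halfspace_neg μ hμ hv, hvd]; exact h1⟩
  exact ⟨w, hw, hwt⟩

theorem exists_binary_question_sq_le (hd : 2 ≤ d) (hμ : μ ≪ volume) {u : Fin 2 → ℝ}
    (hu : u ∈ stdSimplex ℝ (Fin 2)) :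
    ∃ X : Fin 2 → EuclideanSpace ℝ (Fin d), Function.Injective X ∧
      ∑ z, (μ.real (region X z) - u z) ^ 2 ≤ 2 * shortfall u 0 μ ^ 2 := by
  set δ := halfspaceDepth μ with hδ
  have hδ2 : δ ≤ 1 / 2 := halfspaceDepth_le_half μ (by omega) hμ
  have hsum : u 0 + u 1 = 1 := by simpa [Fin.sum_univ_two] using hu.2
  have hle : ∀ z, u z - (1 - δ) ≤ shortfall u 0 μ := by
    intro z
    refine le_trans ?_ (le_max_left _ _)
    have := le_ciSup (Set.finite_range u).bddAbove z
    linarith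
  have hσ : 0 ≤ shortfall u 0 μ := le_max_right _ _
  have h0 := hle 0
  have h1 := hle 1
  -- `t` is `u 0` clamped to `[δ, 1 - δ]`. If `u 0 < δ`, then `u 1` exceeds `1 - δ` by the same
  -- amount. Both components err equally, whence the factor `2`.
  obtain ⟨t, ht0, ht1, ht⟩ : ∃ t, δ ≤ t ∧ t ≤ 1 - δ ∧ |t - u 0| ≤ shortfall u 0 μ := by
    rcases le_total (u 0) δ with h | h
    · exact ⟨δ, le_rfl, by linarith, by rw [abs_le]; constructor <;> linarith⟩
    · rcases le_total (u 0) (1 - δ) with h' | h'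
      · exact ⟨u 0, h, h', by simpa using hσ⟩
      · exact ⟨1 - δ, by linarith, le_rfl, by rw [abs_le]; constructor <;> linarith⟩
  obtain ⟨v, hv, hvt⟩ := exists_halfspace_eq μ hd hμ ht0 ht1
  refine ⟨![v, 0], injective_cons_zero hv, ?_⟩
  have htot := sum_measureReal_region two_pos ![v, 0] μ
  rw [Fin.sum_univ_two] at htot ⊢
  rw [region_cons_zero, hvt] at htot ⊢
  have h2 : μ.real (region ![v, 0] 1) - u 1 = -(t - u 0) := by linarith
  have h3 : (t - u 0) ^ 2 ≤ shortfall u 0 μ ^ 2 := sq_le_sq' (by linarith [(abs_le.1 ht).1])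
    (abs_le.1 ht).2
  rw [h2, neg_sq]
  linarith

theorem exists_multiple_question_sq_le (hd : 2 ≤ d) (hm : 2 < m) (hμ : μ ≪ volume)
    {u : Fin m → ℝ} (hu : u ∈ stdSimplex ℝ (Fin m)) (hpos : ∀ z, 0 < u z) {ε : ℝ} (hε : 0 < ε) :
    ∃ X : Fin m → EuclideanSpace ℝ (Fin d), Function.Injective X ∧
      ∑ z, (μ.real (region X z) - u z) ^ 2 ≤
        (1 + 1 / ((m : ℝ) - 1)) * shortfall u ε μ ^ 2 := by
  have hne : Nonempty (Fin m) := ⟨⟨0, by omega⟩⟩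
  set δ := halfspaceDepth μ with hδ
  have hδ2 : δ ≤ 1 / 2 := halfspaceDepth_le_half μ (by omega) hμ
  have hm1 : (0 : ℝ) < (m : ℝ) - 1 := by
    have : (2 : ℝ) < m := by exact_mod_cast hm
    linarith
  obtain ⟨y, hy⟩ := Finite.exists_max u
  obtain ⟨x, hx⟩ := Finite.exists_min u
  set r := u x with hr
  have hr0 : 0 < r := hpos x
  have hsup : ⨆ z, u z = u y :=
    le_antisymm (ciSup_le hy) (le_ciSup (Set.finite_range u).bddAbove y)
  -- A strict margin is needed, since the components must lie strictly below the mass of some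
  -- halfspace. The bound by `r / 3` keeps the trimmed component positive and the enlarged ones
  -- below `1 - δ`.
  set η := min ε (r / 3) with hη
  have hη0 : 0 < η := lt_min hε (by positivity)
  have hηε : η ≤ ε := min_le_left _ _
  have hηr : η ≤ r / 3 := min_le_right _ _
  have hthree : ∀ w : Fin m → ℝ, (∀ z, 0 ≤ w z) → ∀ z, z ≠ y →
      ∃ k, w y + w z + w k ≤ ∑ i, w i := by
    intro w hw z hz
    obtain ⟨k, hk⟩ : ∃ k, k ∉ ({y, z} : Finset (Fin m)) := by
      by_contra hcon
      push Not at hcon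
      have h1 : (Finset.univ : Finset (Fin m)) ⊆ {y, z} := fun k _ => hcon k
      have h2 := Finset.card_le_card h1
      rw [Finset.card_univ, Fintype.card_fin] at h2
      have h3 := Finset.card_le_two (a := y) (b := z)
      omega
    have h2 := Finset.sum_le_sum_of_subset_of_nonneg
      (Finset.subset_univ ({k, y, z} : Finset (Fin m))) fun l _ _ => hw l
    rw [Finset.sum_insert hk, Finset.sum_insert (by simpa using hz.symm),
      Finset.sum_singleton] at h2
    exact ⟨k, by linarith⟩
  have hr3 : r ≤ 1 / 3 := by
    obtain ⟨z, hz⟩ : ∃ z : Fin m, z ≠ y := by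
      have : Nontrivial (Fin m) := Fin.nontrivial_iff_two_le.2 (by omega)
      exact exists_ne y
    obtain ⟨k, hk⟩ := hthree u hu.1 z hz
    rw [hu.2] at hk
    linarith [hx y, hx z, hx k]
  set c := 1 - δ - η with hc
  have hc0 : 0 < c := by linarith
  set e := max 0 (u y - c) with he
  have he0 : 0 ≤ e := le_max_left _ _
  set q := e / ((m : ℝ) - 1) with hq
  have hq0 : 0 ≤ q := div_nonneg he0 hm1.le
  have hqe : q * ((m : ℝ) - 1) = e := div_mul_cancel₀ _ hm1.ne'
  set w : Fin m → ℝ := fun z => if z = y then u y - e else u z + q with hw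
  have hwy : w y = u y - e := by simp [hw]
  -- The excess `e` of the largest component over `c` is shared equally by the others. The squared
  -- error is `e² + (m - 1) (e / (m - 1))²`.
  have hwz : ∀ z, z ≠ y → w z = u z + q := fun z hz => by simp [hw, hz]
  have hwyc : w y ≤ c := by rw [hwy]; linarith [le_max_right 0 (u y - c)]
  have hwr : ∀ z, z ≠ y → r ≤ w z := fun z hz => by rw [hwz z hz]; linarith [hx z]
  have hwy0 : 0 < w y := by
    rw [hwy]
    rcases max_choice 0 (u y - c) with h | h
    · rw [he, h]; linarith [hpos y]
    · rw [he, h]; linarith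
  have hw0 : ∀ z, 0 < w z := by
    intro z
    by_cases hz : z = y
    · rw [hz]; exact hwy0
    · exact hr0.trans_le (hwr z hz)
  have hsum : ∑ z, w z = 1 := by
    have h1 : ∀ z, w z = u z + q - if z = y then e + q else 0 := by
      intro z
      by_cases hz : z = y
      · rw [hz, hwy, if_pos rfl]; ring
      · rw [hwz z hz, if_neg hz]; ring
    simp_rw [h1]
    rw [Finset.sum_sub_distrib, Finset.sum_add_distrib, hu.2]
    simp
    linarith
  have hsq : ∑ z, (w z - u z) ^ 2 = (1 + 1 / ((m : ℝ) - 1)) * e ^ 2 := by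
    have h1 : ∀ z, (w z - u z) ^ 2 = q ^ 2 + if z = y then e ^ 2 - q ^ 2 else 0 := by
      intro z
      by_cases hz : z = y
      · rw [hz, hwy, if_pos rfl]; ring
      · rw [hwz z hz, if_neg hz]; ring
    simp_rw [h1]
    rw [Finset.sum_add_distrib]
    simp
    rw [← hqe]
    field_simp
    ring
  have hlt : ∀ z, w z < 1 - δ := by
    intro z
    by_cases hz : z = y
    · rw [hz]; linarith
    · rcases le_or_gt (u y) c with h | h
      · have h1 : e = 0 := max_eq_left (by linarith)
        have h2 : q = 0 := by rw [hq, h1, zero_div]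
        rw [hwz z hz, h2]
        linarith [hy z]
      · have h1 : e = u y - c := max_eq_right (by linarith)
        -- Here the component `y` is exactly `c`. A third component of at least `r` leaves `w z ≤ 1
        -- - c - r = δ + η - r`, which is below `1 - δ`.
        obtain ⟨k, hk⟩ := hthree w (fun z => (hw0 z).le) z hz
        have hkr : min c r ≤ w k := by
          by_cases hky : k = y
          · rw [hky, hwy, h1]; exact (min_le_left _ _).trans (by linarith)
          · exact (min_le_right _ _).trans (hwr k hky)
        have hcr : r ≤ c := by linarith
        rw [min_eq_right hcr] at hkr
        rw [hsum, hwy, h1] at hk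
        linarith
  obtain ⟨z, hz⟩ := Finite.exists_max w
  obtain ⟨v, hv, hv2⟩ := exists_halfspace_gt μ (by omega) hμ (hlt z)
  obtain ⟨X, hX, hXw⟩ := exists_question_measureReal_eq μ hd hm hμ hv hw0 hsum
    fun i => (hz i).trans_lt hv2
  refine ⟨X, hX, ?_⟩
  simp_rw [hXw]
  rw [hsq]
  have heσ : e ≤ shortfall u ε μ := by
    rw [shortfall, hsup, max_comm]
    exact max_le_max_left 0 (by linarith)
  exact mul_le_mul_of_nonneg_left (pow_le_pow_left₀ he0 heσ 2) (by positivity)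

theorem exists_question_sq_le (hd : 2 ≤ d) (hμ : μ ≪ volume) {u : Fin m → ℝ}
    (hu : u ∈ stdSimplex ℝ (Fin m)) (hpos : ∀ z, 0 < u z) {ε : ℝ}
    (hε : (m = 2 ∧ ε = 0) ∨ (2 < m ∧ 0 < ε)) :
    ∃ X : Fin m → EuclideanSpace ℝ (Fin d), Function.Injective X ∧
      ∑ z, (μ.real (region X z) - u z) ^ 2 ≤
        (1 + 1 / ((m : ℝ) - 1)) * shortfall u ε μ ^ 2 := by
  rcases hε with ⟨rfl, rfl⟩ | ⟨hm, hε⟩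
  · obtain ⟨X, hX, h⟩ := exists_binary_question_sq_le μ hd hμ hu
    exact ⟨X, hX, h.trans_eq (by norm_num)⟩
  · exact exists_multiple_question_sq_le μ hd hm hμ hu hpos hε

end Depth

/-! ### Construction and performance of the policy -/

section Policy

variable {d m : ℕ} {𝒴 : Type*} [MeasurableSpace 𝒴] {ν : Measure 𝒴}
  (f : NoiseChannel m ν)
  (μ : Measure (EuclideanSpace ℝ (Fin d)))

/-- Only the questions of earlier epochs enter, so changing the question of epoch `n` leaves the
belief at that epoch intact. -/
theorem likelihood_congr {π π' : Policy d m 𝒴} {s s' : ℕ → unitInterval} {n : ℕ}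
    (h : ∀ k < n, π.ask k s = π'.ask k s') (θ : EuclideanSpace ℝ (Fin d)) (y : Fin n → 𝒴) :
    likelihood f π s θ y = likelihood f π' s' θ y :=
  Finset.prod_congr rfl fun k _ => by rw [h k k.isLt]

theorem posterior_congr {π π' : Policy d m 𝒴} {s s' : ℕ → unitInterval} {n : ℕ}
    (h : ∀ k < n, π.ask k s = π'.ask k s') (y : Fin n → 𝒴) :
    posterior f μ π s y = posterior f μ π' s' y := by
  simp only [posterior, likelihood_congr f h]

theorem evidence_congr {π π' : Policy d m 𝒴} {s s' : ℕ → unitInterval} {n : ℕ}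
    (h : ∀ k < n, π.ask k s = π'.ask k s') (y : Fin n → 𝒴) :
    evidence f μ π s y = evidence f μ π' s' y := by
  simp only [evidence, likelihood_congr f h]

theorem jointLaw_congr {π π' : Policy d m 𝒴} {s s' : ℕ → unitInterval} {n : ℕ}
    (h : ∀ k < n, π.ask k s = π'.ask k s') : jointLaw f μ π s n = jointLaw f μ π' s' n := by
  simp only [jointLaw, likelihood_congr f h]

/-- Replace the question that the policy `π` asks after `n` signals. -/
def Policy.updateAsk (π : Policy d m 𝒴) (n : ℕ) (q : (Fin n → 𝒴) → Fin m → EuclideanSpace ℝ (Fin d))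
    (hq : Measurable q) : Policy d m 𝒴 where
  ask := Function.update π.ask n fun _ y => q y
  measurable_ask k := by
    by_cases hk : k = n
    · subst hk
      rw [Function.update_self]
      exact hq.comp measurable_snd
    · rw [Function.update_of_ne hk]
      exact π.measurable_ask k

/-- The policy does not use the randomization. -/
def Policy.IsDeterministic (π : Policy d m 𝒴) : Prop := ∀ k s t, π.ask k s = π.ask k t

/-- After `k` signals the policy asks a question whose predictive distribution is as close to `u`
as the shortfall of the posterior permits. -/
def IsNearOptimal (u : Fin m → ℝ) (ε : ℝ) (π : Policy d m 𝒴) (k : ℕ) : Prop :=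
  ∀ s (y : Fin k → 𝒴), evidence f μ π s y ≠ 0 → evidence f μ π s y ≠ ∞ →
    ∑ z, (predictive f μ π s y z - u z) ^ 2 ≤
      (1 + 1 / ((m : ℝ) - 1)) * shortfall u ε (posterior f μ π s y) ^ 2

variable [SigmaFinite ν] [IsProbabilityMeasure μ]

theorem measurable_shortfall_posterior (hd : 0 < d) (hμ : μ ≪ volume) (u : Fin m → ℝ) (ε : ℝ)
    (π : Policy d m 𝒴) (s : ℕ → unitInterval) (n : ℕ) :
    Measurable fun y : Fin n → 𝒴 => shortfall u ε (posterior f μ π s y) := by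
  unfold shortfall
  have hA : ∀ A, MeasurableSet A → Measurable fun y : Fin n → 𝒴 => posterior f μ π s y A := by
    intro A hA
    have h1 := measurable_posterior_apply f μ π s (n := n) (A := Prod.fst ⁻¹' A)
      (measurable_fst hA)
    exact h1
  have h := measurable_halfspaceDepth hd (fun y : Fin n → 𝒴 => posterior f μ π s y)
    (fun y => (posterior_absolutelyContinuous f μ π s y).trans hμ) hA
  exact (((h.const_sub 1).const_sub _).add_const _).max measurable_const

/-- The error minus its bound is measurable in the history and continuous in an injective question,
and `exists_question_sq_le` makes it nonpositive somewhere; the selection theorem applies. -/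
theorem exists_measurable_question (hd : 2 ≤ d) (hm : 0 < m) (hμ : μ ≪ volume) {u : Fin m → ℝ}
    (hu : u ∈ stdSimplex ℝ (Fin m)) (hpos : ∀ z, 0 < u z) {ε : ℝ}
    (hε : (m = 2 ∧ ε = 0) ∨ (2 < m ∧ 0 < ε)) (π : Policy d m 𝒴) (s : ℕ → unitInterval) (n : ℕ) :
    ∃ q : (Fin n → 𝒴) → Fin m → EuclideanSpace ℝ (Fin d), Measurable q ∧
      ∀ y, evidence f μ π s y ≠ 0 → evidence f μ π s y ≠ ∞ →
        ∑ z, ((posterior f μ π s y).real (region (q y) z) - u z) ^ 2 ≤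
          (1 + 1 / ((m : ℝ) - 1)) * shortfall u ε (posterior f μ π s y) ^ 2 := by
  have hne : Nonempty {X : Fin m → EuclideanSpace ℝ (Fin d) // Function.Injective X} := by
    obtain ⟨X, hX, -⟩ := exists_question_sq_le μ hd hμ hu hpos hε
    exact ⟨⟨X, hX⟩⟩
  have hlc : LocallyCompactSpace
      {X : Fin m → EuclideanSpace ℝ (Fin d) // Function.Injective X} :=
    isOpen_setOf_injective.locallyCompactSpace
  set F : (Fin n → 𝒴) → {X : Fin m → EuclideanSpace ℝ (Fin d) // Function.Injective X} → ℝ :=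
    fun y X => ∑ z, ((posterior f μ π s y).real (region X.1 z) - u z) ^ 2 -
      (1 + 1 / ((m : ℝ) - 1)) * shortfall u ε (posterior f μ π s y) ^ 2
  have hFm : ∀ X, Measurable fun y => F y X := by
    intro X
    have h1 : ∀ z, Measurable fun y : Fin n → 𝒴 =>
        (posterior f μ π s y).real (region X.1 z) := by
      intro z
      have h2 := measurable_posterior_apply f μ π s (n := n) (A := Prod.fst ⁻¹' region X.1 z)
        (measurable_fst (measurableSet_region X.1 z))
      exact h2.ennreal_toReal
    exact (Finset.measurable_sum _ fun z _ => ((h1 z).sub_const _).pow_const 2).sub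
      (((measurable_shortfall_posterior f μ (by omega) hμ u ε π s n).pow_const 2).const_mul _)
  have hFc : ∀ y, Continuous (F y) := by
    intro y
    refine Continuous.sub (continuous_finsetSum _ fun z _ => ?_) continuous_const
    refine ((continuous_iff_continuousAt.2 fun X => ?_).sub continuous_const).pow 2
    have h1 := continuousAt_measureReal_region hm (posterior f μ π s y)
      ((posterior_absolutelyContinuous f μ π s y).trans hμ) z X.2
    exact h1.comp continuous_subtype_val.continuousAt
  obtain ⟨sel, hsel, hsel'⟩ := exists_measurable_selection F hFm hFc
  refine ⟨fun y => (sel y).1, measurable_subtype_coe.comp hsel, fun y h0 ht => ?_⟩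
  have := isProbabilityMeasure_posterior f μ π s h0 ht
  obtain ⟨X, hX, hXle⟩ := exists_question_sq_le (posterior f μ π s y) hd
    ((posterior_absolutelyContinuous f μ π s y).trans hμ) hu hpos hε
  exact sub_nonpos.1 (hsel' y ⟨⟨X, hX⟩, sub_nonpos.2 hXle⟩)

/-- Induction over epochs, replacing one question at a time. Keeping the policy deterministic means
that a fixed seed suffices for the selection, so measurability in the seed is trivial. -/
theorem exists_policy_isNearOptimal (hd : 2 ≤ d) (hm : 0 < m) (hμ : μ ≪ volume) {u : Fin m → ℝ}
    (hu : u ∈ stdSimplex ℝ (Fin m)) (hpos : ∀ z, 0 < u z) {ε : ℝ}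
    (hε : (m = 2 ∧ ε = 0) ∨ (2 < m ∧ 0 < ε)) (n : ℕ) :
    ∃ π : Policy d m 𝒴, π.IsDeterministic ∧ ∀ k < n, IsNearOptimal f μ u ε π k := by
  induction n with
  | zero =>
    exact ⟨⟨fun _ _ _ _ => 0, fun _ => measurable_const⟩, fun _ _ _ => rfl,
      fun k hk => absurd hk (Nat.not_lt_zero k)⟩
  | succ n ih =>
    obtain ⟨π, hdet, hπ⟩ := ih
    obtain ⟨q, hq, hq'⟩ := exists_measurable_question f μ hd hm hμ hu hpos hε π (fun _ => 0) n
    set π' := π.updateAsk n q hq with hπ'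
    have hlt : ∀ k, k ≠ n → ∀ s s', π'.ask k s = π.ask k s' := by
      intro k hk s s'
      rw [hdet k s' s]
      change Function.update π.ask n _ k s = _
      rw [Function.update_of_ne hk]
    have hn : ∀ s y, π'.ask n s y = q y := by
      intro s y
      change Function.update π.ask n _ n s y = _
      rw [Function.update_self]
    refine ⟨π', fun k s s' => ?_, fun k hk s y h0 ht => ?_⟩
    · by_cases hk : k = n
      · subst hk
        funext y
        rw [hn, hn]
      · rw [hlt k hk s s, hlt k hk s' s]
    · rcases (Nat.lt_succ_iff.1 hk).eq_or_lt with rfl | hkn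
      · have hag : ∀ j < k, π'.ask j s = π.ask j fun _ => 0 := fun j hj => hlt j hj.ne _ _
        rw [evidence_congr f μ hag] at h0 ht
        have h1 := hq' y h0 ht
        simp only [predictive, hn]
        rwa [posterior_congr f μ hag]
      · have hag : ∀ j < k, π'.ask j s = π.ask j s := fun j hj => hlt j (hj.trans hkn).ne _ _
        rw [evidence_congr f μ hag] at h0 ht
        have h1 := hπ k hkn s y h0 ht
        simp only [predictive, hlt k hkn.ne s s] at h1 ⊢
        rwa [posterior_congr f μ hag]

theorem expectedInfo_of_isDeterministic (hf : f.FiniteEntropy) (hm : 0 < m) {π : Policy d m 𝒴}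
    (hπ : π.IsDeterministic) (s : ℕ → unitInterval) (K : ℕ) :
    expectedInfo f μ K π = ENNReal.ofReal (∑ k ∈ Finset.range K,
      ∫ y, channelFun f (predictive f μ π s y) ∂(signalLaw f μ π s k)) := by
  rw [← klDiv_jointLaw_div_log_two f μ π s hf hm, expectedInfo]
  have h : ∀ s', jointLaw f μ π s' K = jointLaw f μ π s K := fun s' =>
    jointLaw_congr f μ fun k _ => hπ k s' s
  simp only [signalLaw, h, lintegral_const, measure_univ, mul_one]

theorem expectedSqShortfall_of_isDeterministic {π : Policy d m 𝒴} (hπ : π.IsDeterministic)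
    (s : ℕ → unitInterval) (u : Fin m → ℝ) (ε : ℝ) (k : ℕ) :
    expectedSqShortfall f μ u ε π k =
      ∫ y, (shortfall u ε (posterior f μ π s y)) ^ 2 ∂(signalLaw f μ π s k) := by
  have h : ∀ s', jointLaw f μ π s' k = jointLaw f μ π s k := fun s' =>
    jointLaw_congr f μ fun k _ => hπ k s' s
  have h2 : ∀ s' (y : Fin k → 𝒴), posterior f μ π s' y = posterior f μ π s y := fun s' y =>
    posterior_congr f μ (fun k _ => hπ k s' s) y
  simp only [expectedSqShortfall, signalLaw, h, h2, integral_const, probReal_univ, one_smul]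

theorem shortfall_le (hd : 0 < d) {ρ : Measure (EuclideanSpace ℝ (Fin d))}
    [IsProbabilityMeasure ρ] (hρ : ρ ≪ volume) (u : Fin m → ℝ) (ε : ℝ) :
    shortfall u ε ρ ≤ max ((⨆ z, u z) - 1 / 2 + ε) 0 :=
  max_le_max_right 0 (by linarith [halfspaceDepth_le_half ρ hd hρ])

theorem ae_sq_shortfall_le (hd : 0 < d) (hm : 0 < m) (hμ : μ ≪ volume) (u : Fin m → ℝ) (ε : ℝ)
    (π : Policy d m 𝒴) (s : ℕ → unitInterval) (k : ℕ) :
    ∀ᵐ y ∂(signalLaw f μ π s k), (shortfall u ε (posterior f μ π s y)) ^ 2 ≤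
      (max ((⨆ z, u z) - 1 / 2 + ε) 0) ^ 2 := by
  filter_upwards [ae_signalLaw_evidence f μ π s hm k] with y hy
  have := isProbabilityMeasure_posterior f μ π s hy.1 hy.2
  exact pow_le_pow_left₀ (le_max_right _ _)
    (shortfall_le hd ((posterior_absolutelyContinuous f μ π s y).trans hμ) u ε) 2

theorem integrable_sq_shortfall (hd : 0 < d) (hm : 0 < m) (hμ : μ ≪ volume) (u : Fin m → ℝ)
    (ε : ℝ) (π : Policy d m 𝒴) (s : ℕ → unitInterval) (k : ℕ) :
    Integrable (fun y => (shortfall u ε (posterior f μ π s y)) ^ 2) (signalLaw f μ π s k) := by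
  have := isProbabilityMeasure_signalLaw f μ π s hm k
  refine Integrable.mono' (integrable_const ((max ((⨆ z, u z) - 1 / 2 + ε) 0) ^ 2))
    ((measurable_shortfall_posterior f μ hd hμ u ε π s k).pow_const 2).aestronglyMeasurable ?_
  filter_upwards [ae_sq_shortfall_le f μ hd hm hμ u ε π s k] with y hy
  rwa [Real.norm_of_nonneg (sq_nonneg _)]

/-- The quadratic bound of the channel gap, applied for each history to the predictive law and then
averaged. -/
theorem capacity_sub_integral_channelFun_le (hf : f.FiniteEntropy) (hd : 0 < d) (hm : 2 ≤ m)
    (hμ : μ ≪ volume) {u : Fin m → ℝ} {ε R : ℝ} (hR : R ∈ quadraticBounds f u)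
    {π : Policy d m 𝒴} {k : ℕ} (hπ : IsNearOptimal f μ u ε π k) (s : ℕ → unitInterval) :
    capacity f - ∫ y, channelFun f (predictive f μ π s y) ∂(signalLaw f μ π s k) ≤
      R * (1 + 1 / ((m : ℝ) - 1)) *
        ∫ y, (shortfall u ε (posterior f μ π s y)) ^ 2 ∂(signalLaw f μ π s k) := by
  have hm0 : 0 < m := by omega
  have := isProbabilityMeasure_signalLaw f μ π s hm0 k
  have hi := integrable_channelFun_predictive f μ π s hf hm0 k
  have h1 : capacity f - ∫ y, channelFun f (predictive f μ π s y) ∂(signalLaw f μ π s k) =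
      ∫ y, (capacity f - channelFun f (predictive f μ π s y)) ∂(signalLaw f μ π s k) := by
    rw [integral_sub (integrable_const _) hi]
    simp
  rw [h1, ← integral_const_mul]
  refine integral_mono_ae ((integrable_const _).sub hi)
    ((integrable_sq_shortfall f μ hd hm0 hμ u ε π s k).const_mul _) ?_
  filter_upwards [ae_signalLaw_evidence f μ π s hm0 k] with y hy
  have h2 := hR.2 _ (predictive_mem_stdSimplex f μ π s hm0 hy.1 hy.2)
  have h3 := mul_le_mul_of_nonneg_left (hπ s y hy.1 hy.2) hR.1
  linarith

end Policy

end PreferenceLearning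

end

/-! ### Main theorem -/

open PreferenceLearning in
theorem mainTheorem4 {d m : ℕ} (hd : 2 ≤ d) (hm : 2 ≤ m)
    {𝒴 : Type*} [MeasurableSpace 𝒴] (ν : Measure 𝒴) [SigmaFinite ν]
    (f : NoiseChannel m ν)
    (hf : ∀ z, Integrable (fun y => f.dens z y * Real.logb 2 (f.dens z y)) ν)
    (μ : Measure (EuclideanSpace ℝ (Fin d))) [IsProbabilityMeasure μ] (hμ : μ ≪ volume)
    (ustar : Fin m → ℝ) (hmem : ustar ∈ stdSimplex ℝ (Fin m)) (hpos : ∀ z, 0 < ustar z)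
    (hopt : channelFun f ustar = capacity f)
    (ε : ℝ) (hε : (m = 2 ∧ ε = 0) ∨ (2 < m ∧ 0 < ε)) (K : ℕ) :
    IsLeast (quadraticBounds f ustar) (gapConst f ustar) ∧
    (⨆ π : Policy d m 𝒴, expectedInfo f μ K π) ≤ ENNReal.ofReal (K * capacity f) ∧
    ∃ π : Policy d m 𝒴,
      K * capacity f - (⨆ π' : Policy d m 𝒴, expectedInfo f μ K π').toReal
          ≤ K * capacity f - (expectedInfo f μ K π).toReal ∧
      K * capacity f - (expectedInfo f μ K π).toReal
          ≤ gapConst f ustar * (1 + 1 / ((m : ℝ) - 1)) *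
              ∑ k ∈ Finset.range K, expectedSqShortfall f μ ustar ε π k ∧
      gapConst f ustar * (1 + 1 / ((m : ℝ) - 1)) *
            ∑ k ∈ Finset.range K, expectedSqShortfall f μ ustar ε π k
          ≤ K * (gapConst f ustar * (1 + 1 / ((m : ℝ) - 1)) *
              (max ((⨆ z, ustar z) - 1 / 2 + ε) 0) ^ 2) := by
  have hm0 : 0 < m := by omega
  have hd0 : 0 < d := by omega
  have hent : f.FiniteEntropy := fun z => by
    refine ((hf z).const_mul (Real.log 2)).congr (Filter.Eventually.of_forall fun y => ?_)
    have := (Real.log_pos one_lt_two).ne'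
    simp only [Real.logb]
    field_simp
  have hleast := isLeast_gapConst hent hmem hpos hopt
  have hsup : (⨆ π : Policy d m 𝒴, expectedInfo f μ K π) ≤ ENNReal.ofReal (K * capacity f) :=
    iSup_le fun π => expectedInfo_le f μ π hent hm0 K
  obtain ⟨π, hdet, hπ⟩ := exists_policy_isNearOptimal f μ hd hm0 hμ hmem hpos hε K
  -- An arbitrary seed: the policy ignores it.
  set s : ℕ → unitInterval := fun _ => 0
  have hm1 : (0 : ℝ) < (m : ℝ) - 1 := by
    have : (2 : ℝ) ≤ m := by exact_mod_cast hm
    linarith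
  have hc : 0 ≤ gapConst f ustar * (1 + 1 / ((m : ℝ) - 1)) :=
    mul_nonneg hleast.1.1 (by positivity)
  refine ⟨hleast, hsup, π, ?_, ?_, ?_⟩
  · exact sub_le_sub_left (ENNReal.toReal_mono (ne_top_of_le_ne_top ENNReal.ofReal_ne_top hsup)
      (le_iSup (fun π : Policy d m 𝒴 => expectedInfo f μ K π) π)) _
  -- Nonnegativity of the summands ensures that passing through `ENNReal.ofReal` loses nothing.
  · have h1 : ∀ k, 0 ≤ ∫ y, channelFun f (predictive f μ π s y) ∂(signalLaw f μ π s k) := by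
      intro k
      refine integral_nonneg_of_ae ?_
      filter_upwards [ae_signalLaw_evidence f μ π s hm0 k] with y hy
      exact channelFun_nonneg hent (predictive_mem_stdSimplex f μ π s hm0 hy.1 hy.2)
    rw [expectedInfo_of_isDeterministic f μ hent hm0 hdet s,
      ENNReal.toReal_ofReal (Finset.sum_nonneg fun k _ => h1 k), Finset.mul_sum]
    have h2 : (K : ℝ) * capacity f = ∑ k ∈ Finset.range K, capacity f := by simp
    rw [h2, ← Finset.sum_sub_distrib]
    refine Finset.sum_le_sum fun k hk => ?_
    rw [expectedSqShortfall_of_isDeterministic f μ hdet s]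
    exact capacity_sub_integral_channelFun_le f μ hent hd0 hm hμ hleast.1
      (hπ k (Finset.mem_range.1 hk)) s
  · rw [mul_left_comm]
    refine mul_le_mul_of_nonneg_left ?_ hc
    rw [← nsmul_eq_mul]
    conv_rhs => rw [← Finset.card_range K, ← Finset.sum_const]
    refine Finset.sum_le_sum fun k _ => ?_
    have := isProbabilityMeasure_signalLaw f μ π s hm0 k
    rw [expectedSqShortfall_of_isDeterministic f μ hdet s]
    calc _ ≤ ∫ _, (max ((⨆ z, ustar z) - 1 / 2 + ε) 0) ^ 2 ∂(signalLaw f μ π s k) :=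
          integral_mono_ae (integrable_sq_shortfall f μ hd0 hm0 hμ ustar ε π s k)
            (integrable_const _) (ae_sq_shortfall_le f μ hd0 hm0 hμ ustar ε π s k)
      _ = _ := by simp
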